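/- **Setting.** Let $L>0$, let $n\ge 1$ be an integer, and let $v_1,\dots,v_n:\mathbb R\to\mathbb R$ be continuous. Divide the ring $(0,L]$ into the boxes $B_b=\left(\tfrac{(b-1)L}{n},\tfrac{bL}{n}\right]$, $b=1,\dots,n$. For an even number $N$ of particles let $\mathcal H_N$ be the space of symmetric functions in $L^2((0,L]^N)$. The Hamiltonian of hardcore bosons in the potential $v(t)$ is $$H(t)=-\sum_{j=1}^N\partial_{x_j}^2+\sum_{j=1}^N\sum_{b=1}^n v_b(t)\,\mathbf 1_{B_b}(x_j),$$ acting off the coincidence points on the core of functions $f(x)=g(x)\prod_{i<j}\operatorname{sgn}(x_i-x_j)$, where $g:\mathbb R^N\to\mathbb C$ is $C^2$, antisymmetric, and changes sign when one coordinate is shifted by $L$ (which makes $f$ periodic on the ring, since $N$ is even). The evolution operator $U(t)=\mathcal T\exp\left(-i\int_0^tH(s)\,ds\right)$, $t\in\mathbb R$, is the strongly continuous family of bounded operators on $\mathcal H_N$ with $U(0)=1$ and $\partial_t\langle f,U(t)\Psi\rangle=-i\langle H(t)f,U(t)\Psi\rangle$ for all $\Psi\in\mathcal H_N$ and all $f$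 in the core. Let $K=\{\tfrac{2\pi(m+1/2)}{L}:m\in\mathbb Z\}$ and $K_\otimes=\{(\tfrac{2\pi nm}{L},b):m\in\mathbb Z,\ 1\le b\le n\}$. For $\bar\alpha\in K_\otimes$ write $\alpha$ for its momentum and $b(\bar\alpha)$ for its box. Let $\bar\alpha_1,\dots,\bar\alpha_N\in K_\otimes$ be distinct. For each box $b$ let $J_b=\{j:b(\bar\alpha_j)=b\}$ and $N_b=|J_b|$. The wavelet state $|\bar{\boldsymbol\alpha}\rangle\in\mathcal H_N$ is the tensor product of the box eigenstates: its wave function is $\frac1{\sqrt{N!}}\sum_{\kappa\in\mathfrak S_N}\chi(x_{\kappa 1},\dots,x_{\kappa N})$ with $$\chi(x)=\prod_{b=1}^n\left[\frac{(n/L)^{N_b/2}}{N_b!}\sum_{\sigma\in\mathfrak S(J_b)}(-1)^\sigma e^{\,i\sum_{j\in J_b}x_j\alpha_{\sigma j}}\prod_{i<j\in J_b}\operatorname{sgn}(x_i-x_j)\prod_{j\in J_b}\mathbf 1_{B_b}(x_j)\right].$$ For $\lambda\in K$ and $\bar\alpha,\bar\beta\in K_\otimes$ put $$\varphi(\lambda,\bar\alpha)=\frac{i\sqrt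 n}{L}\cdot\frac{1-e^{iL\lambda/n}}{\lambda-\alpha}\,e^{-iL\,b(\bar\alpha)\lambda/n},\qquad G_t(\bar\alpha,\bar\beta)=\sum_{\lambda\in K}\varphi(\lambda,\bar\alpha)^*\varphi(\lambda,\bar\beta)e^{-it\lambda^2},$$ $$U_t(\bar\alpha,\bar\beta)=\sum_{\bar\gamma\in K_\otimes}G_{-t}(\bar\alpha,\bar\gamma)\,v_{b(\bar\gamma)}(t)\,G_t(\bar\gamma,\bar\beta).$$ **Theorem 1 (Form factors of $U(t)$).** The series defining $G_t$ and $U_t$ converge absolutely. There is exactly one function $\tilde\psi_t(\bar\alpha,\bar\beta)$ of $t\in\mathbb R$ and $\bar\alpha,\bar\beta\in K_\otimes$ such that for each $\bar\beta$ the sum $\sum_{\bar\alpha}|\tilde\psi_t(\bar\alpha,\bar\beta)|^2$ is bounded on bounded time intervals, and $$\partial_t\tilde\psi_t(\bar\alpha,\bar\beta)=-i\sum_{\bar\nu\in K_\otimes}U_t(\bar\alpha,\bar\nu)\tilde\psi_t(\bar\nu,\bar\beta),\qquad\tilde\psi_0(\bar\alpha,\bar\beta)=\delta_{\bar\alpha,\bar\beta}.$$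 The series in this equation, and the series $$\psi_t(\bar\alpha,\bar\beta)=\sum_{\bar\gamma\in K_\otimes}G_t(\bar\alpha,\bar\gamma)\tilde\psi_t(\bar\gamma,\bar\beta),$$ converge absolutely. For every even $N$ the evolution operator $U(t)$ on $\mathcal H_N$ exists and is unique. For all $t\in\mathbb R$ and all wavelet states $|\bar{\boldsymbol\alpha}\rangle,|\bar{\boldsymbol\beta}\rangle$ of $N$ particles, with labels listed so that $b(\bar\alpha_1)\ge\dots\ge b(\bar\alpha_N)$ and $b(\bar\beta_1)\ge\dots\ge b(\bar\beta_N)$, $$\langle\bar{\boldsymbol\alpha}|U(t)|\bar{\boldsymbol\beta}\rangle=\det_{1\le i,j\le N}\psi_t(\bar\alpha_i,\bar\beta_j).$$ -/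

import Mathlib

open MeasureTheory Complex
open scoped ComplexConjugate

noncomputable section

namespace HardcoreBosons

/-! ## The bosonic Hilbert space -/

/-- Lebesgue measure on the configurations of `N` particles on the ring `(0, L]` of length `L`. -/
def ringMeasure (L : ℝ) (N : ℕ) : Measure (Fin N → ℝ) :=
  Measure.pi fun _ => (volume : Measure ℝ).restrict (Set.Ioc 0 L)

instance ringMeasure_isFinite (L : ℝ) (N : ℕ) : IsFiniteMeasure (ringMeasure L N) := by
  unfold ringMeasure
  infer_instance

theorem measurePreserving_perm (L : ℝ) {N : ℕ} (σ : Equiv.Perm (Fin N)) :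
    MeasurePreserving (fun x : Fin N → ℝ => x ∘ σ) (ringMeasure L N) (ringMeasure L N) := by
  have h := measurePreserving_piCongrLeft
    (fun _ : Fin N => (volume : Measure ℝ).restrict (Set.Ioc 0 L)) σ.symm
  have e : (fun x : Fin N → ℝ => x ∘ σ) =
      (MeasurableEquiv.piCongrLeft (fun _ : Fin N => ℝ) σ.symm) := by
    funext x i
    have := MeasurableEquiv.piCongrLeft_apply_apply (β := fun _ : Fin N => ℝ) σ.symm x (σ i)
    simpa using this.symm
  rw [e]
  exact h

/-- The Hilbert space of `N` bosons on the ring: the square integrable wave functions that are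
symmetric under permutations of the particles. -/
def BosonSpace (L : ℝ) (N : ℕ) : Submodule ℂ (Lp ℂ 2 (ringMeasure L N)) where
  carrier := {f | ∀ σ : Equiv.Perm (Fin N),
    (fun x => f (x ∘ σ)) =ᵐ[ringMeasure L N] fun x => f x}
  zero_mem' := by
    intro σ
    have h := Lp.coeFn_zero ℂ 2 (ringMeasure L N)
    have h' := (measurePreserving_perm L σ).quasiMeasurePreserving.ae h
    filter_upwards [h, h'] with x hx hx'
    rw [hx, hx']
    rfl
  add_mem' := by
    intro f g hf hg σ
    have h := Lp.coeFn_add f g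
    have h' := (measurePreserving_perm L σ).quasiMeasurePreserving.ae h
    filter_upwards [h, h', hf σ, hg σ] with x hx hx' h1 h2
    rw [hx, hx', Pi.add_apply, Pi.add_apply, h1, h2]
  smul_mem' := by
    intro c f hf σ
    have h := Lp.coeFn_smul c f
    have h' := (measurePreserving_perm L σ).quasiMeasurePreserving.ae h
    filter_upwards [h, h', hf σ] with x hx hx' h1
    rw [hx, hx', Pi.smul_apply, Pi.smul_apply, h1]

/-- The normalised `N`-particle wave function of the Fock space vector
`∫ dx₁ ⋯ dx_N χ(x₁, …, x_N) φ†(x₁) ⋯ φ†(x_N) |0⟩`. -/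
def bosonize {N : ℕ} (χ : (Fin N → ℝ) → ℂ) (x : Fin N → ℝ) : ℂ :=
  (((Real.sqrt (N.factorial : ℝ))⁻¹ : ℝ) : ℂ) * ∑ κ : Equiv.Perm (Fin N), χ (x ∘ κ)

theorem memLp_bosonize {L : ℝ} {N : ℕ} {χ : (Fin N → ℝ) → ℂ}
    (h : MemLp χ 2 (ringMeasure L N)) : MemLp (bosonize χ) 2 (ringMeasure L N) := by
  unfold bosonize
  refine MemLp.const_mul ?_ _
  refine memLp_finsetSum _ fun κ _ => ?_
  exact h.comp_measurePreserving (measurePreserving_perm L κ)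

theorem bosonize_perm {N : ℕ} (χ : (Fin N → ℝ) → ℂ) (σ : Equiv.Perm (Fin N)) (x : Fin N → ℝ) :
    bosonize χ (x ∘ σ) = bosonize χ x := by
  unfold bosonize
  congr 1
  exact Fintype.sum_equiv (Equiv.mulLeft σ) _ _ fun κ => rfl

/-- The vector `∫ dx₁ ⋯ dx_N χ(x₁, …, x_N) φ†(x₁) ⋯ φ†(x_N) |0⟩` of the `N`-boson space. -/
def ket {L : ℝ} {N : ℕ} (χ : (Fin N → ℝ) → ℂ) (h : MemLp χ 2 (ringMeasure L N)) :
    BosonSpace L N :=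
  ⟨(memLp_bosonize h).toLp (bosonize χ), by
    intro σ
    have h1 := (memLp_bosonize h).coeFn_toLp
    have h2 := (measurePreserving_perm L σ).quasiMeasurePreserving.ae h1
    filter_upwards [h1, h2] with x hx hx'
    rw [hx, hx', bosonize_perm]⟩

/-! ## Wavelet states -/

/-- `∏_{i<j} sgn (x_i - x_j)`. -/
def signProd {ι : Type*} [Fintype ι] [LinearOrder ι] (x : ι → ℝ) : ℝ :=
  ∏ p : ι × ι with p.1 < p.2, Real.sign (x p.1 - x p.2)

/-- The amplitude of the hardcore-boson eigenstate with momenta `k` on an interval of length `ℓ`: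
`1 / (M! ℓ^{M/2}) ∑_σ (-1)^σ exp (i ∑_j x_j k_{σ j}) ∏_{i<j} sgn (x_i - x_j)`,
where `M` is the number of particles. -/
def eigenAmplitude (ℓ : ℝ) {ι : Type*} [Fintype ι] [LinearOrder ι] (k x : ι → ℝ) : ℂ :=
  ((((Fintype.card ι).factorial : ℝ) * Real.sqrt ℓ ^ Fintype.card ι : ℝ) : ℂ)⁻¹ *
    (∑ σ : Equiv.Perm ι, ((Equiv.Perm.sign σ : ℤ) : ℂ) *
      Complex.exp (I * ∑ j, (x j : ℂ) * (k (σ j) : ℂ))) * (signProd x : ℂ)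

/-- The set `K_⊗` of wavelet labels: `(m, b)` stands for the momentum `2π n m / L` in the box `b`.
Boxes are numbered from `0`, so the box index `b` here is the `b + 1` of the usual numbering. -/
abbrev WaveletLabel (n : ℕ) : Type := ℤ × Fin n

/-- The momentum `2π n m / L` of a wavelet label. -/
def momentum (L : ℝ) {n : ℕ} (a : WaveletLabel n) : ℝ := 2 * Real.pi * n * a.1 / L

/-- The `b`-th of the `n` boxes of length `L / n`. -/
def box (L : ℝ) (n : ℕ) (b : Fin n) : Set ℝ :=
  Set.Ioc ((b : ℝ) * (L / n)) (((b : ℝ) + 1) * (L / n))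

/-- The amplitude of the wavelet state with labels `α 0, …, α (N - 1)`: the product over the boxes
`b` of the box eigenstate formed by the particles `j` with label in `b`, all of which are located
in `b`. -/
def waveletAmplitude (L : ℝ) {n N : ℕ} (α : Fin N → WaveletLabel n) (x : Fin N → ℝ) : ℂ :=
  ∏ b : Fin n,
    (eigenAmplitude (L / n) (fun j : {j : Fin N // (α j).2 = b} => momentum L (α j))
        (fun j => x j) *
      ∏ j : {j : Fin N // (α j).2 = b}, (box L n b).indicator (fun _ => (1 : ℂ)) (x j))

theorem measurable_sgn : Measurable Real.sign := by
  have h : Real.sign = fun r : ℝ => if r < 0 then (-1 : ℝ) else if 0 < r then 1 else 0 := by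
    funext r
    rfl
  rw [h]
  exact Measurable.ite measurableSet_Iio measurable_const
    (Measurable.ite measurableSet_Ioi measurable_const measurable_const)

theorem norm_sgn_le (r : ℝ) : ‖Real.sign r‖ ≤ 1 := by
  rcases Real.sign_apply_eq r with h | h | h <;> simp [h]

theorem norm_unit_le (u : ℤˣ) : ‖((u : ℤ) : ℂ)‖ ≤ 1 := by
  rcases Int.units_eq_one_or u with h | h <;> simp [h]

theorem measurable_waveletAmplitude (L : ℝ) {n N : ℕ} (α : Fin N → WaveletLabel n) :
    Measurable (waveletAmplitude L α) := by
  unfold waveletAmplitude eigenAmplitude signProd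
  refine Finset.measurable_prod _ fun b _ => Measurable.mul (Measurable.mul (by fun_prop) ?_) ?_
  · refine Complex.measurable_ofReal.comp (Finset.measurable_prod _ fun p _ => ?_)
    exact measurable_sgn.comp (by fun_prop)
  · refine Finset.measurable_prod _ fun j _ => ?_
    exact (measurable_const.indicator measurableSet_Ioc).comp (measurable_pi_apply _)

theorem bounded_waveletAmplitude (L : ℝ) {n N : ℕ} (α : Fin N → WaveletLabel n) :
    ∃ C : ℝ, ∀ x, ‖waveletAmplitude L α x‖ ≤ C := by
  refine ⟨∏ b : Fin n, (‖((((Fintype.card {j : Fin N // (α j).2 = b}).factorial : ℝ) *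
      Real.sqrt (L / n) ^ Fintype.card {j : Fin N // (α j).2 = b} : ℝ) : ℂ)⁻¹‖ *
      (∑ _σ : Equiv.Perm {j : Fin N // (α j).2 = b}, (1 : ℝ)) * 1 * 1), fun x => ?_⟩
  unfold waveletAmplitude
  rw [norm_prod]
  refine Finset.prod_le_prod (fun _ _ => norm_nonneg _) fun b _ => ?_
  rw [norm_mul]
  refine mul_le_mul ?_ ?_ (norm_nonneg _) (by positivity)
  · unfold eigenAmplitude
    rw [norm_mul, norm_mul]
    refine mul_le_mul (mul_le_mul_of_nonneg_left ?_ (norm_nonneg _)) ?_ (norm_nonneg _)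
      (by positivity)
    · refine (norm_sum_le _ _).trans (Finset.sum_le_sum fun σ _ => ?_)
      rw [norm_mul, Complex.norm_exp]
      have h1 : (I * ∑ j : {j : Fin N // (α j).2 = b},
          ((x j : ℝ) : ℂ) * ((momentum L (α (σ j)) : ℝ) : ℂ)).re = 0 := by
        simp [Complex.mul_re, Complex.im_sum]
      rw [h1, Real.exp_zero, mul_one]
      exact norm_unit_le _
    · unfold signProd
      rw [Complex.norm_real, norm_prod]
      exact Finset.prod_le_one (fun _ _ => norm_nonneg _) fun p _ => norm_sgn_le _
  · rw [norm_prod]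
    refine Finset.prod_le_one (fun _ _ => norm_nonneg _) fun j _ => ?_
    by_cases h : (x j : ℝ) ∈ box L n b
    · rw [Set.indicator_of_mem h]; simp
    · rw [Set.indicator_of_notMem h]; simp

theorem memLp_waveletAmplitude (L : ℝ) {n N : ℕ} (α : Fin N → WaveletLabel n) :
    MemLp (waveletAmplitude L α) 2 (ringMeasure L N) := by
  obtain ⟨C, hC⟩ := bounded_waveletAmplitude L α
  exact MemLp.of_bound (measurable_waveletAmplitude L α).aestronglyMeasurable C
    (Filter.Eventually.of_forall hC)

/-- The wavelet state `|α⟩`. -/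
def waveletState (L : ℝ) {n N : ℕ} (α : Fin N → WaveletLabel n) : BosonSpace L N :=
  ket (waveletAmplitude L α) (memLp_waveletAmplitude L α)

/-! ## The Hamiltonian and the evolution operator -/

/-- A core of the hardcore-boson Hamiltonian on the ring. The wave functions are smooth inside each
ordering of the particles and vanish where two particles meet; they are the products of
`∏_{i<j} sgn (x_i - x_j)` with an antisymmetric `C²` function `g`. Periodicity of the bosonic wave
function on the ring means that `g` picks up the sign `(-1)^(N-1)` (written `(-1)^(N+1)`)
when one particle is taken around the ring past the `N - 1` others. -/
def IsHardcoreTest (L : ℝ) {N : ℕ} (f : (Fin N → ℝ) → ℂ) : Prop :=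
  ∃ g : (Fin N → ℝ) → ℂ, ContDiff ℝ 2 g ∧
    (∀ (σ : Equiv.Perm (Fin N)) (x : Fin N → ℝ),
      g (x ∘ σ) = ((Equiv.Perm.sign σ : ℤ) : ℂ) * g x) ∧
    (∀ (j : Fin N) (x : Fin N → ℝ),
      g (Function.update x j (x j + L)) = (-1 : ℂ) ^ (N + 1) * g x) ∧
    ∀ x, f x = (signProd x : ℂ) * g x

/-- The potential energy `∑_j v_{b(x_j)}` of `N` particles, for the potential that is equal to
`w b` on the box `b`. -/
def potential (L : ℝ) {n N : ℕ} (w : Fin n → ℝ) (x : Fin N → ℝ) : ℝ :=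
  ∑ j : Fin N, ∑ b : Fin n, (box L n b).indicator (fun _ => w b) (x j)

/-- The action `-∑_j ∂_j² f + V f` of the Hamiltonian `H_0 + V` on a wave function `f` (used on
the core, where the derivatives exist off the null set of coinciding particles). -/
def hamiltonian (L : ℝ) {n N : ℕ} (w : Fin n → ℝ) (f : (Fin N → ℝ) → ℂ) (x : Fin N → ℝ) : ℂ :=
  -(∑ j : Fin N, iteratedDeriv 2 (fun s : ℝ => f (Function.update x j s)) (x j)) +
    (potential L w x : ℂ) * f x

/-- `U` is the evolution operator (time-ordered exponential) of the time-dependent hardcore-boson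
Hamiltonian `H(t) = H_0 + V(t)`, i.e. `U 0 = 1`, `U` is strongly continuous, and
`i ∂_t U(t) = H(t) U(t)` holds weakly against the core of `H_0`. -/
structure IsEvolutionOperator (L : ℝ) {n : ℕ} (v : Fin n → ℝ → ℝ) (N : ℕ)
    (U : ℝ → BosonSpace L N →L[ℂ] BosonSpace L N) : Prop where
  initial : U 0 = ContinuousLinearMap.id ℂ (BosonSpace L N)
  continuous : ∀ Ψ : BosonSpace L N, Continuous fun t => U t Ψ
  schrodinger : ∀ (Ψ : BosonSpace L N) (f : (Fin N → ℝ) → ℂ), IsHardcoreTest L f → ∀ t : ℝ,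
    HasDerivAt
      (fun s => ∫ x, conj (f x) * (U s Ψ : Lp ℂ 2 (ringMeasure L N)) x ∂(ringMeasure L N))
      (-I * ∫ x, conj (hamiltonian L (fun b => v b t) f x) *
        (U t Ψ : Lp ℂ 2 (ringMeasure L N)) x ∂(ringMeasure L N)) t

/-! ## The single-particle functions -/

/-- The momenta `2π (m + 1/2) / L`, `m ∈ ℤ`, of the set `K` (for an even number of particles). -/
def ringMomentum (L : ℝ) (m : ℤ) : ℝ := 2 * Real.pi * ((m : ℝ) + 1 / 2) / L

/-- `φ(λ, α) = (i √n / L) (1 - e^{i L λ / n}) / (λ - α) e^{-i L b(α) λ / n}`,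
where `b(α) ∈ {1, …, n}`. -/
def overlap (L : ℝ) {n : ℕ} (l : ℝ) (a : WaveletLabel n) : ℂ :=
  I * (Real.sqrt n : ℂ) / (L : ℂ) *
    ((1 - Complex.exp (I * (L : ℂ) * (l : ℂ) / (n : ℂ))) / ((l : ℂ) - (momentum L a : ℂ))) *
    Complex.exp (-(I * (L : ℂ) * (((a.2 : ℕ) : ℂ) + 1) / (n : ℂ) * (l : ℂ)))

/-- The term `φ(λ, α)^* φ(λ, β) e^{-i t λ²}` for the `m`-th element `λ` of `K`. -/
def greenTerm (L : ℝ) {n : ℕ} (t : ℝ) (a c : WaveletLabel n) (m : ℤ) : ℂ :=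
  conj (overlap L (ringMomentum L m) a) * overlap L (ringMomentum L m) c *
    Complex.exp (-(I * (t : ℂ) * (ringMomentum L m : ℂ) ^ 2))

/-- `G_t(α, β) = ∑_{λ ∈ K} φ(λ, α)^* φ(λ, β) e^{-i t λ²}`. -/
def green (L : ℝ) {n : ℕ} (t : ℝ) (a c : WaveletLabel n) : ℂ :=
  ∑' m : ℤ, greenTerm L t a c m

/-- `U_t(α, β) = ∑_γ G_{-t}(α, γ) v_{b(γ)}(t) G_t(γ, β)`. -/
def generator (L : ℝ) {n : ℕ} (v : Fin n → ℝ → ℝ) (t : ℝ) (a c : WaveletLabel n) : ℂ :=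
  ∑' g : WaveletLabel n, green L (-t) a g * (v g.2 t : ℂ) * green L t g c

/-- `ψt` is a solution, with columns in `ℓ²` (locally uniformly in time), of
`∂_t ψt_t(α, β) = -i ∑_ν U_t(α, ν) ψt_t(ν, β)`, `ψt_0(α, β) = δ_{α, β}`. -/
structure IsInteractionSolution (L : ℝ) {n : ℕ} (v : Fin n → ℝ → ℝ)
    (ψt : ℝ → WaveletLabel n → WaveletLabel n → ℂ) : Prop where
  initial : ∀ a c, ψt 0 a c = if a = c then 1 else 0
  bounded : ∀ (T : ℝ) (c : WaveletLabel n), ∃ C : ℝ, ∀ t : ℝ, |t| ≤ T →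
    Summable (fun a => ‖ψt t a c‖ ^ 2) ∧ ∑' a, ‖ψt t a c‖ ^ 2 ≤ C
  deriv : ∀ (t : ℝ) (a c : WaveletLabel n),
    HasDerivAt (fun s => ψt s a c) (-I * ∑' ν, generator L v t a ν * ψt t ν c) t

/-- `ψ_t(α, β) = ∑_γ G_t(α, γ) ψt_t(γ, β)`. -/
def psi (L : ℝ) {n : ℕ} (ψt : ℝ → WaveletLabel n → WaveletLabel n → ℂ) (t : ℝ)
    (a c : WaveletLabel n) : ℂ :=
  ∑' g : WaveletLabel n, green L t a g * ψt t g c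

end HardcoreBosons

end

open MeasureTheory Complex
open scoped ComplexConjugate

noncomputable section

namespace HardcoreBosons

/-! ## Linear evolution equations in a Hilbert space -/

section Abstract

variable {H : Type*} [NormedAddCommGroup H] [InnerProductSpace ℂ H]
variable {ι : Type*}

/-! Multiplication by `∏_{i<j} sgn (x_i - x_j)` is an involutive unitary that turns bosonic wave
functions into fermionic ones. On the core the sign is locally constant off the coincidence set,
which is null, so the hardcore Hamiltonian becomes the free `-∑ ∂_j²` plus the same potential. For
even `N` the periodicity on the ring becomes antiperiodicity, which is why the momenta in `K` are
half-integral.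

After this transformation the particles no longer interact. On the whole space of `N`
distinguishable particles the kinetic energy is diagonal in products of antiperiodic plane waves and
the potential is a sum of one-particle terms, so a product state evolves into the product of the
one-particle evolutions (`configEvolution_tensor`). This evolution commutes with permutations
(`permOp_configEvolution`), so it preserves antisymmetry; conjugated with the sign it is the
evolution of hardcore bosons. Uniqueness follows because antisymmetrised plane waves, multiplied by
the sign, belong to the core and determine every coordinate of an antisymmetric vector
(`inner_slaterWave`).

A wavelet state with labels in decreasing order of the boxes becomes a normalised Slater determinant
of one-particle wavelets (`signOp_waveletState`): particles in different boxes are ordered, so only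
the signs inside the boxes remain. Matrix elements of a product operator between Slater determinants
are determinants of one-particle matrix elements, here `⟨α|u(t)|β⟩` with `u` the one-particle
evolution.

It remains to identify these with `ψ_t`. In the wavelet basis `G_t` is the matrix of the free
evolution and the potential is diagonal, so `U_t` is the matrix of `e^{itH₀} V(t) e^{-itH₀}`. This
operator is bounded locally uniformly in time, so the interaction picture equation is solved by its
Dyson series (`exists_propagator`), and weak solutions are unique by an iterated Gronwall estimate
(`eq_zero_of_weak_solution`). All series are expansions of inner products in a Hilbert basis. -/

/-- The terms of the Dyson series of `y' = B y`, `y 0 = x`. -/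
def dysonTerm (B : ℝ → H →L[ℂ] H) (x : H) : ℕ → ℝ → H
  | 0 => fun _ => x
  | k + 1 => fun t => ∫ s in (0 : ℝ)..t, B s (dysonTerm B x k s)

/-- Joint continuity of `(t, x) ↦ B t x` is the right hypothesis: the generator of the interaction
picture is only strongly continuous in `t`, because the free evolution is not norm continuous. -/
theorem continuous_dysonTerm {B : ℝ → H →L[ℂ] H} (hB : Continuous fun p : ℝ × H => B p.1 p.2)
    (x : H) (k : ℕ) : Continuous (dysonTerm B x k) := by
  induction k with
  | zero => exact continuous_const
  | succ k ih =>
    have hc : Continuous fun s => B s (dysonTerm B x k s) := hB.comp (continuous_id.prodMk ih)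
    exact intervalIntegral.continuous_primitive (fun a b => hc.intervalIntegrable a b) 0

theorem hasDerivAt_dysonTerm_succ [CompleteSpace H] {B : ℝ → H →L[ℂ] H}
    (hB : Continuous fun p : ℝ × H => B p.1 p.2) (x : H) (k : ℕ) (t : ℝ) :
    HasDerivAt (dysonTerm B x (k + 1)) (B t (dysonTerm B x k t)) t := by
  have hc : Continuous fun s => B s (dysonTerm B x k s) :=
    hB.comp (continuous_id.prodMk (continuous_dysonTerm hB x k))
  exact intervalIntegral.integral_hasDerivAt_right (hc.intervalIntegrable _ _)
    (hc.stronglyMeasurableAtFilter _ _) hc.continuousAt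

/-- A function whose derivative is bounded by `M C (C|t|)^k / k!` and that vanishes at `0` is
bounded by `M (C|t|)^{k+1} / (k+1)!`. -/
theorem norm_le_of_norm_deriv_le_pow {E : Type*} [NormedAddCommGroup E] [NormedSpace ℝ E]
    {y y' : ℝ → E} {T C M : ℝ} (k : ℕ) (h0 : y 0 = 0)
    (hy : ∀ t, |t| ≤ T → HasDerivAt y (y' t) t)
    (hb : ∀ t, |t| ≤ T → ‖y' t‖ ≤ C * (M * (C * |t|) ^ k / k.factorial)) (t : ℝ) (ht : |t| ≤ T) :
    ‖y t‖ ≤ M * (C * |t|) ^ (k + 1) / (k + 1).factorial := by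
  have key : ∀ (z z' : ℝ → E), z 0 = 0 → (∀ t, |t| ≤ T → HasDerivAt z (z' t) t) →
      (∀ t, |t| ≤ T → ‖z' t‖ ≤ C * (M * (C * |t|) ^ k / k.factorial)) →
      ∀ t, 0 ≤ t → t ≤ T → ‖z t‖ ≤ M * (C * t) ^ (k + 1) / (k + 1).factorial := by
    intro z z' hz0 hz hzb t ht0 htT
    have hab : ∀ s ∈ Set.Icc 0 t, |s| ≤ T := fun s hs => by
      rw [abs_of_nonneg hs.1]; exact hs.2.trans htT
    refine image_norm_le_of_norm_deriv_right_le_deriv_boundary (a := 0) (b := t) (f := z) (f' := z')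
      (B := fun s => M * (C * s) ^ (k + 1) / (k + 1).factorial)
      (B' := fun s => C * (M * (C * s) ^ k / k.factorial)) ?_ ?_ ?_ ?_ ?_ ⟨ht0, le_rfl⟩
    · exact fun s hs => (hz s (hab s hs)).continuousAt.continuousWithinAt
    · exact fun s hs => (hz s (hab s ⟨hs.1, hs.2.le⟩)).hasDerivWithinAt
    · simp [hz0]
    · intro s
      have h1 := ((((hasDerivAt_id s).const_mul C).pow (k + 1)).const_mul M).div_const
        (((k + 1).factorial : ℕ) : ℝ)
      refine h1.congr_deriv ?_
      have : (k.factorial : ℝ) ≠ 0 := by positivity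
      rw [Nat.factorial_succ]
      push_cast
      simp only [id]
      field_simp
    · intro s hs
      have := hzb s (hab s ⟨hs.1, hs.2.le⟩)
      rwa [abs_of_nonneg hs.1] at this
  rcases le_total 0 t with h | h
  · rw [abs_of_nonneg h] at ht ⊢
    exact key y y' h0 hy hb t h ht
  · rw [abs_of_nonpos h] at ht ⊢
    -- Negative times reduce to positive ones by reflection.
    have := key (fun s => y (-s)) (fun s => -y' (-s)) (by simpa using h0)
      (fun s hs => by
        have := (hy (-s) (by simpa using hs)).scomp s (hasDerivAt_neg s)
        simpa [Function.comp_def] using this)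
      (fun s hs => by
        have := hb (-s) (by simpa using hs)
        simpa using this) (-t) (by linarith) ht
    simpa using this

/-- Each integration over time raises the power of `|t|` and divides by the next factor of the
factorial, so the series converges like an exponential. -/
theorem norm_dysonTerm_le [CompleteSpace H] {B : ℝ → H →L[ℂ] H} (hB : Continuous fun p : ℝ × H => B p.1 p.2)
    {T C : ℝ} (hC : ∀ t, |t| ≤ T → ‖B t‖ ≤ C) (x : H) (k : ℕ) (t : ℝ) (ht : |t| ≤ T) :
    ‖dysonTerm B x k t‖ ≤ ‖x‖ * (C * |t|) ^ k / k.factorial := by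
  induction k generalizing t with
  | zero => simp [dysonTerm]
  | succ k ih =>
    refine norm_le_of_norm_deriv_le_pow k (by simp [dysonTerm])
      (fun s _ => hasDerivAt_dysonTerm_succ hB x k s) (fun s hs => ?_) t ht
    exact ((B s).le_opNorm _).trans
      (mul_le_mul (hC s hs) (ih s hs) (norm_nonneg _) ((norm_nonneg _).trans (hC s hs)))

theorem norm_dysonTerm_le_of_abs_le [CompleteSpace H] {B : ℝ → H →L[ℂ] H}
    (hB : Continuous fun p : ℝ × H => B p.1 p.2)
    {T C : ℝ} (hC : ∀ t, |t| ≤ T → ‖B t‖ ≤ C) (x : H) (k : ℕ) (t : ℝ) (ht : |t| ≤ T) :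
    ‖dysonTerm B x k t‖ ≤ ‖x‖ * ((C * T) ^ k / k.factorial) := by
  refine (norm_dysonTerm_le hB hC x k t ht).trans ?_
  have hC0 : 0 ≤ C := (norm_nonneg _).trans (hC t ht)
  rw [mul_div_assoc]
  gcongr

theorem summable_dysonTerm [CompleteSpace H] {B : ℝ → H →L[ℂ] H} (hB : Continuous fun p : ℝ × H => B p.1 p.2)
    (hb : ∀ T : ℝ, ∃ C, ∀ t, |t| ≤ T → ‖B t‖ ≤ C) (x : H) (t : ℝ) :
    Summable fun k => dysonTerm B x k t := by
  obtain ⟨C, hC⟩ := hb |t|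
  exact Summable.of_norm_bounded ((Real.summable_pow_div_factorial (C * |t|)).mul_left ‖x‖)
    fun k => norm_dysonTerm_le_of_abs_le hB hC x k t le_rfl

theorem dysonTerm_add {B : ℝ → H →L[ℂ] H} (hB : Continuous fun p : ℝ × H => B p.1 p.2)
    (x y : H) (k : ℕ) : dysonTerm B (x + y) k = dysonTerm B x k + dysonTerm B y k := by
  have hc : ∀ (z : H) k, Continuous fun s => B s (dysonTerm B z k s) := fun z k =>
    hB.comp (continuous_id.prodMk (continuous_dysonTerm hB z k))
  induction k with
  | zero => rfl
  | succ k ih =>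
    funext t
    simp only [dysonTerm, Pi.add_apply, ih, map_add]
    exact intervalIntegral.integral_add ((hc x k).intervalIntegrable _ _)
      ((hc y k).intervalIntegrable _ _)

theorem dysonTerm_smul (B : ℝ → H →L[ℂ] H) (c : ℂ) (x : H) (k : ℕ) :
    dysonTerm B (c • x) k = c • dysonTerm B x k := by
  induction k with
  | zero => rfl
  | succ k ih =>
    funext t
    simp only [dysonTerm, Pi.smul_apply, ih, map_smul]
    exact intervalIntegral.integral_smul c _

/-- The propagator of the evolution equation `y' = B y`, as the sum of the Dyson series. -/
theorem exists_propagator [CompleteSpace H] {B : ℝ → H →L[ℂ] H} (hB : Continuous fun p : ℝ × H => B p.1 p.2)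
    (hb : ∀ T : ℝ, ∃ C, ∀ t, |t| ≤ T → ‖B t‖ ≤ C) :
    ∃ Y : ℝ → H →L[ℂ] H, (∀ x, Y 0 x = x) ∧ ∀ x t, HasDerivAt (fun s => Y s x) (B t (Y t x)) t := by
  have hs := summable_dysonTerm hB hb
  have hbd : ∀ t, ∃ C, ∀ x, ‖∑' k, dysonTerm B x k t‖ ≤ C * ‖x‖ := by
    intro t
    obtain ⟨C, hC⟩ := hb |t|
    refine ⟨∑' k : ℕ, (C * |t|) ^ k / k.factorial, fun x => ?_⟩
    rw [mul_comm, ← tsum_mul_left]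
    exact tsum_of_norm_bounded
      ((Real.summable_pow_div_factorial (C * |t|)).mul_left ‖x‖).hasSum
      fun k => norm_dysonTerm_le_of_abs_le hB hC x k t le_rfl
  choose C hC using hbd
  let Y : ℝ → H →L[ℂ] H := fun t => LinearMap.mkContinuous
    { toFun := fun x => ∑' k, dysonTerm B x k t
      map_add' := fun x y => by
        simp only [dysonTerm_add hB, Pi.add_apply]
        exact (hs x t).tsum_add (hs y t)
      map_smul' := fun c x => by
        simp only [dysonTerm_smul, Pi.smul_apply, RingHom.id_apply]
        exact (hs x t).tsum_const_smul c } (C t) (hC t)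
  have hY : ∀ t x, Y t x = ∑' k, dysonTerm B x k t := fun t x => rfl
  refine ⟨Y, fun x => ?_, fun x t => ?_⟩
  · rw [hY, tsum_eq_single 0]
    · rfl
    · intro k hk
      obtain ⟨j, rfl⟩ := Nat.exists_eq_succ_of_ne_zero hk
      simp [dysonTerm]
  · simp only [hY]
    obtain ⟨C, hC⟩ := hb (|t| + 1)
    have hC0 : 0 ≤ C := (norm_nonneg _).trans (hC 0 (by rw [abs_zero]; positivity))
    have hderiv : ∀ k s, s ∈ Metric.ball (0 : ℝ) (|t| + 1) →
        HasDerivAt (dysonTerm B x (k + 1)) (B s (dysonTerm B x k s)) s :=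
      fun k s _ => hasDerivAt_dysonTerm_succ hB x k s
    -- Term `k + 1` has derivative `B` applied to term `k`, so the differentiated series is `B`
    -- applied to the whole sum. The radius `|t| + 1` leaves an open ball around `t` on which the
    -- bounds are uniform.
    have h1 : HasDerivAt (fun s => ∑' k, dysonTerm B x (k + 1) s)
        (∑' k, B t (dysonTerm B x k t)) t := by
      refine hasDerivAt_tsum_of_isPreconnected
        (u := fun k : ℕ => C * (‖x‖ * ((C * (|t| + 1)) ^ k / k.factorial)))
        (((Real.summable_pow_div_factorial (C * (|t| + 1))).mul_left ‖x‖).mul_left C)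
        Metric.isOpen_ball (convex_ball (0 : ℝ) (|t| + 1)).isPreconnected hderiv ?_
        (y₀ := t) ?_ ((summable_nat_add_iff 1).mpr (hs x t)) ?_
      · intro k s hs
        have hs' : |s| ≤ |t| + 1 := by simpa using (Metric.mem_ball.mp hs).le
        exact ((B s).le_opNorm _).trans (mul_le_mul (hC s hs')
          (norm_dysonTerm_le_of_abs_le hB hC x k s hs') (norm_nonneg _) hC0)
      · simp
      · simp
    rw [(B t).map_tsum (hs x t)]
    have h2 : (fun s => ∑' k, dysonTerm B x k s) = fun s => x + ∑' k, dysonTerm B x (k + 1) s := by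
      funext s
      rw [(hs x s).tsum_eq_zero_add]
      rfl
    rw [h2]
    exact h1.const_add x

/-- A locally bounded weak solution of `y' = B y` that vanishes at `0` vanishes identically. -/
theorem eq_zero_of_weak_solution (b : HilbertBasis ι ℂ H) {B : ℝ → H →L[ℂ] H}
    (hb : ∀ T : ℝ, ∃ C, ∀ t, |t| ≤ T → ‖B t‖ ≤ C) {y : ℝ → H} (h0 : y 0 = 0)
    (hy : ∀ T : ℝ, ∃ M, ∀ t, |t| ≤ T → ‖y t‖ ≤ M)
    (hd : ∀ i t, HasDerivAt (fun s => inner ℂ (b i) (y s)) (inner ℂ (b i) (B t (y t))) t) (t : ℝ) :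
    y t = 0 := by
  obtain ⟨C, hC⟩ := hb |t|
  obtain ⟨M, hM⟩ := hy |t|
  -- The equation is only known weakly against `b i`. It extends to finite combinations, but not
  -- directly to limits; the bounds below, however, do pass to limits.
  have hspan : ∀ f ∈ Submodule.span ℂ (Set.range b), ∀ s,
      HasDerivAt (fun s => inner ℂ f (y s)) (inner ℂ f (B s (y s))) s := by
    intro f hf
    induction hf using Submodule.span_induction with
    | mem f hf => obtain ⟨i, rfl⟩ := hf; exact hd i
    | zero => intro s; simpa using hasDerivAt_const s (0 : ℂ)
    | add f g _ _ hf hg => intro s; simpa only [inner_add_left] using (hf s).fun_add (hg s)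
    | smul c f _ hf => intro s; simpa only [inner_smul_left] using (hf s).const_mul _
  have hdense : Dense (Submodule.span ℂ (Set.range b) : Set H) := by
    rw [Submodule.dense_iff_topologicalClosure_eq_top]
    exact b.dense_span
  have hbound : ∀ (k : ℕ) (s : ℝ), |s| ≤ |t| → ‖y s‖ ≤ M * (C * |s|) ^ k / k.factorial := by
    intro k
    induction k with
    | zero => intro s hs; simpa using hM s hs
    | succ k ih =>
      intro s hs
      have hle : ∀ f : H, ‖inner ℂ f (y s)‖ ≤
          ‖f‖ * M * (C * |s|) ^ (k + 1) / (k + 1).factorial := by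
        intro f
        refine hdense.induction (P := fun f => ‖inner ℂ f (y s)‖ ≤
          ‖f‖ * M * (C * |s|) ^ (k + 1) / (k + 1).factorial) (fun f hf => ?_)
          (isClosed_le (by fun_prop) (by fun_prop)) f
        refine norm_le_of_norm_deriv_le_pow (y := fun s => inner ℂ f (y s)) k (by simp [h0])
          (fun r _ => hspan f hf r) (fun r hr => ?_) s hs
        refine (norm_inner_le_norm _ _).trans ?_
        calc ‖f‖ * ‖B r (y r)‖ ≤ ‖f‖ * (C * (M * (C * |r|) ^ k / k.factorial)) := by
              gcongr
              exact ((B r).le_opNorm _).trans (mul_le_mul (hC r hr) (ih r hr) (norm_nonneg _)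
                ((norm_nonneg _).trans (hC r hr)))
          _ = _ := by ring
      -- Since the estimate holds for every vector, it may be tested with `y s` itself, which bounds
      -- the norm.
      have h := hle (y s)
      rw [inner_self_eq_norm_sq_to_K] at h
      by_cases hz : ‖y s‖ = 0
      · rw [hz]
        have hM0 : 0 ≤ M := (norm_nonneg _).trans (hM s hs)
        have hC0 : 0 ≤ C := (norm_nonneg _).trans (hC s hs)
        positivity
      · have hpos : 0 < ‖y s‖ := lt_of_le_of_ne (norm_nonneg _) (Ne.symm hz)
        refine le_of_mul_le_mul_left ?_ hpos
        calc ‖y s‖ * ‖y s‖ = ‖((‖y s‖ : ℂ)) ^ 2‖ := by simp [sq]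
          _ ≤ _ := h
          _ = _ := by ring
  -- The iteration improves one a priori bound `M` to `M (C|t|)^k / k!` for every `k`, which tends
  -- to `0`.
  have hlim : Filter.Tendsto (fun k : ℕ => M * (C * |t|) ^ k / k.factorial) Filter.atTop
      (nhds 0) := by
    simpa [mul_div_assoc] using
      (FloorSemiring.tendsto_pow_div_factorial_atTop (C * |t|)).const_mul M
  have := ge_of_tendsto' hlim fun k => hbound k t le_rfl
  simpa using this

end Abstract

/-! ### Diagonal Hamiltonians with a bounded time-dependent perturbation. -/

section Evolution

variable {H : Type*} [NormedAddCommGroup H] [InnerProductSpace ℂ H]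
variable {ι : Type*}

theorem hilbertBasis_ext (b : HilbertBasis ι ℂ H) {x y : H}
    (h : ∀ i, inner ℂ (b i) x = inner ℂ (b i) y) : x = y := by
  apply b.repr.injective
  ext i
  rw [b.repr_apply_apply, b.repr_apply_apply, h i]

/-- Multiplication of `ℓ²` sequences by phases. -/
def phaseMul (c : ι → ℂ) (hc : ∀ i, ‖c i‖ = 1) :
    lp (fun _ : ι => ℂ) 2 →ₗᵢ[ℂ] lp (fun _ : ι => ℂ) 2 where
  toFun x := ⟨fun i => c i * x i, (lp.memℓp x).mono' fun i => by simp [hc]⟩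
  map_add' x y := by ext i; exact mul_add _ _ _
  map_smul' r x := by ext i; simp [mul_left_comm]
  norm_map' x := by
    have h2 : (0 : ℝ) < (2 : ENNReal).toReal := by simp
    change ‖(⟨fun i => c i * x i, _⟩ : lp (fun _ : ι => ℂ) 2)‖ = ‖x‖
    rw [lp.norm_eq_tsum_rpow h2, lp.norm_eq_tsum_rpow h2]
    simp [hc]

/-- The unitary group `exp (-i t H₀)` of the operator `H₀` that is diagonal in the Hilbert
basis `b`, with eigenvalues `E`. -/
def freeEvolution (b : HilbertBasis ι ℂ H) (E : ι → ℝ) (t : ℝ) : H →L[ℂ] H :=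
  ((b.repr.symm.toLinearIsometry.comp
    (phaseMul (fun i => Complex.exp (-(I * t * E i))) fun i => by
      rw [Complex.norm_exp]; simp)).comp b.repr.toLinearIsometry).toContinuousLinearMap

variable (b : HilbertBasis ι ℂ H) (E : ι → ℝ)

theorem norm_freeEvolution_apply (t : ℝ) (x : H) : ‖freeEvolution b E t x‖ = ‖x‖ :=
  LinearIsometry.norm_map _ x

theorem inner_freeEvolution (t : ℝ) (i : ι) (x : H) :
    inner ℂ (b i) (freeEvolution b E t x) = Complex.exp (-(I * t * E i)) * inner ℂ (b i) x := by
  rw [← b.repr_apply_apply, ← b.repr_apply_apply]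
  simp [freeEvolution, phaseMul]

theorem freeEvolution_add (s t : ℝ) (x : H) :
    freeEvolution b E (s + t) x = freeEvolution b E s (freeEvolution b E t x) := by
  refine hilbertBasis_ext b fun i => ?_
  rw [inner_freeEvolution, inner_freeEvolution, inner_freeEvolution, ← mul_assoc,
    ← Complex.exp_add]
  congr 2
  push_cast
  ring

theorem freeEvolution_zero (x : H) : freeEvolution b E 0 x = x := by
  refine hilbertBasis_ext b fun i => ?_
  rw [inner_freeEvolution]
  simp

theorem freeEvolution_apply_neg (t : ℝ) (x : H) :
    freeEvolution b E t (freeEvolution b E (-t) x) = x := by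
  rw [← freeEvolution_add, add_neg_cancel, freeEvolution_zero]

theorem inner_freeEvolution_right (t : ℝ) (x y : H) :
    inner ℂ x (freeEvolution b E t y) = inner ℂ (freeEvolution b E (-t) x) y := by
  have h : inner ℂ (freeEvolution b E t (freeEvolution b E (-t) x)) (freeEvolution b E t y) =
      inner ℂ (freeEvolution b E (-t) x) y := LinearIsometry.inner_map_map _ _ _
  rwa [freeEvolution_apply_neg] at h

theorem freeEvolution_basis (t : ℝ) (i : ι) :
    freeEvolution b E t (b i) = Complex.exp (-(I * t * E i)) • b i := by
  refine hilbertBasis_ext b fun j => ?_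
  rw [inner_freeEvolution, inner_smul_right]
  by_cases h : j = i
  · rw [h]
  · rw [b.orthonormal.2 h, mul_zero, mul_zero]

/-- On the span of the eigenvectors only finitely many phases occur. A general orbit is a limit of
such orbits, uniformly in time because the evolution is isometric. -/
theorem continuous_freeEvolution (x : H) : Continuous fun t => freeEvolution b E t x := by
  have hdense : Dense (Submodule.span ℂ (Set.range b) : Set H) := by
    rw [Submodule.dense_iff_topologicalClosure_eq_top]
    exact b.dense_span
  have hspan : ∀ f ∈ Submodule.span ℂ (Set.range b), Continuous fun t => freeEvolution b E t f := by
    intro f hf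
    induction hf using Submodule.span_induction with
    | mem f hf =>
      obtain ⟨i, rfl⟩ := hf
      simp only [freeEvolution_basis]
      fun_prop
    | zero => simpa using continuous_const
    | add f g _ _ hf hg => simpa only [map_add] using hf.fun_add hg
    | smul c f _ hf => simpa only [map_smul] using hf.fun_const_smul c
  refine continuous_of_uniform_approx_of_continuous fun u hu => ?_
  obtain ⟨ε, hε, hεu⟩ := Metric.mem_uniformity_dist.mp hu
  obtain ⟨f, hf, hfx⟩ := hdense.exists_dist_lt x hε
  refine ⟨_, hspan f hf, fun t => hεu ?_⟩
  rw [dist_eq_norm, ← map_sub, norm_freeEvolution_apply, ← dist_eq_norm]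
  exact hfx

/-- Strong continuity becomes joint continuity because all the maps share the Lipschitz constant
`1`. -/
theorem continuous_freeEvolution_prod : Continuous fun p : ℝ × H => freeEvolution b E p.1 p.2 := by
  have h : Continuous fun p : H × ℝ => freeEvolution b E p.2 p.1 :=
    continuous_prod_of_continuous_lipschitzWith (f := fun p : H × ℝ => freeEvolution b E p.2 p.1)
      1 (fun x => continuous_freeEvolution b E x) fun t => by
        refine LipschitzWith.of_dist_le_mul fun x y => ?_
        simp only [dist_eq_norm, ← map_sub, norm_freeEvolution_apply, NNReal.coe_one, one_mul, le_rfl]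
  exact Continuous.comp (g := fun p : H × ℝ => freeEvolution b E p.2 p.1)
    (f := fun p : ℝ × H => (p.2, p.1)) h (by fun_prop)

theorem exists_bound_of_continuous {F : Type*} [NormedAddCommGroup F] {y : ℝ → F} (hy : Continuous y) (T : ℝ) :
    ∃ M, ∀ t, |t| ≤ T → ‖y t‖ ≤ M := by
  obtain ⟨C, hC⟩ := (isCompact_Icc (a := -T) (b := T)).exists_bound_of_continuousOn
    hy.continuousOn
  exact ⟨C, fun t ht => hC t (abs_le.mp ht)⟩

/-- The generator `-i exp (i t H₀) V(t) exp (-i t H₀)` of the evolution in the interaction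
picture. -/
def interactionGenerator (V : ℝ → H →L[ℂ] H) (t : ℝ) : H →L[ℂ] H :=
  (-I) • ((freeEvolution b E (-t)).comp ((V t).comp (freeEvolution b E t)))

theorem interactionGenerator_apply (V : ℝ → H →L[ℂ] H) (t : ℝ) (x : H) :
    interactionGenerator b E V t x =
      (-I) • freeEvolution b E (-t) (V t (freeEvolution b E t x)) := rfl

theorem continuous_interactionGenerator {V : ℝ → H →L[ℂ] H} (hV : Continuous V) :
    Continuous fun p : ℝ × H => interactionGenerator b E V p.1 p.2 := by
  simp only [interactionGenerator_apply]
  have h1 := continuous_freeEvolution_prod b E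
  have h2 : Continuous fun p : ℝ × H => V p.1 (freeEvolution b E p.1 p.2) :=
    (hV.comp continuous_fst).clm_apply h1
  exact (Continuous.comp (g := fun p : ℝ × H => freeEvolution b E p.1 p.2)
    (f := fun p : ℝ × H => (-p.1, V p.1 (freeEvolution b E p.1 p.2))) h1
    (continuous_fst.neg.prodMk h2)).const_smul _

theorem bounded_interactionGenerator {V : ℝ → H →L[ℂ] H} (hV : Continuous V) (T : ℝ) :
    ∃ C, ∀ t, |t| ≤ T → ‖interactionGenerator b E V t‖ ≤ C := by
  obtain ⟨C, hC⟩ := (isCompact_Icc (a := -T) (b := T)).exists_bound_of_continuousOn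
    hV.continuousOn
  refine ⟨C, fun t ht => ?_⟩
  have hCt := hC t (abs_le.mp ht)
  refine ContinuousLinearMap.opNorm_le_bound _ ((norm_nonneg _).trans hCt) fun x => ?_
  rw [interactionGenerator_apply, norm_smul, norm_freeEvolution_apply]
  simp only [norm_neg, norm_I, one_mul]
  refine ((V t).le_opNorm _).trans ?_
  rw [norm_freeEvolution_apply]
  gcongr

variable [CompleteSpace H]

/-- The propagator in the interaction picture. -/
def interactionEvolution {V : ℝ → H →L[ℂ] H} (hV : Continuous V) : ℝ → H →L[ℂ] H :=
  (exists_propagator (continuous_interactionGenerator b E hV)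
    (bounded_interactionGenerator b E hV)).choose

theorem interactionEvolution_zero {V : ℝ → H →L[ℂ] H} (hV : Continuous V) (x : H) :
    interactionEvolution b E hV 0 x = x :=
  (exists_propagator (continuous_interactionGenerator b E hV)
    (bounded_interactionGenerator b E hV)).choose_spec.1 x

theorem hasDerivAt_interactionEvolution {V : ℝ → H →L[ℂ] H} (hV : Continuous V) (x : H) (t : ℝ) :
    HasDerivAt (fun s => interactionEvolution b E hV s x)
      (interactionGenerator b E V t (interactionEvolution b E hV t x)) t :=
  (exists_propagator (continuous_interactionGenerator b E hV)
    (bounded_interactionGenerator b E hV)).choose_spec.2 x t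

theorem continuous_interactionEvolution {V : ℝ → H →L[ℂ] H} (hV : Continuous V) (x : H) :
    Continuous fun t => interactionEvolution b E hV t x :=
  continuous_iff_continuousAt.mpr fun t =>
    (hasDerivAt_interactionEvolution b E hV x t).continuousAt

/-- A locally bounded weak solution in the interaction picture is given by the propagator. -/
theorem eq_interactionEvolution_of_weak_solution {κ : Type*} (w : HilbertBasis κ ℂ H)
    {V : ℝ → H →L[ℂ] H} (hV : Continuous V) {y : ℝ → H}
    (hy : ∀ T : ℝ, ∃ M, ∀ t, |t| ≤ T → ‖y t‖ ≤ M)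
    (hd : ∀ i t, HasDerivAt (fun s => inner ℂ (w i) (y s))
      (inner ℂ (w i) (interactionGenerator b E V t (y t))) t) (t : ℝ) :
    y t = interactionEvolution b E hV t (y 0) := by
  have h := eq_zero_of_weak_solution w (B := interactionGenerator b E V)
    (bounded_interactionGenerator b E hV)
    (y := fun t => y t - interactionEvolution b E hV t (y 0))
    (by simp [interactionEvolution_zero]) ?_ ?_ t
  · exact sub_eq_zero.mp h
  · intro T
    obtain ⟨M, hM⟩ := hy T
    obtain ⟨M', hM'⟩ := exists_bound_of_continuous
      (continuous_interactionEvolution b E hV (y 0)) T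
    exact ⟨M + M', fun t ht => (norm_sub_le _ _).trans (add_le_add (hM t ht) (hM' t ht))⟩
  · intro i t
    simp only [inner_sub_right, map_sub]
    refine (hd i t).fun_sub ?_
    exact ((innerSL ℂ (w i)).restrictScalars ℝ).hasFDerivAt.comp_hasDerivAt t
      (hasDerivAt_interactionEvolution b E hV (y 0) t)

/-- The propagator of `i ∂_t y = (H₀ + V(t)) y`. -/
def evolution {V : ℝ → H →L[ℂ] H} (hV : Continuous V) (t : ℝ) : H →L[ℂ] H :=
  (freeEvolution b E t).comp (interactionEvolution b E hV t)

theorem evolution_apply {V : ℝ → H →L[ℂ] H} (hV : Continuous V) (t : ℝ) (x : H) :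
    evolution b E hV t x = freeEvolution b E t (interactionEvolution b E hV t x) := rfl

theorem evolution_zero {V : ℝ → H →L[ℂ] H} (hV : Continuous V) (x : H) :
    evolution b E hV 0 x = x := by
  rw [evolution_apply, freeEvolution_zero, interactionEvolution_zero]

theorem continuous_evolution {V : ℝ → H →L[ℂ] H} (hV : Continuous V) (x : H) :
    Continuous fun t => evolution b E hV t x :=
  Continuous.comp (g := fun p : ℝ × H => freeEvolution b E p.1 p.2)
    (f := fun t => (t, interactionEvolution b E hV t x)) (continuous_freeEvolution_prod b E)
    (continuous_id.prodMk (continuous_interactionEvolution b E hV x))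

/-- On the domain of `H₀` the free evolution is differentiable. -/
theorem hasDerivAt_freeEvolution {f h : H}
    (hfh : ∀ i, inner ℂ (b i) h = (E i : ℂ) * inner ℂ (b i) f) (t : ℝ) :
    HasDerivAt (fun s => freeEvolution b E s f) ((-I) • freeEvolution b E t h) t := by
  have hc := (continuous_freeEvolution b E h).const_smul (-I)
  -- The candidate obtained by integrating the expected derivative is strongly differentiable. It
  -- equals the orbit because all coordinates have the same derivative and the same value at `0`.
  let F : ℝ → H := fun t => f + ∫ s in (0 : ℝ)..t, (-I) • freeEvolution b E s h
  have hF : ∀ t, HasDerivAt F ((-I) • freeEvolution b E t h) t := fun t =>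
    (intervalIntegral.integral_hasDerivAt_right (hc.intervalIntegrable _ _)
      (hc.stronglyMeasurableAtFilter _ _) hc.continuousAt).const_add f
  suffices heq : (fun s => freeEvolution b E s f) = F by rw [heq]; exact hF t
  funext s
  refine hilbertBasis_ext b fun i => ?_
  have h1 : ∀ r, HasDerivAt (fun s => inner ℂ (b i) (F s))
      (inner ℂ (b i) ((-I) • freeEvolution b E r h)) r := fun r =>
    ((innerSL ℂ (b i)).restrictScalars ℝ).hasFDerivAt.comp_hasDerivAt r (hF r)
  have h2 : ∀ r : ℝ, HasDerivAt (fun s => inner ℂ (b i) (freeEvolution b E s f))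
      (inner ℂ (b i) ((-I) • freeEvolution b E r h)) r := by
    intro r
    simp only [inner_freeEvolution, inner_smul_right, hfh]
    have h3 : HasDerivAt (fun s : ℝ => -(I * (s : ℂ) * (E i : ℂ))) (-(I * 1 * (E i : ℂ))) r :=
      (((hasDerivAt_id r).ofReal_comp.const_mul I).mul_const _).fun_neg
    refine (h3.cexp.mul_const _).congr_deriv ?_
    ring
  have h3 := is_const_of_deriv_eq_zero
    (f := fun s => inner ℂ (b i) (freeEvolution b E s f) - inner ℂ (b i) (F s))
    (fun r => ((h2 r).fun_sub (h1 r)).differentiableAt)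
    (fun r => by rw [((h2 r).fun_sub (h1 r)).deriv, sub_self]) s 0
  have h4 : F 0 = f := by simp [F]
  simp only [freeEvolution_zero, h4, sub_self] at h3
  exact sub_eq_zero.mp h3

/-- The evolution equation, weakly against the domain of `H₀`. -/
theorem hasDerivAt_inner_evolution {V : ℝ → H →L[ℂ] H} (hV : Continuous V) {f h : H}
    (hfh : ∀ i, inner ℂ (b i) h = (E i : ℂ) * inner ℂ (b i) f) (x : H) (t : ℝ) :
    HasDerivAt (fun s => inner ℂ f (evolution b E hV s x))
      (-I * (inner ℂ h (evolution b E hV t x) + inner ℂ f (V t (evolution b E hV t x)))) t := by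
  simp only [evolution_apply]
  simp only [inner_freeEvolution_right b E _ f, inner_freeEvolution_right b E _ h]
  have h1 : HasDerivAt (fun s => freeEvolution b E (-s) f) (-((-I) • freeEvolution b E (-t) h)) t := by
    have := (hasDerivAt_freeEvolution b E hfh (-t)).scomp t (hasDerivAt_neg t)
    simpa [Function.comp_def] using this
  have h2 := h1.inner ℂ (hasDerivAt_interactionEvolution b E hV x t)
  refine h2.congr_deriv ?_
  rw [interactionGenerator_apply, inner_smul_right, inner_freeEvolution_right, neg_neg,
    freeEvolution_apply_neg, inner_neg_left, inner_smul_left]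
  simp
  ring

/-- A locally bounded weak solution is given by the propagator. -/
theorem eq_evolution_of_weak_solution {V : ℝ → H →L[ℂ] H} (hV : Continuous V) {y : ℝ → H}
    (hy : ∀ T : ℝ, ∃ M, ∀ t, |t| ≤ T → ‖y t‖ ≤ M)
    (hd : ∀ i t, HasDerivAt (fun s => inner ℂ (b i) (y s))
      (-I * ((E i : ℂ) * inner ℂ (b i) (y t) + inner ℂ (b i) (V t (y t)))) t) (t : ℝ) :
    y t = evolution b E hV t (y 0) := by
  -- The solution is transported to the interaction picture. Testing against eigenvectors of `H₀`
  -- makes the free evolution a scalar phase, whose derivative cancels the term with `E i`.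
  have h := eq_interactionEvolution_of_weak_solution b E b hV
    (y := fun t => freeEvolution b E (-t) (y t)) ?_ ?_ t
  · rw [evolution_apply]
    simp only [neg_zero, freeEvolution_zero] at h
    rw [← h, freeEvolution_apply_neg]
  · intro T
    obtain ⟨M, hM⟩ := hy T
    exact ⟨M, fun t ht => by rw [norm_freeEvolution_apply]; exact hM t ht⟩
  · intro i t
    have h3 : HasDerivAt (fun s : ℝ => -(I * ((-s : ℝ) : ℂ) * (E i : ℂ)))
        (-(I * (-1 : ℝ) * (E i : ℂ))) t :=
      (((hasDerivAt_neg t).ofReal_comp.const_mul I).mul_const _).fun_neg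
    simp only [inner_freeEvolution]
    refine (h3.cexp.mul (hd i t)).congr_deriv ?_
    rw [interactionGenerator_apply, inner_smul_right, inner_freeEvolution, freeEvolution_apply_neg]
    push_cast
    ring

end Evolution

/-! ## Square integrable functions -/

section LTwo

variable {X : Type*} [MeasurableSpace X] {μ : Measure X}

theorem inner_eq_integral (f g : Lp ℂ 2 μ) : inner ℂ f g = ∫ x, conj (f x) * g x ∂μ := by
  rw [L2.inner_def]
  simp only [RCLike.inner_apply, mul_comm]

theorem inner_toLp_left {f : X → ℂ} (hf : MemLp f 2 μ) (g : Lp ℂ 2 μ) :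
    inner ℂ (hf.toLp f) g = ∫ x, conj (f x) * g x ∂μ := by
  rw [inner_eq_integral]
  refine integral_congr_ae ?_
  filter_upwards [hf.coeFn_toLp] with x hx
  rw [hx]

theorem inner_toLp_toLp {f g : X → ℂ} (hf : MemLp f 2 μ) (hg : MemLp g 2 μ) :
    inner ℂ (hf.toLp f) (hg.toLp g) = ∫ x, conj (f x) * g x ∂μ := by
  rw [inner_toLp_left]
  refine integral_congr_ae ?_
  filter_upwards [hg.coeFn_toLp] with x hx
  rw [hx]

theorem memLp_top_of_norm_le {g : X → ℂ} (hg : Measurable g) (C : ℝ) (hC : ∀ x, ‖g x‖ ≤ C) :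
    MemLp g ⊤ μ :=
  memLp_top_of_bound hg.aestronglyMeasurable C (Filter.Eventually.of_forall hC)

/-- The operator of multiplication by an essentially bounded function. -/
def mulOp {g : X → ℂ} (hg : MemLp g ⊤ μ) : Lp ℂ 2 μ →L[ℂ] Lp ℂ 2 μ :=
  (ContinuousLinearMap.mul ℂ ℂ).holderL μ ⊤ 2 2 (hg.toLp g)

theorem coeFn_mulOp {g : X → ℂ} (hg : MemLp g ⊤ μ) (f : Lp ℂ 2 μ) :
    mulOp hg f =ᵐ[μ] fun x => g x * f x := by
  have h := (ContinuousLinearMap.mul ℂ ℂ).coeFn_holder (r := 2) (hg.toLp g) f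
  filter_upwards [h, hg.coeFn_toLp] with x hx hgx
  change (((ContinuousLinearMap.mul ℂ ℂ).holder 2 (hg.toLp g) f : Lp ℂ 2 μ)) x = _
  rw [hx, hgx]
  rfl

end LTwo

/-! ## Fourier series on an interval -/

theorem integral_exp_period (a T : ℝ) (hT : 0 < T) (k : ℤ) :
    ∫ x in a..(a + T), Complex.exp (2 * Real.pi * I * k * x / T) = if k = 0 then (T : ℂ) else 0 := by
  have hT' : (T : ℂ) ≠ 0 := by exact_mod_cast hT.ne'
  split_ifs with hk
  · simp [hk]
  · have hc : (2 * Real.pi * I * k / T : ℂ) ≠ 0 := by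
      have : (k : ℂ) ≠ 0 := by exact_mod_cast hk
      have : (Real.pi : ℂ) ≠ 0 := by exact_mod_cast Real.pi_ne_zero
      simp [*]
    have h := integral_exp_mul_complex (a := a) (b := a + T) hc
    have e : ∀ x : ℝ, (2 * Real.pi * I * k * x / T : ℂ) = 2 * Real.pi * I * k / T * x := fun x => by
      ring
    simp only [e]
    rw [h]
    have e2 : (2 * Real.pi * I * k / T * ((a + T : ℝ) : ℂ) : ℂ) =
        2 * Real.pi * I * k / T * a + k * (2 * Real.pi * I) := by
      push_cast
      field_simp
    rw [e2, Complex.exp_add, Complex.exp_int_mul_two_pi_mul_I, mul_one, sub_self, zero_div]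

/-- A square integrable function on an interval whose Fourier coefficients all vanish is `0`. -/
theorem ae_eq_zero_of_fourier {a b : ℝ} (hab : a < b) {f : ℝ → ℂ}
    (hf : MemLp f 2 (volume.restrict (Set.Ioc a b)))
    (h : ∀ k : ℤ, ∫ x in Set.Ioc a b, Complex.exp (-(2 * Real.pi * I * k * x / (b - a : ℝ))) * f x = 0) :
    f =ᵐ[volume.restrict (Set.Ioc a b)] 0 := by
  have hcoeff : ∀ k : ℤ, fourierCoeffOn hab f k = 0 := by
    intro k
    rw [fourierCoeffOn_eq_integral, intervalIntegral.integral_of_le hab.le]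
    have : ∀ x : ℝ, fourier (-k) (x : AddCircle (b - a)) • f x =
        Complex.exp (-(2 * Real.pi * I * k * x / (b - a : ℝ))) * f x := by
      intro x
      rw [fourier_coe_apply, smul_eq_mul]
      congr 2
      push_cast
      ring
    simp only [this, h k, smul_zero]
  -- By Parseval the integral of `‖f‖²` is the sum of the squared coefficients, hence `0`.
  have hs := hasSum_sq_fourierCoeffOn hab hf
  simp only [hcoeff, norm_zero, ne_eq, OfNat.ofNat_ne_zero, not_false_eq_true, zero_pow] at hs
  have h0 := hs.unique hasSum_zero
  have hba : (b - a)⁻¹ ≠ 0 := inv_ne_zero (sub_ne_zero.mpr hab.ne')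
  rw [smul_eq_zero, intervalIntegral.integral_of_le hab.le] at h0
  have h1 := h0.resolve_left hba
  rw [integral_eq_zero_iff_of_nonneg (fun x => by positivity)] at h1
  · filter_upwards [h1] with x hx
    simpa using hx
  · exact (memLp_two_iff_integrable_sq_norm hf.1).mp hf

/-! ## The one-particle space -/

/-- The Hilbert space of one particle on the ring. -/
abbrev RingSpace (L : ℝ) : Type := Lp ℂ 2 ((volume : Measure ℝ).restrict (Set.Ioc 0 L))

/-- The antiperiodic plane waves on the ring. -/
def ringWave (L : ℝ) (m : ℤ) (x : ℝ) : ℂ :=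
  (((Real.sqrt L)⁻¹ : ℝ) : ℂ) * Complex.exp (I * (ringMomentum L m * x))

/-- The one-particle wavelets: plane waves in one of the boxes. -/
def waveletFun (L : ℝ) {n : ℕ} (a : WaveletLabel n) (x : ℝ) : ℂ :=
  (((Real.sqrt (L / n))⁻¹ : ℝ) : ℂ) * Complex.exp (I * (x * momentum L a)) *
    (box L n a.2).indicator (fun _ => (1 : ℂ)) x

theorem norm_exp_I_mul_ofReal_mul (x y : ℝ) : ‖Complex.exp (I * (x * y))‖ = 1 := by
  rw [Complex.norm_exp]; simp

theorem continuous_ringWave (L : ℝ) (m : ℤ) : Continuous (ringWave L m) := by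
  unfold ringWave; fun_prop

theorem norm_ringWave (L : ℝ) (m : ℤ) (x : ℝ) : ‖ringWave L m x‖ = (Real.sqrt L)⁻¹ := by
  rw [ringWave, norm_mul, norm_exp_I_mul_ofReal_mul, mul_one, Complex.norm_real]
  exact abs_of_nonneg (by positivity)

theorem memLp_ringWave (L : ℝ) (m : ℤ) :
    MemLp (ringWave L m) 2 ((volume : Measure ℝ).restrict (Set.Ioc 0 L)) :=
  MemLp.of_bound (continuous_ringWave L m).aestronglyMeasurable (Real.sqrt L)⁻¹
    (Filter.Eventually.of_forall fun x => (norm_ringWave L m x).le)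

theorem measurable_waveletFun (L : ℝ) {n : ℕ} (a : WaveletLabel n) :
    Measurable (waveletFun L a) := by
  unfold waveletFun
  exact Measurable.mul (by fun_prop) (measurable_const.indicator measurableSet_Ioc)

theorem norm_waveletFun_le (L : ℝ) {n : ℕ} (a : WaveletLabel n) (x : ℝ) :
    ‖waveletFun L a x‖ ≤ (Real.sqrt (L / n))⁻¹ := by
  rw [waveletFun, norm_mul, norm_mul, norm_exp_I_mul_ofReal_mul, mul_one, Complex.norm_real,
    Real.norm_eq_abs, abs_of_nonneg (by positivity : (0 : ℝ) ≤ (Real.sqrt (L / n))⁻¹)]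
  refine mul_le_of_le_one_right (by positivity) ?_
  rw [norm_indicator_eq_indicator_norm]
  by_cases hx : x ∈ box L n a.2 <;> simp [hx]

theorem memLp_waveletFun (L : ℝ) {n : ℕ} (a : WaveletLabel n) :
    MemLp (waveletFun L a) 2 ((volume : Measure ℝ).restrict (Set.Ioc 0 L)) :=
  MemLp.of_bound (measurable_waveletFun L a).aestronglyMeasurable _
    (Filter.Eventually.of_forall fun x => norm_waveletFun_le L a x)

theorem conj_exp_I_mul (x y : ℝ) :
    conj (Complex.exp (I * (x * y))) = Complex.exp (-(I * (x * y))) := by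
  rw [← Complex.exp_conj]
  simp

theorem inv_sqrt_mul_self {L : ℝ} (hL : 0 < L) :
    (((Real.sqrt L)⁻¹ : ℝ) : ℂ) * (((Real.sqrt L)⁻¹ : ℝ) : ℂ) = (L : ℂ)⁻¹ := by
  rw [← Complex.ofReal_mul, ← mul_inv, Real.mul_self_sqrt hL.le, Complex.ofReal_inv]

/-- The shift by one half cancels in the difference of two momenta, which leaves the usual
orthogonality of periodic exponentials. -/
theorem orthonormal_ringWave {L : ℝ} (hL : 0 < L) :
    Orthonormal ℂ fun m : ℤ => ((memLp_ringWave L m).toLp _ : RingSpace L) := by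
  have hL' : (L : ℂ) ≠ 0 := by exact_mod_cast hL.ne'
  rw [orthonormal_iff_ite]
  intro m k
  rw [inner_toLp_toLp, ← intervalIntegral.integral_of_le hL.le]
  have e : ∀ x : ℝ, conj (ringWave L m x) * ringWave L k x =
      (L : ℂ)⁻¹ * Complex.exp (2 * Real.pi * I * (k - m : ℤ) * x / L) := by
    intro x
    simp only [ringWave, map_mul, Complex.conj_ofReal, conj_exp_I_mul]
    rw [mul_mul_mul_comm, inv_sqrt_mul_self hL, ← Complex.exp_add]
    congr 2
    simp only [ringMomentum]
    push_cast
    ring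
  simp only [e]
  have h := integral_exp_period 0 L hL (k - m)
  rw [zero_add] at h
  rw [intervalIntegral.integral_const_mul, h]
  by_cases hmk : m = k
  · simp [hmk, hL']
  · have : k - m ≠ 0 := by omega
    simp [hmk, this]

theorem span_orthogonal_eq_bot {H ι : Type*} [NormedAddCommGroup H] [InnerProductSpace ℂ H]
    {v : ι → H} (h : ∀ f : H, (∀ i, inner ℂ (v i) f = 0) → f = 0) :
    (Submodule.span ℂ (Set.range v))ᗮ = ⊥ := by
  rw [Submodule.eq_bot_iff]
  intro f hf
  exact h f fun i => (Submodule.mem_orthogonal _ _).mp hf _ (Submodule.subset_span ⟨i, rfl⟩)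

theorem eq_zero_of_inner_ringWave {L : ℝ} (hL : 0 < L) (f : RingSpace L)
    (h : ∀ m : ℤ, inner ℂ ((memLp_ringWave L m).toLp _ : RingSpace L) f = 0) : f = 0 := by
  have hL' : (((Real.sqrt L)⁻¹ : ℝ) : ℂ) ≠ 0 := by
    have := Real.sqrt_pos.mpr hL
    exact_mod_cast (inv_pos.mpr this).ne'
  -- The phase `e^{-iπx/L}` removes the half-integral shift, so completeness reduces to that of
  -- ordinary Fourier series.
  let p : ℝ → ℂ := fun x => Complex.exp (I * ((-(Real.pi / L) : ℝ) * x))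
  have hp : Continuous p := by fun_prop
  have hpn : ∀ x, ‖p x‖ = 1 := fun x => norm_exp_I_mul_ofReal_mul _ _
  have hpf : MemLp (fun x => p x * f x) 2 (volume.restrict (Set.Ioc 0 L)) :=
    (Lp.memLp f).of_le_mul (c := 1) (hp.aestronglyMeasurable.mul (Lp.aestronglyMeasurable f))
      (Filter.Eventually.of_forall fun x => by rw [norm_mul, hpn])
  have h0 := ae_eq_zero_of_fourier hL hpf fun k => by
    have h1 := h k
    rw [inner_toLp_left] at h1
    have e : ∀ x : ℝ, conj (ringWave L k x) * f x = (((Real.sqrt L)⁻¹ : ℝ) : ℂ) *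
        (Complex.exp (-(2 * Real.pi * I * k * x / (L - 0 : ℝ))) * (p x * f x)) := by
      intro x
      simp only [ringWave, map_mul, Complex.conj_ofReal, conj_exp_I_mul, p]
      rw [mul_assoc, ← mul_assoc (Complex.exp (-(2 * Real.pi * I * k * x / (L - 0 : ℝ)))),
        ← Complex.exp_add]
      congr 3
      simp only [ringMomentum]
      push_cast
      ring
    simp only [e] at h1
    rw [integral_const_mul, mul_eq_zero] at h1
    exact h1.resolve_left hL'
  refine (Lp.eq_zero_iff_ae_eq_zero).mpr ?_
  filter_upwards [h0] with x hx
  have : p x ≠ 0 := Complex.exp_ne_zero _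
  simpa [this] using hx

/-- The Hilbert basis of antiperiodic plane waves. -/
def ringBasis {L : ℝ} (hL : 0 < L) : HilbertBasis ℤ ℂ (RingSpace L) :=
  HilbertBasis.mkOfOrthogonalEqBot (orthonormal_ringWave hL)
    (span_orthogonal_eq_bot (eq_zero_of_inner_ringWave hL))

theorem ringBasis_apply {L : ℝ} (hL : 0 < L) (m : ℤ) :
    ringBasis hL m = (memLp_ringWave L m).toLp _ := by
  rw [ringBasis, HilbertBasis.coe_mkOfOrthogonalEqBot]

/-! ### Boxes and the wavelet basis. -/

theorem measurableSet_box (L : ℝ) (n : ℕ) (b : Fin n) : MeasurableSet (box L n b) :=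
  measurableSet_Ioc

theorem box_subset {L : ℝ} (hL : 0 < L) {n : ℕ} (b : Fin n) : box L n b ⊆ Set.Ioc 0 L := by
  have hn : (0 : ℝ) < n := by exact_mod_cast b.pos
  have hb : ((b : ℝ) + 1) ≤ n := by exact_mod_cast b.isLt
  refine Set.Ioc_subset_Ioc (by positivity) ?_
  calc ((b : ℝ) + 1) * (L / n) ≤ n * (L / n) := by gcongr
    _ = L := by field_simp

theorem lt_of_mem_box {L : ℝ} (hL : 0 < L) {n : ℕ} {b c : Fin n} (hbc : b < c) {x y : ℝ}
    (hx : x ∈ box L n b) (hy : y ∈ box L n c) : x < y := by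
  have hn : (0 : ℝ) < n := by exact_mod_cast b.pos
  have hb : ((b : ℝ) + 1) ≤ c := by exact_mod_cast hbc
  refine lt_of_le_of_lt (hx.2.trans ?_) hy.1
  gcongr

theorem eq_of_mem_box {L : ℝ} (hL : 0 < L) {n : ℕ} {b c : Fin n} {x : ℝ}
    (hx : x ∈ box L n b) (hy : x ∈ box L n c) : b = c := by
  rcases lt_trichotomy b c with h | h | h
  · exact absurd (lt_of_mem_box hL h hx hy) (lt_irrefl _)
  · exact h
  · exact absurd (lt_of_mem_box hL h hy hx) (lt_irrefl _)

theorem exists_mem_box {L : ℝ} (hL : 0 < L) {n : ℕ} (hn : 0 < n) {x : ℝ} (hx : x ∈ Set.Ioc 0 L) :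
    ∃ b : Fin n, x ∈ box L n b := by
  have hn' : (0 : ℝ) < n := by exact_mod_cast hn
  have hl : 0 < L / n := by positivity
  have hpos : 0 < x / (L / n) := div_pos hx.1 hl
  -- The boxes are open on the left and closed on the right, so the index counted from `0` is the
  -- ceiling of `x / (L / n)` minus one.
  have hc : 0 < ⌈x / (L / n)⌉₊ := Nat.ceil_pos.mpr hpos
  have hle : ⌈x / (L / n)⌉₊ ≤ n := by
    refine Nat.ceil_le.mpr ((div_le_iff₀ hl).mpr ?_)
    rw [mul_div_cancel₀ _ hn'.ne']
    exact hx.2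
  obtain ⟨k, hk⟩ := Nat.exists_eq_succ_of_ne_zero hc.ne'
  refine ⟨⟨k, by omega⟩, ?_, ?_⟩
  · have := Nat.lt_ceil.mp (show k < ⌈x / (L / n)⌉₊ by omega)
    exact (lt_div_iff₀ hl).mp this
  · have := Nat.le_ceil (x / (L / n))
    rw [hk] at this
    push_cast at this
    exact (div_le_iff₀ hl).mp this

theorem integral_waveletFun_mul {L : ℝ} (hL : 0 < L) {n : ℕ} (a : WaveletLabel n) (f : ℝ → ℂ) :
    ∫ x in Set.Ioc 0 L, conj (waveletFun L a x) * f x =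
      (((Real.sqrt (L / n))⁻¹ : ℝ) : ℂ) *
        ∫ x in box L n a.2, Complex.exp (-(I * (x * momentum L a))) * f x := by
  have e : ∀ x : ℝ, conj (waveletFun L a x) * f x = (box L n a.2).indicator (fun x =>
      (((Real.sqrt (L / n))⁻¹ : ℝ) : ℂ) * (Complex.exp (-(I * (x * momentum L a))) * f x)) x := by
    intro x
    simp only [waveletFun, map_mul, Complex.conj_ofReal, conj_exp_I_mul]
    by_cases hx : x ∈ box L n a.2
    · simp [hx, mul_assoc]
    · simp [hx]
  simp only [e]
  rw [setIntegral_indicator (measurableSet_box L n a.2),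
    Set.inter_eq_right.mpr (box_subset hL a.2), integral_const_mul]

/-- Two momenta in the same box differ by a multiple of `2π / (L / n)`, so their relative phase is
integrated over full periods; wavelets of different boxes have disjoint supports. -/
theorem orthonormal_waveletFun {L : ℝ} (hL : 0 < L) (n : ℕ) :
    Orthonormal ℂ fun a : WaveletLabel n => ((memLp_waveletFun L a).toLp _ : RingSpace L) := by
  rw [orthonormal_iff_ite]
  intro a c
  have hn : (0 : ℝ) < n := by exact_mod_cast a.2.pos
  have hl : 0 < L / n := by positivity
  have hl' : ((L / n : ℝ) : ℂ) ≠ 0 := by exact_mod_cast hl.ne'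
  rw [inner_toLp_toLp, integral_waveletFun_mul hL]
  by_cases hb : a.2 = c.2
  · have e : ∀ x ∈ box L n a.2, Complex.exp (-(I * (x * momentum L a))) * waveletFun L c x =
        (((Real.sqrt (L / n))⁻¹ : ℝ) : ℂ) *
          Complex.exp (2 * Real.pi * I * (c.1 - a.1 : ℤ) * x / (L / n : ℝ)) := by
      intro x hx
      rw [hb] at hx
      simp only [waveletFun, Set.indicator_of_mem hx, mul_one]
      rw [mul_left_comm, ← Complex.exp_add]
      congr 2
      simp only [momentum]
      push_cast
      field_simp
      ring
    rw [setIntegral_congr_fun (measurableSet_box L n a.2) e, integral_const_mul, ← mul_assoc,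
      inv_sqrt_mul_self hl]
    have h := integral_exp_period (a.2 * (L / n)) (L / n) hl (c.1 - a.1)
    have e2 : (a.2 : ℝ) * (L / n) + L / n = ((a.2 : ℝ) + 1) * (L / n) := by ring
    rw [intervalIntegral.integral_of_le (by linarith), e2] at h
    rw [box, h]
    by_cases hac : a = c
    · rw [hac, sub_self, if_pos rfl, if_pos rfl, inv_mul_cancel₀ hl']
    · have : c.1 - a.1 ≠ 0 := fun h => hac (Prod.ext (by omega) hb)
      simp [hac, this]
  · have e : ∀ x ∈ box L n a.2,
        Complex.exp (-(I * (x * momentum L a))) * waveletFun L c x = 0 := by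
      intro x hx
      have : x ∉ box L n c.2 := fun hx' => hb (eq_of_mem_box hL hx hx')
      simp [waveletFun, this]
    rw [setIntegral_congr_fun (measurableSet_box L n a.2) e]
    have : a ≠ c := fun h => hb (by rw [h])
    simp [this]

theorem eq_zero_of_inner_waveletFun {L : ℝ} (hL : 0 < L) {n : ℕ} (hn : 0 < n) (f : RingSpace L)
    (h : ∀ a : WaveletLabel n, inner ℂ ((memLp_waveletFun L a).toLp _ : RingSpace L) f = 0) :
    f = 0 := by
  have hn' : (0 : ℝ) < n := by exact_mod_cast hn
  have hl : 0 < L / n := by positivity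
  have hl' : (((Real.sqrt (L / n))⁻¹ : ℝ) : ℂ) ≠ 0 := by
    have := Real.sqrt_pos.mpr hl
    exact_mod_cast (inv_pos.mpr this).ne'
  have hbox : ∀ b : Fin n, f =ᵐ[volume.restrict (box L n b)] 0 := by
    intro b
    refine ae_eq_zero_of_fourier (by nlinarith)
      ((Lp.memLp f).mono_measure (Measure.restrict_mono (box_subset hL b) le_rfl)) fun k => ?_
    have h1 := h (k, b)
    rw [inner_toLp_left, integral_waveletFun_mul hL, mul_eq_zero] at h1
    rw [← h1.resolve_left hl']
    refine integral_congr_ae (Filter.Eventually.of_forall fun x => ?_)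
    simp only [momentum]
    congr 2
    push_cast
    field_simp
    ring
  refine (Lp.eq_zero_iff_ae_eq_zero).mpr ?_
  have h1 : ∀ᵐ x ∂(volume : Measure ℝ), ∀ b : Fin n, x ∈ box L n b → f x = 0 :=
    ae_all_iff.mpr fun b => (ae_restrict_iff' (measurableSet_box L n b)).mp (hbox b)
  refine (ae_restrict_iff' measurableSet_Ioc).mpr ?_
  filter_upwards [h1] with x hx hxL
  obtain ⟨b, hb⟩ := exists_mem_box hL hn hxL
  exact hx b hb

/-- The Hilbert basis of wavelets. -/
def waveletBasis {L : ℝ} (hL : 0 < L) {n : ℕ} (hn : 0 < n) :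
    HilbertBasis (WaveletLabel n) ℂ (RingSpace L) :=
  HilbertBasis.mkOfOrthogonalEqBot (orthonormal_waveletFun hL n)
    (span_orthogonal_eq_bot (eq_zero_of_inner_waveletFun hL hn))

theorem waveletBasis_apply {L : ℝ} (hL : 0 < L) {n : ℕ} (hn : 0 < n) (a : WaveletLabel n) :
    waveletBasis hL hn a = (memLp_waveletFun L a).toLp _ := by
  rw [waveletBasis, HilbertBasis.coe_mkOfOrthogonalEqBot]

/-- Equality would make the odd number `2m + 1` equal to an even one. Hence the denominators `λ - α`
never vanish. -/
theorem ringMomentum_sub_momentum_ne_zero {L : ℝ} (hL : 0 < L) {n : ℕ} (m : ℤ)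
    (a : WaveletLabel n) : ringMomentum L m - momentum L a ≠ 0 := by
  intro h
  have hpi := Real.pi_pos
  have h1 : 2 * Real.pi * ((m : ℝ) + 1 / 2) = 2 * Real.pi * n * a.1 := by
    simp only [ringMomentum, momentum] at h
    field_simp at h
    linarith
  have h2 : (m : ℝ) + 1 / 2 = n * a.1 := by
    have : 2 * Real.pi ≠ 0 := by positivity
    refine mul_left_cancel₀ this ?_
    rw [h1]; ring
  have h3 : 2 * m + 1 = 2 * (n * a.1) := by
    have : (2 * m + 1 : ℝ) = 2 * (n * a.1) := by linarith
    exact_mod_cast this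
  omega

/-- `φ(λ, α)` is the overlap of a plane wave and a wavelet. -/
theorem inner_ringBasis_waveletBasis {L : ℝ} (hL : 0 < L) {n : ℕ} (hn : 0 < n) (m : ℤ)
    (a : WaveletLabel n) :
    inner ℂ (ringBasis hL m) (waveletBasis hL hn a) = overlap L (ringMomentum L m) a := by
  have hn' : (0 : ℝ) < n := by exact_mod_cast hn
  have hl : 0 < L / n := by positivity
  have hnC : (n : ℂ) ≠ 0 := by exact_mod_cast hn.ne'
  have hLC : (L : ℂ) ≠ 0 := by exact_mod_cast hL.ne'
  have hd : (ringMomentum L m : ℂ) - (momentum L a : ℂ) ≠ 0 := by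
    exact_mod_cast ringMomentum_sub_momentum_ne_zero hL m a
  have hc : I * ((momentum L a : ℂ) - ringMomentum L m) ≠ 0 :=
    mul_ne_zero I_ne_zero (by rw [← neg_sub]; exact neg_ne_zero.mpr hd)
  rw [← inner_conj_symm, ringBasis_apply, waveletBasis_apply, inner_toLp_toLp,
    integral_waveletFun_mul hL, box,
    map_mul, Complex.conj_ofReal, ← integral_conj,
    ← intervalIntegral.integral_of_le (by nlinarith)]
  have e : ∀ x : ℝ, conj (Complex.exp (-(I * (x * momentum L a))) * ringWave L m x) =
      (((Real.sqrt L)⁻¹ : ℝ) : ℂ) *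
        Complex.exp (I * ((momentum L a : ℂ) - ringMomentum L m) * x) := by
    intro x
    simp only [ringWave, map_mul, Complex.conj_ofReal, conj_exp_I_mul]
    rw [← Complex.exp_conj, mul_left_comm, ← Complex.exp_add]
    congr 2
    simp
    ring
  simp only [e]
  rw [intervalIntegral.integral_const_mul, integral_exp_mul_complex hc]
  -- At the end points of the boxes `e^{iαx} = 1`, since `α j L / n` is a multiple of `2π`. Only the
  -- phases in `λ` survive in the boundary terms.
  have hp1 : ∀ j : ℤ, Complex.exp (I * ((momentum L a : ℂ) - ringMomentum L m) *
      ((j * (L / n) : ℝ) : ℂ)) =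
      Complex.exp (-(I * (L : ℂ) * j / (n : ℂ) * (ringMomentum L m : ℂ))) := by
    intro j
    have : I * ((momentum L a : ℂ) - ringMomentum L m) * ((j * (L / n) : ℝ) : ℂ) =
        -(I * (L : ℂ) * j / (n : ℂ) * (ringMomentum L m : ℂ)) + (a.1 * j : ℤ) * (2 * Real.pi * I) := by
      simp only [momentum]
      push_cast
      field_simp
      ring
    rw [this, Complex.exp_add, Complex.exp_int_mul_two_pi_mul_I, mul_one]
  have h1 := hp1 (((a.2 : ℕ) : ℤ) + 1)
  have h0 := hp1 ((a.2 : ℕ) : ℤ)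
  simp only [Int.cast_add, Int.cast_natCast, Int.cast_one] at h0 h1
  rw [h0, h1, overlap]
  have hs : (((Real.sqrt (L / n))⁻¹ : ℝ) : ℂ) * (((Real.sqrt L)⁻¹ : ℝ) : ℂ) =
      (Real.sqrt n : ℂ) / L := by
    rw [← Complex.ofReal_mul, ← Complex.ofReal_div]
    congr 1
    rw [Real.sqrt_div hL.le, inv_div, div_mul_eq_mul_div, div_eq_div_iff (by positivity) hL.ne']
    have h5 := Real.mul_self_sqrt hL.le
    have h6 : Real.sqrt L ≠ 0 := (Real.sqrt_pos.mpr hL).ne'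
    field_simp
    nlinarith
  have h2 : Complex.exp (-(I * (L : ℂ) * ((a.2 : ℕ) : ℂ) / (n : ℂ) * (ringMomentum L m : ℂ))) =
      Complex.exp (I * (L : ℂ) * (ringMomentum L m : ℂ) / (n : ℂ)) *
      Complex.exp (-(I * (L : ℂ) * (((a.2 : ℕ) : ℂ) + 1) / (n : ℂ) * (ringMomentum L m : ℂ))) := by
    rw [← Complex.exp_add]
    congr 1
    ring
  rw [h2, ← mul_assoc, hs]
  have hI : (1 : ℂ) / (I * ((momentum L a : ℂ) - ringMomentum L m)) =
      I / ((ringMomentum L m : ℂ) - momentum L a) := by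
    rw [div_eq_div_iff hc hd]
    linear_combination (-((momentum L a : ℂ) - ringMomentum L m)) * I_mul_I
  rw [div_eq_mul_one_div _ (I * ((momentum L a : ℂ) - ringMomentum L m)), hI]
  ring

/-! ## The one-particle evolution -/

theorem hasSum_of_forall_eq {κ : Type*} {f g : κ → ℂ} {s : ℂ} (hf : HasSum f s)
    (h : ∀ k, g k = f k) : HasSum g s := by
  rwa [funext h]

/-- This is matrix multiplication with an inserted basis: a continuous operator and functional act
termwise on the expansion of `y`. Summability in `ℂ` is unconditional and hence absolute, so the
absolute convergence of `U_t`, of the differential equation and of `ψ_t` comes from here. -/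
theorem hasSum_inner_clm {H κ : Type*} [NormedAddCommGroup H] [InnerProductSpace ℂ H]
    (w : HilbertBasis κ ℂ H) (T : H →L[ℂ] H) (x y : H) :
    HasSum (fun k => inner ℂ x (T (w k)) * inner ℂ (w k) y) (inner ℂ x (T y)) := by
  have h := ((w.hasSum_repr y).mapL T).mapL (innerSL ℂ x)
  have e : (fun k => inner ℂ x (T (w k)) * inner ℂ (w k) y) =
      fun k => innerSL ℂ x (T (w.repr y k • w k)) := by
    funext k
    rw [map_smul, innerSL_apply_apply, inner_smul_right, w.repr_apply_apply, mul_comm]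
  rw [e]
  exact h

theorem memLp_top_boxIndicator (L : ℝ) {n : ℕ} (b : Fin n) (μ : Measure ℝ) :
    MemLp ((box L n b).indicator fun _ => (1 : ℂ)) ⊤ μ :=
  memLp_top_of_norm_le (measurable_const.indicator (measurableSet_box L n b)) 1 fun x => by
    by_cases hx : x ∈ box L n b <;> simp [hx]

/-- The projection to a box. -/
def boxProj (L : ℝ) {n : ℕ} (b : Fin n) : RingSpace L →L[ℂ] RingSpace L :=
  mulOp (memLp_top_boxIndicator L b _)

/-- The one-particle potential energy operator. -/
def ringPotential (L : ℝ) {n : ℕ} (v : Fin n → ℝ → ℝ) (t : ℝ) : RingSpace L →L[ℂ] RingSpace L :=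
  ∑ b, (v b t : ℂ) • boxProj L b

theorem continuous_ringPotential (L : ℝ) {n : ℕ} {v : Fin n → ℝ → ℝ}
    (hv : ∀ b, Continuous (v b)) : Continuous (ringPotential L v) := by
  unfold ringPotential
  refine continuous_finsetSum _ fun b _ => ?_
  exact (Complex.continuous_ofReal.comp (hv b)).smul continuous_const

/-- The kinetic energy of a plane wave. -/
def ringEnergy (L : ℝ) (m : ℤ) : ℝ := ringMomentum L m ^ 2

/-- Each wavelet is supported in one box, so the box projections, and with them the potential, are
diagonal in the wavelet basis. -/
theorem inner_waveletBasis_boxProj {L : ℝ} (hL : 0 < L) {n : ℕ} (hn : 0 < n)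
    (a : WaveletLabel n) (b : Fin n) (x : RingSpace L) :
    inner ℂ (waveletBasis hL hn a) (boxProj L b x) =
      if a.2 = b then inner ℂ (waveletBasis hL hn a) x else 0 := by
  rw [waveletBasis_apply, inner_toLp_left, inner_toLp_left]
  have h : (fun y => conj (waveletFun L a y) * (boxProj L b x) y)
      =ᵐ[(volume : Measure ℝ).restrict (Set.Ioc 0 L)]
      fun y => if a.2 = b then conj (waveletFun L a y) * x y else 0 := by
    filter_upwards [coeFn_mulOp (memLp_top_boxIndicator L b _) x] with y hy
    rw [boxProj, hy]
    by_cases hya : y ∈ box L n a.2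
    · split_ifs with hab
      · rw [hab] at hya
        simp [hya]
      · have : y ∉ box L n b := fun h => hab (eq_of_mem_box hL hya h)
        simp [this]
    · simp [waveletFun, hya]
  rw [integral_congr_ae h]
  split_ifs <;> simp

theorem inner_waveletBasis_ringPotential {L : ℝ} (hL : 0 < L) {n : ℕ} (hn : 0 < n)
    (v : Fin n → ℝ → ℝ) (t : ℝ) (a : WaveletLabel n) (x : RingSpace L) :
    inner ℂ (waveletBasis hL hn a) (ringPotential L v t x) =
      (v a.2 t : ℂ) * inner ℂ (waveletBasis hL hn a) x := by
  simp only [ringPotential, sum_apply, smul_apply,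
    inner_sum, inner_smul_right, inner_waveletBasis_boxProj]
  simp

/-- The free one-particle evolution. -/
abbrev ringFree {L : ℝ} (hL : 0 < L) (t : ℝ) : RingSpace L →L[ℂ] RingSpace L :=
  freeEvolution (ringBasis hL) (ringEnergy L) t

/-- The sum over `K` inserts the plane waves, in which the free evolution is diagonal, between two
wavelets. -/
theorem hasSum_greenTerm {L : ℝ} (hL : 0 < L) {n : ℕ} (hn : 0 < n) (t : ℝ)
    (a c : WaveletLabel n) :
    HasSum (greenTerm L t a c)
      (inner ℂ (waveletBasis hL hn a) (ringFree hL t (waveletBasis hL hn c))) := by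
  refine hasSum_of_forall_eq ((ringBasis hL).hasSum_inner_mul_inner (waveletBasis hL hn a)
    (ringFree hL t (waveletBasis hL hn c))) fun m => ?_
  rw [inner_freeEvolution, inner_ringBasis_waveletBasis, ← inner_conj_symm,
    inner_ringBasis_waveletBasis, greenTerm, ringEnergy]
  push_cast
  ring

theorem green_eq_inner {L : ℝ} (hL : 0 < L) {n : ℕ} (hn : 0 < n) (t : ℝ)
    (a c : WaveletLabel n) :
    green L t a c = inner ℂ (waveletBasis hL hn a) (ringFree hL t (waveletBasis hL hn c)) :=
  (hasSum_greenTerm hL hn t a c).tsum_eq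

theorem hasSum_generator {L : ℝ} (hL : 0 < L) {n : ℕ} (hn : 0 < n) (v : Fin n → ℝ → ℝ) (t : ℝ)
    (a c : WaveletLabel n) :
    HasSum (fun g : WaveletLabel n => green L (-t) a g * (v g.2 t : ℂ) * green L t g c)
      (inner ℂ (waveletBasis hL hn a)
        (ringFree hL (-t) (ringPotential L v t (ringFree hL t (waveletBasis hL hn c))))) := by
  refine hasSum_of_forall_eq (hasSum_inner_clm (waveletBasis hL hn) (ringFree hL (-t)) (waveletBasis hL hn a)
    (ringPotential L v t (ringFree hL t (waveletBasis hL hn c)))) fun g => ?_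
  rw [inner_waveletBasis_ringPotential, green_eq_inner hL hn, green_eq_inner hL hn, mul_assoc]

theorem hasSum_generator_mul {L : ℝ} (hL : 0 < L) {n : ℕ} (hn : 0 < n) (v : Fin n → ℝ → ℝ)
    (t : ℝ) (a : WaveletLabel n) (y : RingSpace L) :
    HasSum (fun k : WaveletLabel n => generator L v t a k * inner ℂ (waveletBasis hL hn k) y)
      (inner ℂ (waveletBasis hL hn a)
        (ringFree hL (-t) (ringPotential L v t (ringFree hL t y)))) := by
  refine hasSum_of_forall_eq (hasSum_inner_clm (waveletBasis hL hn)
    ((ringFree hL (-t)).comp ((ringPotential L v t).comp (ringFree hL t)))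
    (waveletBasis hL hn a) y) fun k => ?_
  rw [generator, (hasSum_generator hL hn v t a k).tsum_eq]
  rfl

/-! ### The one-particle interaction picture in the wavelet basis. -/

variable {L : ℝ} (hL : 0 < L) {n : ℕ} (hn : 0 < n) {v : Fin n → ℝ → ℝ}
  (hv : ∀ b, Continuous (v b))

/-- The one-particle evolution in the interaction picture. -/
abbrev ringInteraction (t : ℝ) : RingSpace L →L[ℂ] RingSpace L :=
  interactionEvolution (ringBasis hL) (ringEnergy L) (continuous_ringPotential L hv) t

/-- The one-particle evolution. -/
abbrev ringEvolution (t : ℝ) : RingSpace L →L[ℂ] RingSpace L :=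
  evolution (ringBasis hL) (ringEnergy L) (continuous_ringPotential L hv) t

/-- The matrix of the one-particle evolution in the interaction picture, in the wavelet basis. -/
def interactionMatrix (t : ℝ) (a c : WaveletLabel n) : ℂ :=
  inner ℂ (waveletBasis hL hn a) (ringInteraction hL hv t (waveletBasis hL hn c))

theorem tsum_generator_mul (t : ℝ) (a : WaveletLabel n) (y : RingSpace L) :
    -I * ∑' k, generator L v t a k * inner ℂ (waveletBasis hL hn k) y =
      inner ℂ (waveletBasis hL hn a)
        (interactionGenerator (ringBasis hL) (ringEnergy L) (ringPotential L v) t y) := by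
  rw [(hasSum_generator_mul hL hn v t a y).tsum_eq, interactionGenerator_apply, inner_smul_right]

theorem hasSum_norm_inner_sq {H κ : Type*} [NormedAddCommGroup H] [InnerProductSpace ℂ H]
    (w : HilbertBasis κ ℂ H) (y : H) :
    HasSum (fun k => ‖inner ℂ (w k) y‖ ^ 2) (‖y‖ ^ 2) := by
  have h := Complex.hasSum_re (w.hasSum_inner_mul_inner y y)
  rw [inner_self_eq_norm_sq_to_K] at h
  convert h using 2 with k
  · rw [← inner_conj_symm y (w k), mul_comm, Complex.mul_conj, Complex.normSq_eq_norm_sq,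
      Complex.ofReal_re]
  · norm_cast

theorem isInteractionSolution_interactionMatrix :
    IsInteractionSolution L v (interactionMatrix hL hn hv) where
  initial a c := by
    rw [interactionMatrix, interactionEvolution_zero]
    exact orthonormal_iff_ite.mp (waveletBasis hL hn).orthonormal a c
  bounded T c := by
    obtain ⟨M, hM⟩ := exists_bound_of_continuous (continuous_interactionEvolution (ringBasis hL)
      (ringEnergy L) (continuous_ringPotential L hv) (waveletBasis hL hn c)) T
    refine ⟨M ^ 2, fun t ht => ?_⟩
    have h := hasSum_norm_inner_sq (waveletBasis hL hn)
      (ringInteraction hL hv t (waveletBasis hL hn c))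
    refine ⟨h.summable, ?_⟩
    unfold interactionMatrix
    rw [h.tsum_eq]
    exact pow_le_pow_left₀ (norm_nonneg _) (hM t ht) 2
  deriv t a c := by
    unfold interactionMatrix
    rw [tsum_generator_mul]
    exact ((innerSL ℂ (waveletBasis hL hn a)).restrictScalars ℝ).hasFDerivAt.comp_hasDerivAt t
      (hasDerivAt_interactionEvolution _ _ _ _ t)

/-- The vector with given square summable coordinates. -/
theorem exists_forall_inner_eq {H κ : Type*} [NormedAddCommGroup H] [InnerProductSpace ℂ H]
    (w : HilbertBasis κ ℂ H) (f : κ → ℂ) (hf : Summable fun k => ‖f k‖ ^ 2) :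
    ∃ y : H, ∀ k, inner ℂ (w k) y = f k := by
  have hm : Memℓp f 2 := (memℓp_gen_iff (by simp)).mpr (by simpa using hf)
  refine ⟨w.repr.symm ⟨f, hm⟩, fun k => ?_⟩
  rw [← w.repr_apply_apply, LinearIsometryEquiv.apply_symm_apply]

/-- A square summable column is the coordinate sequence of a vector. The matrix equation is then the
weak evolution equation for that vector, and the bound on the columns is the a priori bound that
uniqueness needs. -/
theorem eq_interactionMatrix {ψ : ℝ → WaveletLabel n → WaveletLabel n → ℂ}
    (hψ : IsInteractionSolution L v ψ) : ψ = interactionMatrix hL hn hv := by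
  have hsum : ∀ t c, Summable fun a => ‖ψ t a c‖ ^ 2 := fun t c =>
    ((hψ.bounded |t| c).choose_spec t le_rfl).1
  have hex : ∀ c t, ∃ y : RingSpace L, ∀ a, inner ℂ (waveletBasis hL hn a) y = ψ t a c :=
    fun c t => exists_forall_inner_eq _ (fun a => ψ t a c) (hsum t c)
  choose y hy using hex
  have key : ∀ c t, y c t = ringInteraction hL hv t (y c 0) := by
    intro c
    -- Two bases are involved: plane waves diagonalise the free evolution, while the equation is
    -- tested against wavelets.
    refine eq_interactionEvolution_of_weak_solution _ _ (waveletBasis hL hn) _ (fun T => ?_) ?_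
    · obtain ⟨C, hC⟩ := hψ.bounded T c
      refine ⟨Real.sqrt C, fun t ht => Real.le_sqrt_of_sq_le ?_⟩
      have h := hasSum_norm_inner_sq (waveletBasis hL hn) (y c t)
      simp only [hy] at h
      rw [← h.tsum_eq]
      exact (hC t ht).2
    · intro a t
      rw [← tsum_generator_mul]
      simp only [hy]
      exact hψ.deriv t a c
  funext t a c
  rw [← hy, key, interactionMatrix]
  congr 2
  refine hilbertBasis_ext (waveletBasis hL hn) fun k => ?_
  rw [hy, hψ.initial]
  exact (orthonormal_iff_ite.mp (waveletBasis hL hn).orthonormal k c).symm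

theorem summable_generator_mul (t : ℝ) (a c : WaveletLabel n) :
    Summable fun k => generator L v t a k * interactionMatrix hL hn hv t k c :=
  (hasSum_generator_mul hL hn v t a _).summable

theorem hasSum_psi (t : ℝ) (a c : WaveletLabel n) :
    HasSum (fun g => green L t a g * interactionMatrix hL hn hv t g c)
      (inner ℂ (waveletBasis hL hn a) (ringEvolution hL hv t (waveletBasis hL hn c))) := by
  simp only [green_eq_inner hL hn]
  exact hasSum_inner_clm (waveletBasis hL hn) (ringFree hL t) (waveletBasis hL hn a)
    (ringInteraction hL hv t (waveletBasis hL hn c))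

theorem psi_interactionMatrix (t : ℝ) (a c : WaveletLabel n) :
    psi L (interactionMatrix hL hn hv) t a c =
      inner ℂ (waveletBasis hL hn a) (ringEvolution hL hv t (waveletBasis hL hn c)) :=
  (hasSum_psi hL hn hv t a c).tsum_eq

/-! ## Distinguishable particles -/

/-- The Hilbert space of `N` distinguishable particles on the ring. -/
abbrev ConfigSpace (L : ℝ) (N : ℕ) : Type := Lp ℂ 2 (ringMeasure L N)

theorem quasiMeasurePreserving_eval (L : ℝ) {N : ℕ} (i : Fin N) :
    Measure.QuasiMeasurePreserving (Function.eval i) (ringMeasure L N)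
      ((volume : Measure ℝ).restrict (Set.Ioc 0 L)) :=
  Measure.quasiMeasurePreserving_eval _ i

theorem ae_forall_eval {L : ℝ} {N : ℕ} {p : Fin N → ℝ → Prop}
    (h : ∀ i, ∀ᵐ y ∂((volume : Measure ℝ).restrict (Set.Ioc 0 L)), p i y) :
    ∀ᵐ x ∂(ringMeasure L N), ∀ i, p i (x i) :=
  ae_all_iff.mpr fun i => (quasiMeasurePreserving_eval L i).ae (h i)

theorem memLp_prod (L : ℝ) {N : ℕ} {f : Fin N → ℝ → ℂ}
    (hf : ∀ i, MemLp (f i) 2 ((volume : Measure ℝ).restrict (Set.Ioc 0 L))) :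
    MemLp (fun x : Fin N → ℝ => ∏ i, f i (x i)) 2 (ringMeasure L N) := by
  have hm : AEStronglyMeasurable (fun x : Fin N → ℝ => ∏ i, f i (x i)) (ringMeasure L N) :=
    Finset.aestronglyMeasurable_fun_prod _ fun i _ =>
      (hf i).1.comp_quasiMeasurePreserving (quasiMeasurePreserving_eval L i)
  rw [memLp_two_iff_integrable_sq_norm hm]
  simp only [norm_prod, ← Finset.prod_pow]
  exact Integrable.fintype_prod (f := fun i y => ‖f i y‖ ^ 2)
    fun i => (memLp_two_iff_integrable_sq_norm (hf i).1).mp (hf i)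

/-- The product of one-particle wave functions. -/
def tensorFun {L : ℝ} {N : ℕ} (ψ : Fin N → RingSpace L) : ConfigSpace L N :=
  (memLp_prod L fun i => Lp.memLp (ψ i)).toLp _

theorem coeFn_tensorFun {L : ℝ} {N : ℕ} (ψ : Fin N → RingSpace L) :
    tensorFun ψ =ᵐ[ringMeasure L N] fun x => ∏ i, ψ i (x i) :=
  MemLp.coeFn_toLp _

theorem tensorFun_toLp {L : ℝ} {N : ℕ} {f : Fin N → ℝ → ℂ}
    (hf : ∀ i, MemLp (f i) 2 ((volume : Measure ℝ).restrict (Set.Ioc 0 L))) :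
    tensorFun (fun i => ((hf i).toLp (f i) : RingSpace L)) = (memLp_prod L hf).toLp _ := by
  refine Lp.ext ?_
  filter_upwards [coeFn_tensorFun fun i => ((hf i).toLp (f i) : RingSpace L),
    (memLp_prod L hf).coeFn_toLp, ae_forall_eval fun i => (hf i).coeFn_toLp] with x h1 h2 h3
  rw [h1, h2]
  exact Finset.prod_congr rfl fun i _ => h3 i

theorem inner_tensorFun {L : ℝ} {N : ℕ} (φ ψ : Fin N → RingSpace L) :
    inner ℂ (tensorFun φ) (tensorFun ψ) = ∏ i, inner ℂ (φ i) (ψ i) := by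
  rw [tensorFun, tensorFun, inner_toLp_toLp]
  simp only [inner_eq_integral, map_prod, ← Finset.prod_mul_distrib]
  exact integral_fintype_prod_eq_prod (fun i y => conj (φ i y) * ψ i y)

theorem norm_tensorFun {L : ℝ} {N : ℕ} (ψ : Fin N → RingSpace L) :
    ‖tensorFun ψ‖ = ∏ i, ‖ψ i‖ := by
  have h : ((‖tensorFun ψ‖ : ℝ) : ℂ) ^ 2 = ((∏ i, ‖ψ i‖ : ℝ) : ℂ) ^ 2 := by
    have h1 := inner_tensorFun ψ ψ
    simp only [inner_self_eq_norm_sq_to_K] at h1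
    rw [Finset.prod_pow] at h1
    push_cast
    exact h1
  have h2 : ‖tensorFun ψ‖ ^ 2 = (∏ i, ‖ψ i‖) ^ 2 := by exact_mod_cast h
  exact (sq_eq_sq₀ (norm_nonneg _) (by positivity)).mp h2

theorem tensorFun_update_ae {L : ℝ} {N : ℕ} (ψ : Fin N → RingSpace L) (i : Fin N)
    (φ : RingSpace L) :
    tensorFun (Function.update ψ i φ) =ᵐ[ringMeasure L N]
      fun x => ∏ j, Function.update (fun j => ψ j (x j)) i (φ (x i)) j := by
  filter_upwards [coeFn_tensorFun (Function.update ψ i φ)] with x hx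
  rw [hx]
  refine Finset.prod_congr rfl fun j _ => ?_
  by_cases h : j = i
  · subst h; simp
  · simp [h]

theorem tensorFun_update_add {L : ℝ} {N : ℕ} (ψ : Fin N → RingSpace L) (i : Fin N)
    (φ χ : RingSpace L) : tensorFun (Function.update ψ i (φ + χ)) =
      tensorFun (Function.update ψ i φ) + tensorFun (Function.update ψ i χ) := by
  refine Lp.ext ?_
  filter_upwards [tensorFun_update_ae ψ i (φ + χ), tensorFun_update_ae ψ i φ,
    tensorFun_update_ae ψ i χ, Lp.coeFn_add (tensorFun (Function.update ψ i φ))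
      (tensorFun (Function.update ψ i χ)),
    (quasiMeasurePreserving_eval L i).ae (Lp.coeFn_add φ χ)] with x h1 h2 h3 h4 h5
  rw [h4, Pi.add_apply, h1, h2, h3]
  simp only [Function.eval, Pi.add_apply] at h5
  rw [h5]
  exact (MultilinearMap.mkPiAlgebra ℂ (Fin N) ℂ).map_update_add _ i _ _

theorem tensorFun_update_smul {L : ℝ} {N : ℕ} (ψ : Fin N → RingSpace L) (i : Fin N) (c : ℂ)
    (φ : RingSpace L) : tensorFun (Function.update ψ i (c • φ)) =
      c • tensorFun (Function.update ψ i φ) := by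
  refine Lp.ext ?_
  filter_upwards [tensorFun_update_ae ψ i (c • φ), tensorFun_update_ae ψ i φ,
    Lp.coeFn_smul c (tensorFun (Function.update ψ i φ)),
    (quasiMeasurePreserving_eval L i).ae (Lp.coeFn_smul c φ)] with x h1 h2 h4 h5
  rw [h4, Pi.smul_apply, h1, h2]
  simp only [Function.eval, Pi.smul_apply] at h5
  rw [h5]
  exact (MultilinearMap.mkPiAlgebra ℂ (Fin N) ℂ).map_update_smul _ i _ _

/-- The product of one-particle wave functions, as a continuous multilinear map. -/
def tensor (L : ℝ) (N : ℕ) :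
    ContinuousMultilinearMap ℂ (fun _ : Fin N => RingSpace L) (ConfigSpace L N) :=
  MultilinearMap.mkContinuous
    { toFun := tensorFun
      map_update_add' := by
        intro inst ψ i φ χ
        -- Multilinearity is required for every decidability instance on `Fin N`, whereas the two
        -- update lemmas use the standard one.
        rw [Subsingleton.elim inst (instDecidableEqFin N)]
        exact tensorFun_update_add ψ i φ χ
      map_update_smul' := by
        intro inst ψ i c φ
        rw [Subsingleton.elim inst (instDecidableEqFin N)]
        exact tensorFun_update_smul ψ i c φ } 1
    fun ψ => by rw [one_mul]; exact (norm_tensorFun ψ).le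

theorem tensor_apply {L : ℝ} {N : ℕ} (ψ : Fin N → RingSpace L) : tensor L N ψ = tensorFun ψ := rfl

theorem inner_tensor {L : ℝ} {N : ℕ} (φ ψ : Fin N → RingSpace L) :
    inner ℂ (tensor L N φ) (tensor L N ψ) = ∏ i, inner ℂ (φ i) (ψ i) :=
  inner_tensorFun φ ψ

/-! ### The product basis -/

/-- A vector orthogonal to all products of basis vectors is orthogonal to all products. -/
theorem inner_tensor_eq_zero {L : ℝ} {N : ℕ} {ι : Type*} (b : HilbertBasis ι ℂ (RingSpace L))
    {f : ConfigSpace L N} (h : ∀ Λ : Fin N → ι, inner ℂ (tensor L N fun i => b (Λ i)) f = 0)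
    (ψ : Fin N → RingSpace L) : inner ℂ (tensor L N ψ) f = 0 := by
  -- Induction on the set `s` of slots allowed to hold arbitrary vectors; one slot is freed at a
  -- time, by linearity and density of the span.
  suffices key : ∀ (s : Finset (Fin N)) (ψ : Fin N → RingSpace L),
      (∀ i, i ∉ s → ψ i ∈ Set.range b) → inner ℂ (tensor L N ψ) f = 0 from
    key Finset.univ ψ fun i hi => absurd (Finset.mem_univ i) hi
  intro s
  induction s using Finset.induction with
  | empty =>
    intro ψ hψ
    choose Λ hΛ using fun i => hψ i (Finset.notMem_empty i)
    rw [← h Λ]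
    congr 2
    funext i
    exact (hΛ i).symm
  | insert j s hj ih =>
    intro ψ hψ
    have hspan : ∀ φ ∈ Submodule.span ℂ (Set.range b),
        inner ℂ (tensor L N (Function.update ψ j φ)) f = 0 := by
      intro φ hφ
      induction hφ using Submodule.span_induction with
      | mem φ hφ =>
        refine ih _ fun i hi => ?_
        by_cases hij : i = j
        · subst hij; simpa using hφ
        · rw [Function.update_of_ne hij]
          exact hψ i (by simp [hij, hi])
      | zero =>
        rw [ContinuousMultilinearMap.map_coord_zero _ j (by simp)]
        simp
      | add φ χ _ _ h1 h2 => rw [ContinuousMultilinearMap.map_update_add, inner_add_left, h1, h2,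
          add_zero]
      | smul c φ _ h1 => rw [ContinuousMultilinearMap.map_update_smul, inner_smul_left, h1,
          mul_zero]
    have hdense : Dense (Submodule.span ℂ (Set.range b) : Set (RingSpace L)) := by
      rw [Submodule.dense_iff_topologicalClosure_eq_top]
      exact b.dense_span
    have hclosed : IsClosed {φ : RingSpace L |
        inner ℂ (tensor L N (Function.update ψ j φ)) f = 0} := by
      refine isClosed_eq (Continuous.inner ?_ continuous_const) continuous_const
      exact (tensor L N).cont.comp (continuous_const.update j continuous_id)
    have := hdense.induction (P := fun φ => inner ℂ (tensor L N (Function.update ψ j φ)) f = 0)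
      hspan hclosed (ψ j)
    rwa [Function.update_eq_self] at this

/-- A vector orthogonal to all products vanishes. -/
theorem eq_zero_of_inner_tensor {L : ℝ} {N : ℕ} {f : ConfigSpace L N}
    (h : ∀ ψ : Fin N → RingSpace L, inner ℂ (tensor L N ψ) f = 0) : f = 0 := by
  have hfi : Integrable f (ringMeasure L N) := (Lp.memLp f).integrable (by norm_num)
  -- Indicators of rectangles are products, so `f` integrates to `0` over every rectangle.
  -- Rectangles form a π-system generating the σ-algebra, so the same holds over every measurable
  -- set.
  have hrect : ∀ t : Fin N → Set ℝ, (∀ i, MeasurableSet (t i)) →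
      ∫ x in Set.univ.pi t, f x ∂(ringMeasure L N) = 0 := by
    intro t ht
    have hmem : ∀ i, MemLp ((t i).indicator fun _ => (1 : ℂ)) 2
        ((volume : Measure ℝ).restrict (Set.Ioc 0 L)) := fun i =>
      (memLp_const (1 : ℂ)).indicator (ht i)
    rw [← h fun i => (hmem i).toLp _, tensor_apply, tensorFun_toLp hmem, inner_toLp_left,
      ← integral_indicator (MeasurableSet.univ_pi ht)]
    refine integral_congr_ae (Filter.Eventually.of_forall fun x => ?_)
    simp only [map_prod]
    by_cases hx : x ∈ Set.univ.pi t
    · have : ∀ i, x i ∈ t i := fun i => hx i trivial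
      simp [hx, this]
    · obtain ⟨i, hi⟩ : ∃ i, x i ∉ t i := by simpa using hx
      rw [Set.indicator_of_notMem hx, Finset.prod_eq_zero (Finset.mem_univ i) (by simp [hi]),
        zero_mul]
  have huniv : ∫ x, f x ∂(ringMeasure L N) = 0 := by
    have := hrect (fun _ => Set.univ) fun _ => MeasurableSet.univ
    rwa [Set.pi_univ, setIntegral_univ] at this
  have hall : ∀ s, MeasurableSet s → ∫ x in s, f x ∂(ringMeasure L N) = 0 := by
    refine MeasurableSpace.induction_on_inter generateFrom_pi.symm isPiSystem_pi (by simp) ?_ ?_ ?_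
    · rintro _ ⟨t, ht, rfl⟩
      exact hrect t fun i => ht i trivial
    · intro t ht h0
      have := integral_add_compl ht hfi
      rw [h0, huniv, zero_add] at this
      exact this
    · intro t hd ht h0
      rw [integral_iUnion ht hd hfi.integrableOn]
      simp [h0]
  exact (Lp.eq_zero_iff_ae_eq_zero).mpr
    (hfi.ae_eq_zero_of_forall_setIntegral_eq_zero fun s hs _ => hall s hs)

theorem orthonormal_tensor {L : ℝ} (N : ℕ) {ι : Type*} (b : HilbertBasis ι ℂ (RingSpace L)) :
    Orthonormal ℂ fun Λ : Fin N → ι => tensor L N fun i => b (Λ i) := by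
  classical
  rw [orthonormal_iff_ite]
  intro Λ M
  simp only [inner_tensor, orthonormal_iff_ite.mp b.orthonormal]
  by_cases h : Λ = M
  · simp [h]
  · obtain ⟨i, hi⟩ := Function.ne_iff.mp h
    rw [if_neg h, Finset.prod_eq_zero (Finset.mem_univ i) (if_neg hi)]

/-- The Hilbert basis of products of plane waves. -/
def configBasis {L : ℝ} (hL : 0 < L) (N : ℕ) : HilbertBasis (Fin N → ℤ) ℂ (ConfigSpace L N) :=
  HilbertBasis.mkOfOrthogonalEqBot (orthonormal_tensor N (ringBasis hL))
    (span_orthogonal_eq_bot fun _ hf => eq_zero_of_inner_tensor (inner_tensor_eq_zero _ hf))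

theorem configBasis_apply {L : ℝ} (hL : 0 < L) {N : ℕ} (Λ : Fin N → ℤ) :
    configBasis hL N Λ = tensor L N fun i => ringBasis hL (Λ i) := by
  rw [configBasis, HilbertBasis.coe_mkOfOrthogonalEqBot]

/-! ### The evolution of distinguishable particles -/

/-- The kinetic energy of a product of plane waves. -/
def configEnergy (L : ℝ) {N : ℕ} (Λ : Fin N → ℤ) : ℝ := ∑ i, ringEnergy L (Λ i)

theorem memLp_top_boxCount (L : ℝ) {n : ℕ} (N : ℕ) (b : Fin n) :
    MemLp (fun x : Fin N → ℝ => ∑ i, (box L n b).indicator (fun _ => (1 : ℂ)) (x i)) ⊤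
      (ringMeasure L N) := by
  refine memLp_top_of_norm_le (Finset.measurable_sum _ fun i _ => ?_) (∑ _i : Fin N, 1)
    fun x => (norm_sum_le _ _).trans (Finset.sum_le_sum fun i _ => ?_)
  · exact (measurable_const.indicator (measurableSet_box L n b)).comp (measurable_pi_apply i)
  · by_cases hx : x i ∈ box L n b <;> simp [hx]

/-- The operator that counts the particles in a box. -/
def boxCount (L : ℝ) {n : ℕ} (N : ℕ) (b : Fin n) : ConfigSpace L N →L[ℂ] ConfigSpace L N :=
  mulOp (memLp_top_boxCount L N b)

/-- The potential energy operator. -/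
def configPotential (L : ℝ) {n : ℕ} (N : ℕ) (v : Fin n → ℝ → ℝ) (t : ℝ) :
    ConfigSpace L N →L[ℂ] ConfigSpace L N :=
  ∑ b, (v b t : ℂ) • boxCount L N b

theorem continuous_configPotential (L : ℝ) {n : ℕ} (N : ℕ) {v : Fin n → ℝ → ℝ}
    (hv : ∀ b, Continuous (v b)) : Continuous (configPotential L N v) := by
  unfold configPotential
  refine continuous_finsetSum _ fun b _ => ?_
  exact (Complex.continuous_ofReal.comp (hv b)).smul continuous_const

theorem coeFn_configPotential (L : ℝ) {n : ℕ} {N : ℕ} (v : Fin n → ℝ → ℝ) (t : ℝ)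
    (f : ConfigSpace L N) :
    configPotential L N v t f =ᵐ[ringMeasure L N]
      fun x => (potential L (fun b => v b t) x : ℂ) * f x := by
  have hsum : (configPotential L N v t f : ConfigSpace L N) =
      ∑ b, (v b t : ℂ) • boxCount L N b f := by
    simp only [configPotential, sum_apply, smul_apply]
  rw [hsum]
  have h1 : ∀ᵐ x ∂(ringMeasure L N), ∀ b : Fin n, ((v b t : ℂ) • boxCount L N b f) x =
      (v b t : ℂ) * ((∑ i, (box L n b).indicator (fun _ => (1 : ℂ)) (x i)) * f x) := by
    refine ae_all_iff.mpr fun b => ?_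
    filter_upwards [Lp.coeFn_smul (v b t : ℂ) (boxCount L N b f),
      coeFn_mulOp (memLp_top_boxCount L N b) f] with x h1 h2
    rw [h1, Pi.smul_apply, boxCount, h2, smul_eq_mul]
  filter_upwards [h1, Lp.coeFn_finsetSum Finset.univ fun b => (v b t : ℂ) • boxCount L N b f]
    with x h1 h2
  rw [h2, Finset.sum_apply, Finset.sum_congr rfl fun b _ => h1 b]
  simp only [potential]
  push_cast
  simp only [Finset.sum_mul, Finset.mul_sum]
  rw [Finset.sum_comm]
  refine Finset.sum_congr rfl fun i _ => Finset.sum_congr rfl fun b _ => ?_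
  by_cases hx : x i ∈ box L n b <;> simp [hx]

/-- The counting function is a sum over the particles, and each summand multiplies a single factor
of the product. -/
theorem boxCount_tensor (L : ℝ) {n : ℕ} {N : ℕ} (b : Fin n) (ψ : Fin N → RingSpace L) :
    boxCount L N b (tensor L N ψ) =
      ∑ i, tensor L N (Function.update ψ i (boxProj L b (ψ i))) := by
  refine Lp.ext ?_
  have h1 : ∀ᵐ x ∂(ringMeasure L N), ∀ i, tensor L N (Function.update ψ i (boxProj L b (ψ i))) x =
      ∏ j, Function.update (fun j => ψ j (x j)) i (boxProj L b (ψ i) (x i)) j :=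
    ae_all_iff.mpr fun i => tensorFun_update_ae ψ i _
  filter_upwards [coeFn_mulOp (memLp_top_boxCount L N b) (tensor L N ψ), h1, coeFn_tensorFun ψ,
    Lp.coeFn_finsetSum Finset.univ fun i => tensor L N (Function.update ψ i (boxProj L b (ψ i))),
    ae_forall_eval fun i => coeFn_mulOp (memLp_top_boxIndicator L b _) (ψ i)] with x h1 h2 h3 h4 h5
  rw [boxCount, h1, h4, Finset.sum_apply, Finset.sum_congr rfl fun i _ => h2 i, tensor_apply, h3,
    Finset.sum_mul]
  refine Finset.sum_congr rfl fun i _ => ?_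
  have h6 : (boxProj L b (ψ i)) (x i) =
      (box L n b).indicator (fun _ => (1 : ℂ)) (x i) * (ψ i) (x i) := h5 i
  rw [h6, Finset.prod_update_of_mem (Finset.mem_univ i), mul_assoc, Finset.sdiff_singleton_eq_erase,
    Finset.mul_prod_erase Finset.univ (fun j => ψ j (x j)) (Finset.mem_univ i)]

theorem configPotential_tensor (L : ℝ) {n : ℕ} {N : ℕ} (v : Fin n → ℝ → ℝ) (t : ℝ)
    (ψ : Fin N → RingSpace L) :
    configPotential L N v t (tensor L N ψ) =
      ∑ i, tensor L N (Function.update ψ i (ringPotential L v t (ψ i))) := by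
  have h : ∀ i, tensor L N (Function.update ψ i (ringPotential L v t (ψ i))) =
      ∑ b, (v b t : ℂ) • tensor L N (Function.update ψ i (boxProj L b (ψ i))) := by
    intro i
    simp only [ringPotential, sum_apply, smul_apply, ← ContinuousMultilinearMap.map_update_smul]
    exact (tensor L N).toMultilinearMap.map_update_sum Finset.univ i
      (fun b => (v b t : ℂ) • boxProj L b (ψ i)) ψ
  simp only [h, configPotential, sum_apply, smul_apply, boxCount_tensor, Finset.smul_sum]
  exact Finset.sum_comm

section

variable {L : ℝ} (hL : 0 < L) {n : ℕ} {v : Fin n → ℝ → ℝ} (hv : ∀ b, Continuous (v b))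

/-- The evolution of `N` distinguishable particles. -/
abbrev configEvolution (N : ℕ) (t : ℝ) : ConfigSpace L N →L[ℂ] ConfigSpace L N :=
  evolution (configBasis hL N) (configEnergy L) (continuous_configPotential L N hv) t

/-- Distinguishable particles evolve independently. -/
theorem configEvolution_tensor {N : ℕ} (t : ℝ) (ψ : Fin N → RingSpace L) :
    configEvolution hL hv N t (tensor L N ψ) = tensor L N fun i => ringEvolution hL hv t (ψ i) := by
  have hc : ∀ i, Continuous fun t => ringEvolution hL hv t (ψ i) := fun i =>
    continuous_evolution _ _ _ _
  -- The product of the one-particle evolutions is shown to be a weak solution. Its coordinates are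
  -- products, and the product rule yields the sum of the energies plus the potential acting on one
  -- factor at a time.
  have h := eq_evolution_of_weak_solution (configBasis hL N) (configEnergy L)
    (continuous_configPotential L N hv)
    (y := fun t => tensor L N fun i => ringEvolution hL hv t (ψ i))
    (exists_bound_of_continuous ((tensor L N).cont.comp (continuous_pi hc))) ?_ t
  · simp only [evolution_zero] at h
    exact h.symm
  · intro Λ t
    simp only [configBasis_apply, inner_tensor, configPotential_tensor, inner_sum]
    have h1 : ∀ i ∈ Finset.univ, HasDerivAt
        (fun s => inner ℂ (ringBasis hL (Λ i)) (ringEvolution hL hv s (ψ i)))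
        (-I * ((ringEnergy L (Λ i) : ℂ) * inner ℂ (ringBasis hL (Λ i))
            (ringEvolution hL hv t (ψ i)) +
          inner ℂ (ringBasis hL (Λ i))
            (ringPotential L v t (ringEvolution hL hv t (ψ i))))) t := by
      intro i _
      have := hasDerivAt_inner_evolution (ringBasis hL) (ringEnergy L)
        (continuous_ringPotential L hv) (f := ringBasis hL (Λ i))
        (h := (ringEnergy L (Λ i) : ℂ) • ringBasis hL (Λ i)) (fun j => ?_) (ψ i) t
      · rwa [inner_smul_left, Complex.conj_ofReal] at this
      · rw [inner_smul_right]
        by_cases hj : j = Λ i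
        · rw [hj]
        · rw [(ringBasis hL).orthonormal.2 hj, mul_zero, mul_zero]
    refine (HasDerivAt.fun_finsetProd h1).congr_deriv ?_
    rw [configEnergy]
    push_cast
    rw [Finset.sum_mul, ← Finset.sum_add_distrib, Finset.mul_sum]
    refine Finset.sum_congr rfl fun i _ => ?_
    have h2 : ∏ j, inner ℂ (ringBasis hL (Λ j)) (Function.update
        (fun j => ringEvolution hL hv t (ψ j)) i
          (ringPotential L v t (ringEvolution hL hv t (ψ i))) j) =
        inner ℂ (ringBasis hL (Λ i)) (ringPotential L v t (ringEvolution hL hv t (ψ i))) *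
          ∏ j ∈ Finset.univ.erase i, inner ℂ (ringBasis hL (Λ j)) (ringEvolution hL hv t (ψ j)) := by
      rw [← Finset.mul_prod_erase _ _ (Finset.mem_univ i), Function.update_self]
      congr 1
      refine Finset.prod_congr rfl fun j hj => ?_
      rw [Function.update_of_ne (Finset.ne_of_mem_erase hj)]
    rw [h2, ← Finset.mul_prod_erase _ _ (Finset.mem_univ i), smul_eq_mul]
    ring

/-! ### Permutation symmetry of the evolution. -/

/-- The action of a permutation of the particles. -/
def permOp (L : ℝ) {N : ℕ} (σ : Equiv.Perm (Fin N)) : ConfigSpace L N →ₗᵢ[ℂ] ConfigSpace L N :=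
  Lp.compMeasurePreservingₗᵢ ℂ (fun x : Fin N → ℝ => x ∘ σ) (measurePreserving_perm L σ)

theorem coeFn_permOp {N : ℕ} (σ : Equiv.Perm (Fin N)) (f : ConfigSpace L N) :
    permOp L σ f =ᵐ[ringMeasure L N] fun x => f (x ∘ σ) :=
  Lp.coeFn_compMeasurePreserving f (measurePreserving_perm L σ)

theorem permOp_tensor {N : ℕ} (σ : Equiv.Perm (Fin N)) (ψ : Fin N → RingSpace L) :
    permOp L σ (tensor L N (ψ ∘ σ)) = tensor L N ψ := by
  refine Lp.ext ?_
  filter_upwards [coeFn_permOp σ (tensor L N (ψ ∘ σ)), coeFn_tensorFun ψ,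
    (measurePreserving_perm L σ).quasiMeasurePreserving.ae (coeFn_tensorFun (ψ ∘ σ))]
    with x h1 h2 h3
  rw [h1, tensor_apply, h3, tensor_apply, h2]
  exact Equiv.prod_comp σ fun i => ψ i (x i)

theorem potential_perm {N : ℕ} (w : Fin n → ℝ) (σ : Equiv.Perm (Fin N)) (x : Fin N → ℝ) :
    potential L w (x ∘ σ) = potential L w x :=
  Equiv.sum_comp σ fun i => ∑ b : Fin n, (box L n b).indicator (fun _ => w b) (x i)

theorem permOp_configPotential {N : ℕ} (σ : Equiv.Perm (Fin N)) (t : ℝ) (f : ConfigSpace L N) :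
    permOp L σ (configPotential L N v t f) = configPotential L N v t (permOp L σ f) := by
  refine Lp.ext ?_
  filter_upwards [coeFn_permOp σ (configPotential L N v t f), coeFn_permOp σ f,
    coeFn_configPotential L v t (permOp L σ f),
    (measurePreserving_perm L σ).quasiMeasurePreserving.ae (coeFn_configPotential L v t f)]
    with x h1 h2 h3 h4
  rw [h1, h3, h4, h2, potential_perm]

theorem inner_configBasis_permOp {N : ℕ} (σ : Equiv.Perm (Fin N)) (Λ : Fin N → ℤ)
    (f : ConfigSpace L N) :
    inner ℂ (configBasis hL N Λ) (permOp L σ f) = inner ℂ (configBasis hL N (Λ ∘ σ)) f := by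
  rw [configBasis_apply, configBasis_apply, ← permOp_tensor σ, LinearIsometry.inner_map_map]
  rfl

theorem configEnergy_perm {N : ℕ} (σ : Equiv.Perm (Fin N)) (Λ : Fin N → ℤ) :
    configEnergy L (Λ ∘ σ) = configEnergy L Λ :=
  Equiv.sum_comp σ fun i => ringEnergy L (Λ i)

theorem hasDerivAt_inner_configBasis {N : ℕ} (Λ : Fin N → ℤ) (x : ConfigSpace L N) (t : ℝ) :
    HasDerivAt (fun s => inner ℂ (configBasis hL N Λ) (configEvolution hL hv N s x))
      (-I * ((configEnergy L Λ : ℂ) * inner ℂ (configBasis hL N Λ) (configEvolution hL hv N t x) +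
        inner ℂ (configBasis hL N Λ) (configPotential L N v t (configEvolution hL hv N t x)))) t := by
  have := hasDerivAt_inner_evolution (configBasis hL N) (configEnergy L)
    (continuous_configPotential L N hv) (f := configBasis hL N Λ)
    (h := (configEnergy L Λ : ℂ) • configBasis hL N Λ) (fun j => ?_) x t
  · rwa [inner_smul_left, Complex.conj_ofReal] at this
  · rw [inner_smul_right]
    by_cases hj : j = Λ
    · rw [hj]
    · rw [(configBasis hL N).orthonormal.2 hj, mul_zero, mul_zero]

/-- The evolution commutes with permutations of the particles. -/
theorem permOp_configEvolution {N : ℕ} (σ : Equiv.Perm (Fin N)) (t : ℝ) (f : ConfigSpace L N) :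
    permOp L σ (configEvolution hL hv N t f) = configEvolution hL hv N t (permOp L σ f) := by
  -- The permuted solution satisfies the same equation, since the potential is symmetric and the
  -- energy is invariant under permuting the momenta; uniqueness gives the equality.
  have h := eq_evolution_of_weak_solution (configBasis hL N) (configEnergy L)
    (continuous_configPotential L N hv)
    (y := fun t => permOp L σ (configEvolution hL hv N t f))
    (exists_bound_of_continuous ((permOp L σ).continuous.comp (continuous_evolution _ _ _ f))) ?_ t
  · simp only [evolution_zero] at h
    exact h
  · intro Λ t
    rw [← permOp_configPotential]
    simp only [inner_configBasis_permOp, ← configEnergy_perm σ Λ]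
    exact hasDerivAt_inner_configBasis hL hv (Λ ∘ σ) f t

end

/-! ## The sign factor -/

theorem real_sign_mul (r s : ℝ) : Real.sign (r * s) = Real.sign r * Real.sign s := by
  rcases lt_trichotomy r 0 with hr | hr | hr <;> rcases lt_trichotomy s 0 with hs | hs | hs <;>
    simp [Real.sign_of_neg, Real.sign_of_pos, hr, hs, mul_neg_of_neg_of_pos,
      mul_neg_of_pos_of_neg, mul_pos_of_neg_of_neg]

theorem real_sign_prod {ι : Type*} (s : Finset ι) (f : ι → ℝ) :
    Real.sign (∏ i ∈ s, f i) = ∏ i ∈ s, Real.sign (f i) := by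
  classical
  induction s using Finset.induction with
  | empty => simp
  | insert i s hi ih => rw [Finset.prod_insert hi, Finset.prod_insert hi, real_sign_mul, ih]

/-- Writing the product through a Vandermonde determinant makes its antisymmetry a matter of
permuting rows. The argument is `-x` because the Vandermonde factors are the later entry minus the
earlier one. -/
theorem signProd_eq_sign_det {N : ℕ} (x : Fin N → ℝ) :
    signProd x = Real.sign (Matrix.det (Matrix.vandermonde (-x))) := by
  rw [Matrix.det_vandermonde, real_sign_prod, signProd, Finset.prod_filter,
    Fintype.prod_prod_type]
  refine Finset.prod_congr rfl fun i _ => ?_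
  rw [real_sign_prod, ← Finset.prod_filter]
  refine Finset.prod_congr (by ext j; simp) fun j _ => ?_
  congr 1
  simp only [Pi.neg_apply]
  ring

theorem signProd_perm {N : ℕ} (σ : Equiv.Perm (Fin N)) (x : Fin N → ℝ) :
    signProd (x ∘ σ) = ((Equiv.Perm.sign σ : ℤ) : ℝ) * signProd x := by
  rw [signProd_eq_sign_det, signProd_eq_sign_det]
  have h : Matrix.vandermonde (-(x ∘ σ)) = (Matrix.vandermonde (-x)).submatrix σ id := rfl
  rw [h, Matrix.det_permute, real_sign_mul]
  rcases Int.units_eq_one_or (Equiv.Perm.sign σ) with h | h <;> simp [h, Real.sign_neg]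

theorem signProd_mul_self {N : ℕ} {x : Fin N → ℝ} (hx : Function.Injective x) :
    signProd x * signProd x = 1 := by
  rw [signProd, ← Finset.prod_mul_distrib]
  refine Finset.prod_eq_one fun p hp => ?_
  have hne : x p.1 - x p.2 ≠ 0 := sub_ne_zero.mpr fun h =>
    (Finset.mem_filter.mp hp).2.ne (hx h)
  rcases Real.sign_apply_eq_of_ne_zero _ hne with h | h <;> simp [h]

theorem measurable_signProd (N : ℕ) : Measurable fun x : Fin N → ℝ => signProd x :=
  Finset.measurable_prod _ fun p _ => measurable_sgn.comp (by fun_prop)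

theorem norm_signProd_le {N : ℕ} (x : Fin N → ℝ) : ‖signProd x‖ ≤ 1 := by
  rw [signProd, norm_prod]
  exact Finset.prod_le_one (fun _ _ => norm_nonneg _) fun p _ => norm_sgn_le _

theorem eventually_sign_eq {r : ℝ} (hr : r ≠ 0) : ∀ᶠ s in nhds r, Real.sign s = Real.sign r := by
  rcases lt_or_gt_of_ne hr with h | h
  · filter_upwards [Iio_mem_nhds h] with s hs
    rw [Real.sign_of_neg hs, Real.sign_of_neg h]
  · filter_upwards [Ioi_mem_nhds h] with s hs
    rw [Real.sign_of_pos hs, Real.sign_of_pos h]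

/-- Off the coincidences the sign factor is locally constant. -/
theorem eventually_signProd_eq {N : ℕ} {x : Fin N → ℝ} (hx : Function.Injective x) :
    ∀ᶠ y in nhds x, signProd y = signProd x := by
  have h : ∀ p : Fin N × Fin N, p.1 < p.2 →
      ∀ᶠ y in nhds x, Real.sign (y p.1 - y p.2) = Real.sign (x p.1 - x p.2) := by
    intro p hp
    have hc : ContinuousAt (fun y : Fin N → ℝ => y p.1 - y p.2) x := by fun_prop
    exact hc.eventually (eventually_sign_eq (sub_ne_zero.mpr fun h => hp.ne (hx h)))
  have h' : ∀ᶠ y in nhds x, ∀ p : Fin N × Fin N, p.1 < p.2 →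
      Real.sign (y p.1 - y p.2) = Real.sign (x p.1 - x p.2) := by
    refine Filter.eventually_all.mpr fun p => ?_
    by_cases hp : p.1 < p.2
    · filter_upwards [h p hp] with y hy _ using hy
    · exact Filter.Eventually.of_forall fun y hp' => absurd hp' hp
  filter_upwards [h'] with y hy
  exact Finset.prod_congr rfl fun p hp => hy p (Finset.mem_filter.mp hp).2

/-- The coincidence sets `x i = x j` are proper subspaces, hence null. Off them the sign factor
squares to `1`. -/
theorem ae_injective (L : ℝ) (N : ℕ) : ∀ᵐ x ∂(ringMeasure L N), Function.Injective x := by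
  have h : ∀ i j : Fin N, i ≠ j → ∀ᵐ x ∂(ringMeasure L N), x i ≠ x j := by
    intro i j hij
    have h1 : (ringMeasure L N) ≪ volume := by
      rw [ringMeasure, ← Measure.restrict_pi_pi]
      exact Measure.absolutelyContinuous_of_le Measure.restrict_le_self
    let s : Submodule ℝ (Fin N → ℝ) :=
      LinearMap.ker ((LinearMap.proj i : (Fin N → ℝ) →ₗ[ℝ] ℝ) - LinearMap.proj j)
    have hs : s ≠ ⊤ := by
      intro h
      have : (Pi.single i 1 : Fin N → ℝ) ∈ s := by rw [h]; trivial
      simp [s, hij.symm] at this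
    have h0 := Measure.addHaar_submodule (volume : Measure (Fin N → ℝ)) s hs
    refine h1.ae_le (ae_iff.mpr (measure_mono_null (fun x hx => ?_) h0))
    have hx' : x i = x j := by simpa using hx
    simp [s, hx']
  have h' : ∀ᵐ x ∂(ringMeasure L N), ∀ i j : Fin N, i ≠ j → x i ≠ x j := by
    refine ae_all_iff.mpr fun i => ae_all_iff.mpr fun j => ?_
    by_cases hij : i = j
    · exact Filter.Eventually.of_forall fun x h => absurd hij h
    · filter_upwards [h i j hij] with x hx _ using hx
  filter_upwards [h'] with x hx i j hij
  by_contra hne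
  exact hx i j hne hij

theorem memLp_top_signProd (L : ℝ) (N : ℕ) :
    MemLp (fun x : Fin N → ℝ => (signProd x : ℂ)) ⊤ (ringMeasure L N) :=
  memLp_top_of_norm_le (Complex.measurable_ofReal.comp (measurable_signProd N)) 1 fun x => by
    rw [Complex.norm_real]; exact norm_signProd_le x

/-- Multiplication by the sign factor, which exchanges bosonic and fermionic wave functions. -/
def signOp (L : ℝ) (N : ℕ) : ConfigSpace L N →L[ℂ] ConfigSpace L N :=
  mulOp (memLp_top_signProd L N)

theorem coeFn_signOp {L : ℝ} {N : ℕ} (f : ConfigSpace L N) :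
    signOp L N f =ᵐ[ringMeasure L N] fun x => (signProd x : ℂ) * f x :=
  coeFn_mulOp _ f

theorem signOp_signOp {L : ℝ} {N : ℕ} (f : ConfigSpace L N) : signOp L N (signOp L N f) = f := by
  refine Lp.ext ?_
  filter_upwards [coeFn_signOp (signOp L N f), coeFn_signOp f, ae_injective L N] with x h1 h2 hx
  rw [h1, h2, ← mul_assoc, ← Complex.ofReal_mul, signProd_mul_self hx, Complex.ofReal_one, one_mul]

theorem inner_signOp_left {L : ℝ} {N : ℕ} (f g : ConfigSpace L N) :
    inner ℂ (signOp L N f) g = inner ℂ f (signOp L N g) := by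
  rw [inner_eq_integral, inner_eq_integral]
  refine integral_congr_ae ?_
  filter_upwards [coeFn_signOp f, coeFn_signOp g] with x h1 h2
  rw [h1, h2, map_mul, Complex.conj_ofReal]
  ring

theorem permOp_signOp {L : ℝ} {N : ℕ} (σ : Equiv.Perm (Fin N)) (f : ConfigSpace L N) :
    permOp L σ (signOp L N f) =
      ((Equiv.Perm.sign σ : ℤ) : ℂ) • signOp L N (permOp L σ f) := by
  refine Lp.ext ?_
  filter_upwards [coeFn_permOp σ (signOp L N f),
    (measurePreserving_perm L σ).quasiMeasurePreserving.ae (coeFn_signOp f),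
    Lp.coeFn_smul ((Equiv.Perm.sign σ : ℤ) : ℂ) (signOp L N (permOp L σ f)),
    coeFn_signOp (permOp L σ f), coeFn_permOp σ f] with x h1 h2 h3 h4 h5
  rw [h1, h2, h3, Pi.smul_apply, h4, h5, signProd_perm, smul_eq_mul]
  push_cast
  ring

theorem sign_mul_sign {N : ℕ} (σ : Equiv.Perm (Fin N)) :
    ((Equiv.Perm.sign σ : ℤ) : ℂ) * ((Equiv.Perm.sign σ : ℤ) : ℂ) = 1 := by
  rcases Int.units_eq_one_or (Equiv.Perm.sign σ) with h | h <;> simp [h]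

theorem mem_bosonSpace_iff {L : ℝ} {N : ℕ} {f : ConfigSpace L N} :
    f ∈ BosonSpace L N ↔ ∀ σ : Equiv.Perm (Fin N), permOp L σ f = f := by
  refine forall_congr' fun σ => ⟨fun h => Lp.ext ((coeFn_permOp σ f).trans h), fun h => ?_⟩
  have := coeFn_permOp σ f
  rw [h] at this
  exact this.symm

theorem permOp_signOp_boson {L : ℝ} {N : ℕ} (σ : Equiv.Perm (Fin N)) (Ψ : BosonSpace L N) :
    permOp L σ (signOp L N (Ψ : ConfigSpace L N)) =
      ((Equiv.Perm.sign σ : ℤ) : ℂ) • signOp L N (Ψ : ConfigSpace L N) := by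
  rw [permOp_signOp, mem_bosonSpace_iff.mp Ψ.2]

theorem signOp_mem_bosonSpace {L : ℝ} {N : ℕ} {f : ConfigSpace L N}
    (hf : ∀ σ : Equiv.Perm (Fin N), permOp L σ f = ((Equiv.Perm.sign σ : ℤ) : ℂ) • f) :
    signOp L N f ∈ BosonSpace L N := by
  refine mem_bosonSpace_iff.mpr fun σ => ?_
  rw [permOp_signOp, hf, map_smul, smul_smul, sign_mul_sign, one_smul]

section

variable {L : ℝ} (hL : 0 < L) {n : ℕ} {v : Fin n → ℝ → ℝ} (hv : ∀ b, Continuous (v b))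

/-- The evolution operator of `N` hardcore bosons. -/
def bosonEvolution (N : ℕ) (t : ℝ) : BosonSpace L N →L[ℂ] BosonSpace L N :=
  ((signOp L N).comp ((configEvolution hL hv N t).comp
    ((signOp L N).comp (BosonSpace L N).subtypeL))).codRestrict (BosonSpace L N) fun Ψ => by
      refine signOp_mem_bosonSpace fun σ => ?_
      change permOp L σ (configEvolution hL hv N t (signOp L N (Ψ : ConfigSpace L N))) =
        ((Equiv.Perm.sign σ : ℤ) : ℂ) •
          configEvolution hL hv N t (signOp L N (Ψ : ConfigSpace L N))
      rw [permOp_configEvolution, permOp_signOp_boson, map_smul]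

theorem coe_bosonEvolution {N : ℕ} (t : ℝ) (Ψ : BosonSpace L N) :
    (bosonEvolution hL hv N t Ψ : ConfigSpace L N) =
      signOp L N (configEvolution hL hv N t (signOp L N (Ψ : ConfigSpace L N))) := rfl

theorem signOp_bosonEvolution {N : ℕ} (t : ℝ) (Ψ : BosonSpace L N) :
    signOp L N (bosonEvolution hL hv N t Ψ : ConfigSpace L N) =
      configEvolution hL hv N t (signOp L N (Ψ : ConfigSpace L N)) := by
  rw [coe_bosonEvolution, signOp_signOp]

end

/-! ## The kinetic energy on the core -/

/-- Partial derivative in the `j`-th coordinate. -/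
def partialDeriv {N : ℕ} (j : Fin N) (g : (Fin N → ℝ) → ℂ) (x : Fin N → ℝ) : ℂ :=
  fderiv ℝ g x (Pi.single j 1)

theorem hasDerivAt_update_comp {N : ℕ} {g : (Fin N → ℝ) → ℂ} (hg : Differentiable ℝ g)
    (j : Fin N) (x : Fin N → ℝ) (s : ℝ) :
    HasDerivAt (fun s => g (Function.update x j s)) (partialDeriv j g (Function.update x j s)) s :=
  (hg (Function.update x j s)).hasFDerivAt.comp_hasDerivAt s (hasDerivAt_update x j s)

theorem contDiff_partialDeriv {N : ℕ} {g : (Fin N → ℝ) → ℂ} (hg : ContDiff ℝ 2 g) (j : Fin N) :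
    ContDiff ℝ 1 (partialDeriv j g) :=
  (hg.fderiv_right (m := 1) (by norm_num)).clm_apply contDiff_const

theorem continuous_partialDeriv_partialDeriv {N : ℕ} {g : (Fin N → ℝ) → ℂ} (hg : ContDiff ℝ 2 g)
    (j : Fin N) : Continuous (partialDeriv j (partialDeriv j g)) :=
  ((contDiff_partialDeriv hg j).continuous_fderiv (by norm_num)).clm_apply continuous_const

theorem iteratedDeriv_two_update {N : ℕ} {g : (Fin N → ℝ) → ℂ} (hg : ContDiff ℝ 2 g) (j : Fin N)
    (x : Fin N → ℝ) :
    iteratedDeriv 2 (fun s => g (Function.update x j s)) (x j) =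
      partialDeriv j (partialDeriv j g) x := by
  rw [iteratedDeriv_succ, iteratedDeriv_one]
  have h1 : deriv (fun s => g (Function.update x j s)) =
      fun s => partialDeriv j g (Function.update x j s) := by
    funext s
    exact (hasDerivAt_update_comp (hg.differentiable (by norm_num)) j x s).deriv
  rw [h1, (hasDerivAt_update_comp ((contDiff_partialDeriv hg j).differentiable (by norm_num))
    j x (x j)).deriv, Function.update_eq_self]

/-- `-∑_j ∂_j² g`. -/
def kinetic {N : ℕ} (g : (Fin N → ℝ) → ℂ) (x : Fin N → ℝ) : ℂ :=
  -∑ j, partialDeriv j (partialDeriv j g) x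

theorem continuous_kinetic {N : ℕ} {g : (Fin N → ℝ) → ℂ} (hg : ContDiff ℝ 2 g) :
    Continuous (kinetic g) :=
  (continuous_finsetSum _ fun j _ => continuous_partialDeriv_partialDeriv hg j).neg

theorem ae_mem_ring (L : ℝ) (N : ℕ) : ∀ᵐ x ∂(ringMeasure L N), ∀ i, x i ∈ Set.Ioc 0 L :=
  ae_forall_eval fun _ => ae_restrict_mem measurableSet_Ioc

theorem memLp_of_continuous {L : ℝ} {N : ℕ} {g : (Fin N → ℝ) → ℂ} (hg : Continuous g)
    (p : ENNReal) : MemLp g p (ringMeasure L N) := by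
  have hK : IsCompact (Set.univ.pi fun _ : Fin N => Set.Icc 0 L) :=
    isCompact_univ_pi fun _ => isCompact_Icc
  obtain ⟨C, hC⟩ := hK.exists_bound_of_continuousOn hg.continuousOn
  refine MemLp.of_bound hg.aestronglyMeasurable C ?_
  filter_upwards [ae_mem_ring L N] with x hx
  exact hC x fun i _ => Set.Ioc_subset_Icc_self (hx i)

/-- Near a point without coincidences the sign is constant and can be pulled out of the derivatives,
so the Hamiltonian acts on `g` as on a free wave function. -/
theorem hamiltonian_ae {L : ℝ} {n N : ℕ} (w : Fin n → ℝ) {f g : (Fin N → ℝ) → ℂ}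
    (hg : ContDiff ℝ 2 g) (hf : ∀ x, f x = (signProd x : ℂ) * g x) :
    hamiltonian L w f =ᵐ[ringMeasure L N]
      fun x => (signProd x : ℂ) * (kinetic g x + (potential L w x : ℂ) * g x) := by
  filter_upwards [ae_injective L N] with x hx
  have h : ∀ j, iteratedDeriv 2 (fun s : ℝ => f (Function.update x j s)) (x j) =
      (signProd x : ℂ) * partialDeriv j (partialDeriv j g) x := by
    intro j
    have hc : ContinuousAt (fun s : ℝ => Function.update x j s) (x j) :=
      (continuous_const.update j continuous_id).continuousAt
    have he : (fun s : ℝ => f (Function.update x j s)) =ᶠ[nhds (x j)]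
        fun s => (signProd x : ℂ) * g (Function.update x j s) := by
      have h1 : ∀ᶠ y in nhds (Function.update x j (x j)), signProd y = signProd x := by
        rw [Function.update_eq_self]
        exact eventually_signProd_eq hx
      filter_upwards [hc.eventually h1] with s hs
      rw [hf, hs]
    rw [he.iteratedDeriv_eq, iteratedDeriv_const_mul_field, iteratedDeriv_two_update hg]
  rw [hamiltonian, hf, kinetic, Finset.sum_congr rfl fun j _ => h j, ← Finset.mul_sum]
  ring

theorem ringWave_add_period {L : ℝ} (hL : 0 < L) (m : ℤ) (s : ℝ) :
    ringWave L m (s + L) = -ringWave L m s := by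
  have hL' : (L : ℂ) ≠ 0 := by exact_mod_cast hL.ne'
  have e : I * ((ringMomentum L m : ℂ) * ((s + L : ℝ) : ℂ)) =
      I * ((ringMomentum L m : ℂ) * (s : ℂ)) + (Real.pi * I + m * (2 * Real.pi * I)) := by
    rw [ringMomentum]
    push_cast
    field_simp
    ring
  rw [ringWave, ringWave, e, Complex.exp_add, Complex.exp_add, Complex.exp_int_mul_two_pi_mul_I,
    Complex.exp_pi_mul_I]
  ring

/-- Antiperiodic functions have no boundary terms in the partial integration against an
antiperiodic plane wave. -/
theorem integral_ringWave_mul {L : ℝ} (hL : 0 < L) (m : ℤ) {G G' G'' : ℝ → ℂ}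
    (h1 : ∀ s, HasDerivAt G (G' s) s) (h2 : ∀ s, HasDerivAt G' (G'' s) s) (hc : Continuous G'')
    (hp : ∀ s, G (s + L) = -G s) :
    ∫ s in Set.Ioc 0 L, conj (ringWave L m s) * (G'' s + (ringEnergy L m : ℂ) * G s) = 0 := by
  -- Differentiating the antiperiodicity of `G` gives that of `G'`.
  have hp' : G' L = -G' 0 := by
    have h3 : HasDerivAt (fun s => G (s + L)) (G' (0 + L)) 0 := (h1 (0 + L)).comp_add_const 0 L
    have h4 : (fun s => G (s + L)) = fun s => -G s := funext hp
    rw [h4] at h3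
    have := h3.unique (h1 0).fun_neg
    rwa [zero_add] at this
  have hw : ∀ s, HasDerivAt (fun s => conj (ringWave L m s))
      (-(I * ringMomentum L m) * conj (ringWave L m s)) s := by
    intro s
    have e : ∀ s : ℝ, conj (ringWave L m s) =
        (((Real.sqrt L)⁻¹ : ℝ) : ℂ) * Complex.exp (-(I * (ringMomentum L m * s))) := by
      intro s
      rw [ringWave, map_mul, Complex.conj_ofReal, conj_exp_I_mul]
    simp only [e]
    have h3 : HasDerivAt (fun s : ℝ => -(I * ((ringMomentum L m : ℂ) * (s : ℂ))))
        (-(I * ((ringMomentum L m : ℂ) * 1))) s :=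
      (((hasDerivAt_id s).ofReal_comp.const_mul _).const_mul I).fun_neg
    refine (h3.cexp.const_mul _).congr_deriv ?_
    ring
  -- The integrand has an explicit antiderivative. It is a product of two antiperiodic functions,
  -- hence takes equal values at both ends of the ring.
  have hF : ∀ s, HasDerivAt
      (fun s => conj (ringWave L m s) * (G' s + I * ringMomentum L m * G s))
      (conj (ringWave L m s) * (G'' s + (ringEnergy L m : ℂ) * G s)) s := by
    intro s
    refine ((hw s).fun_mul ((h2 s).fun_add ((h1 s).const_mul _))).congr_deriv ?_
    rw [ringEnergy]
    push_cast
    linear_combination (-conj (ringWave L m s) * (ringMomentum L m : ℂ) ^ 2 * G s) * I_mul_I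
  have hGc : Continuous G := continuous_iff_continuousAt.mpr fun s => (h1 s).continuousAt
  have hwc : Continuous fun s => conj (ringWave L m s) :=
    Complex.continuous_conj.comp (continuous_ringWave L m)
  rw [← intervalIntegral.integral_of_le hL.le,
    intervalIntegral.integral_eq_sub_of_hasDerivAt (fun s _ => hF s)
      (Continuous.intervalIntegrable (by fun_prop) _ _)]
  have hG : G L = -G 0 := by simpa using hp 0
  have hwL : ringWave L m L = -ringWave L m 0 := by simpa using ringWave_add_period hL m 0
  rw [hG, hp', hwL, map_neg]
  ring

/-- Integration in one coordinate first. -/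
theorem integral_eq_zero_of_forall_update {L : ℝ} {N : ℕ} (j : Fin N) {F : (Fin N → ℝ) → ℂ}
    (hF : Integrable F (ringMeasure L N))
    (h : ∀ x, ∫ s in Set.Ioc 0 L, F (Function.update x j s) = 0) :
    ∫ x, F x ∂(ringMeasure L N) = 0 := by
  cases N with
  | zero => exact j.elim0
  | succ M =>
    have hmp := (measurePreserving_piFinSuccAbove
      (fun _ : Fin (M + 1) => (volume : Measure ℝ).restrict (Set.Ioc 0 L)) j).symm
    rw [ringMeasure, ← hmp.integral_comp']
    rw [integral_prod_symm]
    · refine integral_eq_zero_of_ae (Filter.Eventually.of_forall fun z => ?_)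
      have := h (Fin.insertNth j 0 z)
      simp only [Fin.update_insertNth] at this
      exact this
    · exact (hmp.integrable_comp_emb (MeasurableEquiv.measurableEmbedding _)).mpr hF

theorem configBasis_eq_toLp {L : ℝ} (hL : 0 < L) {N : ℕ} (Λ : Fin N → ℤ) :
    configBasis hL N Λ = (memLp_prod L fun i => memLp_ringWave L (Λ i)).toLp _ := by
  rw [configBasis_apply, tensor_apply, ← tensorFun_toLp]
  congr 1
  funext i
  exact ringBasis_apply hL (Λ i)

theorem prod_update_eq {N : ℕ} (f : Fin N → ℝ → ℂ) (x : Fin N → ℝ) (j : Fin N) (s : ℝ) :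
    ∏ i, f i (Function.update x j s i) = f j s * ∏ i ∈ Finset.univ.erase j, f i (x i) := by
  rw [← Finset.mul_prod_erase _ _ (Finset.mem_univ j), Function.update_self]
  congr 1
  refine Finset.prod_congr rfl fun i hi => ?_
  rw [Function.update_of_ne (Finset.ne_of_mem_erase hi)]

/-- The plane waves diagonalise the kinetic energy. -/
theorem inner_configBasis_kinetic {L : ℝ} (hL : 0 < L) {N : ℕ} {g : (Fin N → ℝ) → ℂ}
    (hg : ContDiff ℝ 2 g)
    (hp : ∀ (j : Fin N) (x : Fin N → ℝ), g (Function.update x j (x j + L)) = -g x)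
    (Λ : Fin N → ℤ) :
    inner ℂ (configBasis hL N Λ)
        ((memLp_of_continuous (continuous_kinetic hg) 2).toLp _ : ConfigSpace L N) =
      (configEnergy L Λ : ℂ) * inner ℂ (configBasis hL N Λ)
        ((memLp_of_continuous hg.continuous 2).toLp _ : ConfigSpace L N) := by
  rw [configBasis_eq_toLp, inner_toLp_toLp, inner_toLp_toLp]
  let e : (Fin N → ℝ) → ℂ := fun x => ∏ i, ringWave L (Λ i) (x i)
  have he : Continuous e := continuous_finsetProd _ fun i _ =>
    (continuous_ringWave L (Λ i)).comp (continuous_apply i)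
  have hec : Continuous fun x => conj (e x) := Complex.continuous_conj.comp he
  have hint : ∀ f : (Fin N → ℝ) → ℂ, Continuous f → Integrable f (ringMeasure L N) := fun f hf =>
    memLp_one_iff_integrable.mp (memLp_of_continuous hf 1)
  -- For each coordinate, integrating that variable first leaves a one-dimensional integral that
  -- vanishes; the remaining plane waves are a constant factor.
  have hj : ∀ j, ∫ x, conj (e x) * (partialDeriv j (partialDeriv j g) x +
      (ringEnergy L (Λ j) : ℂ) * g x) ∂(ringMeasure L N) = 0 := by
    intro j
    have hdd := continuous_partialDeriv_partialDeriv hg j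
    refine integral_eq_zero_of_forall_update j
      (hint _ (hec.mul (hdd.add (continuous_const.mul hg.continuous)))) fun x => ?_
    have h0 := integral_ringWave_mul hL (Λ j) (G := fun s => g (Function.update x j s))
      (G' := fun s => partialDeriv j g (Function.update x j s))
      (G'' := fun s => partialDeriv j (partialDeriv j g) (Function.update x j s))
      (hasDerivAt_update_comp (hg.differentiable (by norm_num)) j x)
      (hasDerivAt_update_comp ((contDiff_partialDeriv hg j).differentiable (by norm_num)) j x)
      (hdd.comp (continuous_const.update j continuous_id)) fun s => by
        have := hp j (Function.update x j s)
        simpa using this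
    have h1 : ∀ s, conj (e (Function.update x j s)) *
        (partialDeriv j (partialDeriv j g) (Function.update x j s) +
          (ringEnergy L (Λ j) : ℂ) * g (Function.update x j s)) =
        conj (∏ i ∈ Finset.univ.erase j, ringWave L (Λ i) (x i)) *
          (conj (ringWave L (Λ j) s) *
            (partialDeriv j (partialDeriv j g) (Function.update x j s) +
              (ringEnergy L (Λ j) : ℂ) * g (Function.update x j s))) := by
      intro s
      simp only [e]
      rw [prod_update_eq (fun i => ringWave L (Λ i)), map_mul]
      ring
    simp only [h1]
    rw [integral_const_mul, h0, mul_zero]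
  have hsum : ∀ x, conj (e x) * kinetic g x - (configEnergy L Λ : ℂ) * (conj (e x) * g x) =
      -∑ j, conj (e x) * (partialDeriv j (partialDeriv j g) x +
        (ringEnergy L (Λ j) : ℂ) * g x) := by
    intro x
    rw [← Finset.mul_sum, Finset.sum_add_distrib, kinetic, configEnergy, ← Finset.sum_mul]
    push_cast
    ring
  rw [← sub_eq_zero, ← integral_const_mul, ← integral_sub]
  · change ∫ x, (conj (e x) * kinetic g x - (configEnergy L Λ : ℂ) * (conj (e x) * g x))
      ∂(ringMeasure L N) = 0
    simp only [hsum]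
    rw [integral_neg, integral_finsetSum]
    · simp [hj]
    · intro j _
      exact hint _ (hec.mul ((continuous_partialDeriv_partialDeriv hg j).add
        (continuous_const.mul hg.continuous)))
  · exact hint _ (hec.mul (continuous_kinetic hg))
  · exact hint _ (continuous_const.mul (hec.mul hg.continuous))

/-! ## The evolution operator of hardcore bosons -/

/-- The real sign factor is moved from the test function to the state, so that testing against the
core becomes pairing with the smooth `g`. -/
theorem integral_test_mul {L : ℝ} {N : ℕ} {f g : (Fin N → ℝ) → ℂ} (hg : Continuous g)
    (hf : ∀ x, f x = (signProd x : ℂ) * g x) (Φ : ConfigSpace L N) :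
    ∫ x, conj (f x) * Φ x ∂(ringMeasure L N) =
      inner ℂ ((memLp_of_continuous hg 2).toLp _ : ConfigSpace L N) (signOp L N Φ) := by
  rw [inner_toLp_left]
  refine integral_congr_ae ?_
  filter_upwards [coeFn_signOp Φ] with x hx
  rw [hx, hf, map_mul, Complex.conj_ofReal]
  ring

theorem integral_hamiltonian_mul {L : ℝ} {n N : ℕ} (v : Fin n → ℝ → ℝ) (t : ℝ)
    {f g : (Fin N → ℝ) → ℂ} (hg : ContDiff ℝ 2 g) (hf : ∀ x, f x = (signProd x : ℂ) * g x)
    (Φ : ConfigSpace L N) :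
    ∫ x, conj (hamiltonian L (fun b => v b t) f x) * Φ x ∂(ringMeasure L N) =
      inner ℂ ((memLp_of_continuous (continuous_kinetic hg) 2).toLp _ : ConfigSpace L N)
          (signOp L N Φ) +
        inner ℂ ((memLp_of_continuous hg.continuous 2).toLp _ : ConfigSpace L N)
          (configPotential L N v t (signOp L N Φ)) := by
  rw [inner_eq_integral, inner_eq_integral, ← integral_add]
  · refine integral_congr_ae ?_
    filter_upwards [hamiltonian_ae (L := L) (fun b => v b t) hg hf, coeFn_signOp Φ,
      coeFn_configPotential L v t (signOp L N Φ),
      (memLp_of_continuous (L := L) hg.continuous 2).coeFn_toLp,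
      (memLp_of_continuous (L := L) (continuous_kinetic hg) 2).coeFn_toLp] with x h1 h2 h3 h4 h5
    rw [h1, h3, h2, h4, h5]
    simp only [map_mul, map_add, Complex.conj_ofReal]
    ring
  · simpa only [RCLike.inner_apply, mul_comm] using L2.integrable_inner (𝕜 := ℂ)
      ((memLp_of_continuous (continuous_kinetic hg) 2).toLp _ : ConfigSpace L N) (signOp L N Φ)
  · simpa only [RCLike.inner_apply, mul_comm] using L2.integrable_inner (𝕜 := ℂ)
      ((memLp_of_continuous hg.continuous 2).toLp _ : ConfigSpace L N)
      (configPotential L N v t (signOp L N Φ))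

theorem isEvolutionOperator_bosonEvolution {L : ℝ} (hL : 0 < L) {n : ℕ} {v : Fin n → ℝ → ℝ}
    (hv : ∀ b, Continuous (v b)) {N : ℕ} (hN : Even N) :
    IsEvolutionOperator L v N (bosonEvolution hL hv N) where
  initial := by
    ext1 Ψ
    refine Subtype.ext ?_
    rw [coe_bosonEvolution, evolution_zero, signOp_signOp]
    rfl
  continuous Ψ := by
    refine Continuous.subtype_mk (f := fun t => signOp L N
      (configEvolution hL hv N t (signOp L N (Ψ : ConfigSpace L N)))) ?_ _
    exact (signOp L N).continuous.comp (continuous_evolution _ _ _ _)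
  schrodinger Ψ f hf t := by
    obtain ⟨g, hg, -, hp, hfg⟩ := hf
    simp only [integral_test_mul hg.continuous hfg, integral_hamiltonian_mul v t hg hfg,
      signOp_bosonEvolution]
    refine hasDerivAt_inner_evolution _ _ _ (inner_configBasis_kinetic hL hg ?_) _ t
    intro j x
    -- Here the parity matters: for even `N` the twist `(-1)^(N+1)` is `-1`, matching the
    -- antiperiodic plane waves.
    rw [hp, hN.add_one.neg_one_pow, neg_one_mul]

/-! ### Uniqueness, tested on antisymmetrised plane waves. -/

/-- The antisymmetrised plane waves. -/
def slaterWave (L : ℝ) {N : ℕ} (Λ : Fin N → ℤ) (x : Fin N → ℝ) : ℂ :=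
  (N.factorial : ℂ)⁻¹ * ∑ σ : Equiv.Perm (Fin N), ((Equiv.Perm.sign σ : ℤ) : ℂ) *
    ∏ i, ringWave L (Λ (σ i)) (x i)

theorem contDiff_slaterWave (L : ℝ) {N : ℕ} (Λ : Fin N → ℤ) : ContDiff ℝ 2 (slaterWave L Λ) := by
  have h : ∀ m, ContDiff ℝ 2 (ringWave L m) := by
    intro m
    have h1 : ContDiff ℝ 2 fun x : ℝ => (x : ℂ) := Complex.ofRealCLM.contDiff
    exact contDiff_const.mul (contDiff_const.mul (contDiff_const.mul h1)).cexp
  refine contDiff_const.mul (ContDiff.sum fun σ _ => contDiff_const.mul (contDiff_prod fun i _ => ?_))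
  exact (h _).comp (contDiff_apply ℝ ℝ i)

theorem slaterWave_perm (L : ℝ) {N : ℕ} (Λ : Fin N → ℤ) (σ : Equiv.Perm (Fin N))
    (x : Fin N → ℝ) : slaterWave L Λ (x ∘ σ) = ((Equiv.Perm.sign σ : ℤ) : ℂ) * slaterWave L Λ x := by
  rw [slaterWave, slaterWave, mul_left_comm]
  congr 1
  rw [Finset.mul_sum, ← Equiv.sum_comp (Equiv.mulRight σ)]
  refine Finset.sum_congr rfl fun τ _ => ?_
  rw [Equiv.coe_mulRight, Equiv.Perm.sign_mul]
  push_cast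
  rw [← Equiv.prod_comp σ fun i => ringWave L (Λ (τ i)) (x i)]
  simp only [Function.comp_apply]
  ring

theorem slaterWave_update {L : ℝ} (hL : 0 < L) {N : ℕ} (Λ : Fin N → ℤ) (j : Fin N)
    (x : Fin N → ℝ) :
    slaterWave L Λ (Function.update x j (x j + L)) = -slaterWave L Λ x := by
  rw [slaterWave, slaterWave, ← mul_neg, ← Finset.sum_neg_distrib]
  congr 1
  refine Finset.sum_congr rfl fun σ _ => ?_
  rw [prod_update_eq (fun i => ringWave L (Λ (σ i))), ringWave_add_period hL,
    ← Finset.mul_prod_erase Finset.univ (fun i => ringWave L (Λ (σ i)) (x i)) (Finset.mem_univ j)]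
  ring

theorem isHardcoreTest_slaterWave {L : ℝ} (hL : 0 < L) {N : ℕ} (hN : Even N) (Λ : Fin N → ℤ) :
    IsHardcoreTest L fun x => (signProd x : ℂ) * slaterWave L Λ x :=
  ⟨slaterWave L Λ, contDiff_slaterWave L Λ, slaterWave_perm L Λ, fun j x => by
    rw [slaterWave_update hL, hN.add_one.neg_one_pow, neg_one_mul], fun _ => rfl⟩

theorem toLp_slaterWave {L : ℝ} (hL : 0 < L) {N : ℕ} (Λ : Fin N → ℤ) :
    ((memLp_of_continuous (contDiff_slaterWave L Λ).continuous 2).toLp _ : ConfigSpace L N) =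
      (N.factorial : ℂ)⁻¹ • ∑ σ : Equiv.Perm (Fin N),
        ((Equiv.Perm.sign σ : ℤ) : ℂ) • configBasis hL N (Λ ∘ σ) := by
  refine Lp.ext ?_
  have h1 : ∀ᵐ x ∂(ringMeasure L N), ∀ σ : Equiv.Perm (Fin N),
      (((Equiv.Perm.sign σ : ℤ) : ℂ) • configBasis hL N (Λ ∘ σ) : ConfigSpace L N) x =
        ((Equiv.Perm.sign σ : ℤ) : ℂ) * ∏ i, ringWave L (Λ (σ i)) (x i) := by
    refine ae_all_iff.mpr fun σ => ?_
    rw [configBasis_eq_toLp]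
    filter_upwards [Lp.coeFn_smul ((Equiv.Perm.sign σ : ℤ) : ℂ)
      ((memLp_prod L fun i => memLp_ringWave L ((Λ ∘ σ) i)).toLp _ : ConfigSpace L N),
      (memLp_prod L fun i => memLp_ringWave L ((Λ ∘ σ) i)).coeFn_toLp] with x h1 h2
    rw [h1, Pi.smul_apply, h2]
    rfl
  filter_upwards [h1, (memLp_of_continuous (L := L) (contDiff_slaterWave L Λ).continuous 2).coeFn_toLp,
    Lp.coeFn_smul (N.factorial : ℂ)⁻¹ (∑ σ : Equiv.Perm (Fin N),
        ((Equiv.Perm.sign σ : ℤ) : ℂ) • configBasis hL N (Λ ∘ σ)),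
    Lp.coeFn_finsetSum Finset.univ fun σ : Equiv.Perm (Fin N) =>
        ((Equiv.Perm.sign σ : ℤ) : ℂ) • configBasis hL N (Λ ∘ σ)] with x h1 h2 h3 h4
  rw [h2, h3, Pi.smul_apply, h4, Finset.sum_apply, Finset.sum_congr rfl fun σ _ => h1 σ]
  rfl

/-- For antisymmetric `y` all `N!` terms contribute equally, and the factor `1 / N!` in `slaterWave`
averages them. Core functions therefore detect the full coordinates of `y`. -/
theorem inner_slaterWave {L : ℝ} (hL : 0 < L) {N : ℕ} (Λ : Fin N → ℤ) {y : ConfigSpace L N}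
    (hy : ∀ σ : Equiv.Perm (Fin N), permOp L σ y = ((Equiv.Perm.sign σ : ℤ) : ℂ) • y) :
    inner ℂ ((memLp_of_continuous (contDiff_slaterWave L Λ).continuous 2).toLp _ :
      ConfigSpace L N) y = inner ℂ (configBasis hL N Λ) y := by
  rw [toLp_slaterWave hL, inner_smul_left, sum_inner]
  have h : ∀ σ : Equiv.Perm (Fin N),
      inner ℂ (((Equiv.Perm.sign σ : ℤ) : ℂ) • configBasis hL N (Λ ∘ σ)) y =
        inner ℂ (configBasis hL N Λ) y := by
    intro σ
    rw [inner_smul_left, ← inner_configBasis_permOp, hy, inner_smul_right, ← mul_assoc]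
    rcases Int.units_eq_one_or (Equiv.Perm.sign σ) with h | h <;> simp [h]
  rw [Finset.sum_congr rfl fun σ _ => h σ, Finset.sum_const, Finset.card_univ, Fintype.card_perm,
    Fintype.card_fin, nsmul_eq_mul, ← mul_assoc]
  have : (N.factorial : ℂ) ≠ 0 := by exact_mod_cast N.factorial_ne_zero
  simp [this]

/-- All terms of the antisymmetrisation carry the same total energy, so their combination is again
an eigenvector. -/
theorem toLp_kinetic_slaterWave {L : ℝ} (hL : 0 < L) {N : ℕ} (Λ : Fin N → ℤ) :
    ((memLp_of_continuous (continuous_kinetic (contDiff_slaterWave L Λ)) 2).toLp _ :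
        ConfigSpace L N) = (configEnergy L Λ : ℂ) •
      ((memLp_of_continuous (contDiff_slaterWave L Λ).continuous 2).toLp _ : ConfigSpace L N) := by
  refine hilbertBasis_ext (configBasis hL N) fun M => ?_
  rw [inner_configBasis_kinetic hL (contDiff_slaterWave L Λ) (slaterWave_update hL Λ),
    inner_smul_right, toLp_slaterWave hL, inner_smul_right, inner_sum, Finset.mul_sum,
    Finset.mul_sum, Finset.mul_sum]
  refine Finset.sum_congr rfl fun σ _ => ?_
  rw [inner_smul_right]
  by_cases h : M = Λ ∘ σ
  · rw [h, configEnergy_perm]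
  · rw [(configBasis hL N).orthonormal.2 h]
    ring

/-- Multiplied by the sign, any evolution operator yields antisymmetric solutions. Testing them on
Slater waves gives the weak equation in every coordinate of `configBasis`, where uniqueness is
known. -/
theorem eq_bosonEvolution {L : ℝ} (hL : 0 < L) {n : ℕ} {v : Fin n → ℝ → ℝ}
    (hv : ∀ b, Continuous (v b)) {N : ℕ} (hN : Even N)
    {U : ℝ → BosonSpace L N →L[ℂ] BosonSpace L N} (hU : IsEvolutionOperator L v N U) :
    U = bosonEvolution hL hv N := by
  funext t
  ext1 Ψ
  have hperm : ∀ (s : ℝ) (σ : Equiv.Perm (Fin N)),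
      permOp L σ (signOp L N (U s Ψ : ConfigSpace L N)) =
        ((Equiv.Perm.sign σ : ℤ) : ℂ) • signOp L N (U s Ψ : ConfigSpace L N) := fun s σ =>
    permOp_signOp_boson σ _
  have key := eq_evolution_of_weak_solution (configBasis hL N) (configEnergy L)
    (continuous_configPotential L N hv) (y := fun s => signOp L N (U s Ψ : ConfigSpace L N))
    (exists_bound_of_continuous
      ((signOp L N).continuous.comp (continuous_subtype_val.comp (hU.continuous Ψ)))) ?_ t
  · simp only [hU.initial] at key
    refine Subtype.ext ?_
    rw [coe_bosonEvolution, ← signOp_signOp (U t Ψ : ConfigSpace L N), key]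
    rfl
  · intro Λ s
    have h := hU.schrodinger Ψ _ (isHardcoreTest_slaterWave hL hN Λ) s
    simp only [integral_test_mul (contDiff_slaterWave L Λ).continuous (fun _ => rfl),
      integral_hamiltonian_mul v s (contDiff_slaterWave L Λ) (fun _ => rfl),
      toLp_kinetic_slaterWave hL, inner_smul_left, Complex.conj_ofReal] at h
    simp only [inner_slaterWave hL Λ (hperm _)] at h
    -- The symmetric potential preserves antisymmetry, so the averaging argument also applies to
    -- this term.
    rw [inner_slaterWave hL Λ (y := configPotential L N v s (signOp L N (U s Ψ : ConfigSpace L N)))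
      (fun σ => by rw [permOp_configPotential, hperm, map_smul])] at h
    exact h

/-! ## Wavelet states as Slater determinants -/

section Fibers

variable {ι κ : Type*} (c : ι → κ)

theorem prod_prod_fiber [Fintype ι] [Fintype κ] [DecidableEq κ] {M : Type*} [CommMonoid M] (F : ∀ b, {j // c j = b} → M) :
    ∏ b, ∏ j, F b j = ∏ i, F (c i) ⟨i, rfl⟩ := by
  have h := Fintype.prod_sigma fun p : (Σ b, {j // c j = b}) => F p.1 p.2
  rw [← h, ← Equiv.prod_comp (Equiv.sigmaFiberEquiv c).symm]
  rfl

/-- The permutation that acts on each fiber of `c` by a given permutation. -/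
def fiberPerm : (∀ b, Equiv.Perm {j // c j = b}) →* Equiv.Perm ι :=
  (Equiv.sigmaFiberEquiv c).permCongrHom.toMonoidHom.comp
    (Equiv.Perm.sigmaCongrRightHom fun b => {j // c j = b})

theorem fiberPerm_apply (σ : ∀ b, Equiv.Perm {j // c j = b}) (i : ι) :
    fiberPerm c σ i = σ (c i) ⟨i, rfl⟩ := rfl

/-- Both sides are homomorphisms on a finite product of groups, so it is enough to compare them on
permutations that move a single fiber. -/
theorem sign_fiberPerm [Fintype ι] [DecidableEq ι] [Fintype κ] [DecidableEq κ]
    (σ : ∀ b, Equiv.Perm {j // c j = b}) :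
    Equiv.Perm.sign (fiberPerm c σ) = ∏ b, Equiv.Perm.sign (σ b) := by
  let f : (∀ b, Equiv.Perm {j // c j = b}) →* ℤˣ := Equiv.Perm.sign.comp (fiberPerm c)
  let g : (∀ b, Equiv.Perm {j // c j = b}) →* ℤˣ :=
    { toFun := fun σ => ∏ b, Equiv.Perm.sign (σ b)
      map_one' := by simp
      map_mul' := fun σ τ => by simp [Finset.prod_mul_distrib] }
  have h : f = g := by
    refine MonoidHom.pi_ext fun b τ => ?_
    have h1 : fiberPerm c (Pi.mulSingle b τ) = Equiv.Perm.ofSubtype τ := by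
      ext i
      rw [fiberPerm_apply]
      by_cases hi : c i = b
      · subst hi
        rw [Pi.mulSingle_eq_same, Equiv.Perm.ofSubtype_apply_of_mem τ rfl]
      · rw [Pi.mulSingle_eq_of_ne hi, Equiv.Perm.ofSubtype_apply_of_not_mem τ hi]
        rfl
    have h2 : f (Pi.mulSingle b τ) = Equiv.Perm.sign τ := by
      change Equiv.Perm.sign (fiberPerm c (Pi.mulSingle b τ)) = _
      rw [h1, Equiv.Perm.sign_ofSubtype]
    have h3 : g (Pi.mulSingle b τ) = Equiv.Perm.sign τ := by
      change ∏ b', Equiv.Perm.sign ((Pi.mulSingle b τ : ∀ b, Equiv.Perm {j // c j = b}) b') = _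
      rw [Finset.prod_eq_single b]
      · rw [Pi.mulSingle_eq_same]
      · intro b' _ hb'
        rw [Pi.mulSingle_eq_of_ne hb', map_one]
      · simp
    rw [h2, h3]
  exact DFunLike.congr_fun h σ

end Fibers

theorem signProd_eq_prod_prod {ι : Type*} [Fintype ι] [LinearOrder ι] (x : ι → ℝ) :
    signProd x = ∏ i, ∏ j, if i < j then Real.sign (x i - x j) else 1 := by
  rw [signProd, Finset.prod_filter, Fintype.prod_prod_type]

/-- If particles in different fibers of `c` are ordered, the sign factor is the product of the sign
factors of the fibers. -/
theorem signProd_eq_prod_fiber {N : ℕ} {κ : Type*} [Fintype κ] [DecidableEq κ] (c : Fin N → κ)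
    (x : Fin N → ℝ) (h : ∀ i j, i < j → c i ≠ c j → x j < x i) :
    ∏ b, signProd (fun j : {j // c j = b} => x j) = signProd x := by
  simp only [signProd_eq_prod_prod]
  rw [prod_prod_fiber c fun b i => ∏ j : {j // c j = b},
    if i < j then Real.sign (x i - x j) else 1]
  refine Finset.prod_congr rfl fun i _ => ?_
  have h1 : ∏ j ∈ Finset.univ.filter (fun j => c j = c i),
      (if i < j then Real.sign (x i - x j) else 1) =
      ∏ j : {j // c j = c i}, if i < (j : Fin N) then Real.sign (x i - x j) else 1 :=
    Finset.prod_subtype _ (by simp) _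
  have h2 : ∏ j : {j // c j = c i}, (if (⟨i, rfl⟩ : {j // c j = c i}) < j then
      Real.sign (x i - x j) else 1) =
      ∏ j : {j // c j = c i}, if i < (j : Fin N) then Real.sign (x i - x j) else 1 := rfl
  rw [h2, ← h1, Finset.prod_filter]
  refine Finset.prod_congr rfl fun j _ => ?_
  by_cases hc : c j = c i
  · rw [if_pos hc]
  -- Pairs from different fibers contribute `+1`, by the assumed ordering.
  · rw [if_neg hc]
    split_ifs with hij
    · rw [Real.sign_of_pos (sub_pos.mpr (h i j hij (Ne.symm hc)))]
    · rfl

/-- Signs and sums over permutations depend on a `DecidableEq` instance; the one coming from the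
linear order is replaced here by an arbitrary one. -/
theorem eigenAmplitude_eq (ℓ : ℝ) {ι : Type*} [Fintype ι] [LinearOrder ι] [DecidableEq ι]
    (k x : ι → ℝ) : eigenAmplitude ℓ k x =
      ((((Fintype.card ι).factorial : ℝ) * Real.sqrt ℓ ^ Fintype.card ι : ℝ) : ℂ)⁻¹ *
        (∑ σ : Equiv.Perm ι, ((Equiv.Perm.sign σ : ℤ) : ℂ) *
          Complex.exp (I * ∑ j, (x j : ℂ) * (k (σ j) : ℂ))) * (signProd x : ℂ) := by
  unfold eigenAmplitude
  congr!

/-- A permutation of the fiber keeps every label in the box `b`, so the indicators do not depend on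
it and can be absorbed into the plane waves, giving wavelets. -/
theorem eigenAmplitude_mul_indicator (L : ℝ) {n N : ℕ} (α : Fin N → WaveletLabel n)
    (x : Fin N → ℝ) (b : Fin n) :
    eigenAmplitude (L / n) (fun j : {j : Fin N // (α j).2 = b} => momentum L (α j)) (fun j => x j) *
      ∏ j : {j : Fin N // (α j).2 = b}, (box L n b).indicator (fun _ => (1 : ℂ)) (x j) =
    (signProd (fun j : {j : Fin N // (α j).2 = b} => x j) : ℂ) *
      (((Fintype.card {j : Fin N // (α j).2 = b}).factorial : ℂ)⁻¹ *
        ∑ σ : Equiv.Perm {j : Fin N // (α j).2 = b}, ((Equiv.Perm.sign σ : ℤ) : ℂ) *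
          ∏ j, waveletFun L (α (σ j)) (x j)) := by
  have h : ∀ σ : Equiv.Perm {j : Fin N // (α j).2 = b}, ∏ j, waveletFun L (α (σ j)) (x j) =
      ((Real.sqrt (L / n) : ℂ) ^ Fintype.card {j : Fin N // (α j).2 = b})⁻¹ *
        Complex.exp (I * ∑ j : {j : Fin N // (α j).2 = b},
          (x j : ℂ) * (momentum L (α (σ j)) : ℂ)) *
        ∏ j : {j : Fin N // (α j).2 = b}, (box L n b).indicator (fun _ => (1 : ℂ)) (x j) := by
    intro σ
    have hb : ∀ j : {j : Fin N // (α j).2 = b}, waveletFun L (α (σ j)) (x j) =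
        (Real.sqrt (L / n) : ℂ)⁻¹ * Complex.exp (I * ((x j : ℂ) * (momentum L (α (σ j)) : ℂ))) *
          (box L n b).indicator (fun _ => (1 : ℂ)) (x j) := by
      intro j
      rw [waveletFun, (σ j).2, Complex.ofReal_inv]
    simp only [hb]
    rw [Finset.prod_mul_distrib, Finset.prod_mul_distrib, Finset.prod_const, Finset.card_univ,
      inv_pow, ← Complex.exp_sum, Finset.mul_sum]
  simp only [h, eigenAmplitude_eq]
  push_cast
  rw [mul_inv]
  simp only [Finset.mul_sum, Finset.sum_mul]
  refine Finset.sum_congr rfl fun σ _ => ?_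
  ring

/-- The antisymmetrised product of the wavelets with labels `α`. -/
def slaterWavelet (L : ℝ) {n N : ℕ} (α : Fin N → WaveletLabel n) (x : Fin N → ℝ) : ℂ :=
  ∑ κ : Equiv.Perm (Fin N), ((Equiv.Perm.sign κ : ℤ) : ℂ) * ∏ i, waveletFun L (α (κ i)) (x i)

theorem sum_sign_prod_inv {N : ℕ} (f : Fin N → Fin N → ℂ) :
    ∑ κ : Equiv.Perm (Fin N), ((Equiv.Perm.sign κ : ℤ) : ℂ) * ∏ i, f i (κ i) =
      ∑ κ : Equiv.Perm (Fin N), ((Equiv.Perm.sign κ : ℤ) : ℂ) * ∏ i, f (κ i) i := by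
  have h1 := Matrix.det_apply' (Matrix.of f)
  have h2 := Matrix.det_apply' (Matrix.of f).transpose
  rw [Matrix.det_transpose, h1] at h2
  simpa using h2.symm

/-- For labels in decreasing order of the boxes, the wavelet amplitude is the sign factor times a
product of Slater determinants. -/
theorem waveletAmplitude_eq {L : ℝ} (hL : 0 < L) {n N : ℕ} {α : Fin N → WaveletLabel n}
    (hα : Antitone fun i => (α i).2) (x : Fin N → ℝ) :
    waveletAmplitude L α x = (signProd x : ℂ) *
      ((∏ b : Fin n, ((Fintype.card {j : Fin N // (α j).2 = b}).factorial : ℂ)⁻¹) *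
        ∑ σ : ∀ b : Fin n, Equiv.Perm {j : Fin N // (α j).2 = b},
          ((Equiv.Perm.sign (fiberPerm (fun j => (α j).2) σ) : ℤ) : ℂ) *
            ∏ i, waveletFun L (α (fiberPerm (fun j => (α j).2) σ i)) (x i)) := by
  have hsum : ∏ b : Fin n, ∑ σ : Equiv.Perm {j : Fin N // (α j).2 = b},
      ((Equiv.Perm.sign σ : ℤ) : ℂ) * ∏ j, waveletFun L (α (σ j)) (x j) =
      ∑ σ : ∀ b : Fin n, Equiv.Perm {j : Fin N // (α j).2 = b},
          ((Equiv.Perm.sign (fiberPerm (fun j => (α j).2) σ) : ℤ) : ℂ) *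
            ∏ i, waveletFun L (α (fiberPerm (fun j => (α j).2) σ i)) (x i) := by
    rw [Finset.prod_univ_sum, Fintype.piFinset_univ]
    refine Finset.sum_congr rfl fun σ _ => ?_
    rw [Finset.prod_mul_distrib, sign_fiberPerm, prod_prod_fiber (fun j => (α j).2)
      fun b j => waveletFun L (α (σ b j)) (x j)]
    push_cast
    rfl
  rw [waveletAmplitude]
  simp only [eigenAmplitude_mul_indicator]
  rw [Finset.prod_mul_distrib, Finset.prod_mul_distrib, hsum]
  -- If every particle is in the box of its label, the decreasing order of the labels orders
  -- particles of different boxes and the signs factorise. Otherwise every product of wavelets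
  -- vanishes, and with it both sides.
  by_cases hx : ∀ i, x i ∈ box L n (α i).2
  · rw [← signProd_eq_prod_fiber (fun j => (α j).2) x]
    · push_cast
      rfl
    · intro i j hij hne
      exact lt_of_mem_box hL (lt_of_le_of_ne (hα hij.le) (Ne.symm hne)) (hx j) (hx i)
  · obtain ⟨i, hi⟩ := not_forall.mp hx
    have hzero : ∀ σ : ∀ b : Fin n, Equiv.Perm {j : Fin N // (α j).2 = b},
        ∏ i, waveletFun L (α (fiberPerm (fun j => (α j).2) σ i)) (x i) = 0 := by
      intro σ
      refine Finset.prod_eq_zero (Finset.mem_univ i) ?_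
      have h2 : (α (fiberPerm (fun j => (α j).2) σ i)).2 = (α i).2 :=
        (σ (α i).2 ⟨i, rfl⟩).2
      rw [waveletFun, h2, Set.indicator_of_notMem hi, mul_zero]
    simp [hzero]

/-- Symmetrisation meets the antisymmetric sign factor and becomes antisymmetrisation. Every choice
of permutations inside the boxes then gives the same full Slater sum by reindexing, and the number
`∏ N_b!` of choices cancels the normalisation. -/
theorem bosonize_waveletAmplitude {L : ℝ} (hL : 0 < L) {n N : ℕ} {α : Fin N → WaveletLabel n}
    (hα : Antitone fun i => (α i).2) (x : Fin N → ℝ) :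
    bosonize (waveletAmplitude L α) x = (signProd x : ℂ) *
      ((((Real.sqrt (N.factorial : ℝ))⁻¹ : ℝ) : ℂ) * slaterWavelet L α x) := by
  let c : Fin N → Fin n := fun j => (α j).2
  let C : ℂ := ∏ b : Fin n, ((Fintype.card {j : Fin N // (α j).2 = b}).factorial : ℂ)⁻¹
  have hfix : ∀ σ : ∀ b : Fin n, Equiv.Perm {j : Fin N // (α j).2 = b},
      ∑ κ : Equiv.Perm (Fin N), ((Equiv.Perm.sign κ : ℤ) : ℂ) *
        (((Equiv.Perm.sign (fiberPerm c σ) : ℤ) : ℂ) *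
          ∏ i, waveletFun L (α (fiberPerm c σ i)) (x (κ i))) = slaterWavelet L α x := by
    intro σ
    rw [slaterWavelet, ← sum_sign_prod_inv fun i j => waveletFun L (α i) (x j),
      ← Equiv.sum_comp (Equiv.mulRight (fiberPerm c σ))
        fun κ => ((Equiv.Perm.sign κ : ℤ) : ℂ) *
          (((Equiv.Perm.sign (fiberPerm c σ) : ℤ) : ℂ) *
            ∏ i, waveletFun L (α (fiberPerm c σ i)) (x (κ i)))]
    refine Finset.sum_congr rfl fun κ _ => ?_
    rw [Equiv.coe_mulRight, Equiv.Perm.sign_mul,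
      ← Equiv.prod_comp (fiberPerm c σ) fun i => waveletFun L (α i) (x (κ i))]
    push_cast
    rw [mul_assoc, ← mul_assoc (((Equiv.Perm.sign (fiberPerm c σ) : ℤ) : ℂ)), sign_mul_sign,
      one_mul]
    rfl
  have hcard : C * (Fintype.card (∀ b : Fin n, Equiv.Perm {j : Fin N // (α j).2 = b}) : ℂ) = 1 := by
    rw [Fintype.card_pi]
    push_cast
    rw [← Finset.prod_mul_distrib]
    refine Finset.prod_eq_one fun b _ => ?_
    rw [Fintype.card_perm]
    exact inv_mul_cancel₀ (by exact_mod_cast Nat.factorial_ne_zero _)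
  have hamp : ∀ κ : Equiv.Perm (Fin N), waveletAmplitude L α (x ∘ κ) = (signProd x : ℂ) * (C *
      ∑ σ : ∀ b : Fin n, Equiv.Perm {j : Fin N // (α j).2 = b},
        ((Equiv.Perm.sign κ : ℤ) : ℂ) * (((Equiv.Perm.sign (fiberPerm c σ) : ℤ) : ℂ) *
          ∏ i, waveletFun L (α (fiberPerm c σ i)) (x (κ i)))) := by
    intro κ
    rw [waveletAmplitude_eq hL hα, signProd_perm, ← Finset.mul_sum]
    push_cast
    simp only [Function.comp_apply]
    ring
  rw [bosonize, mul_left_comm]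
  congr 1
  simp only [hamp]
  rw [← Finset.mul_sum, ← Finset.mul_sum, Finset.sum_comm, Finset.sum_congr rfl fun σ _ => hfix σ,
    Finset.sum_const, Finset.card_univ, nsmul_eq_mul, ← mul_assoc C, hcard, one_mul]

/-! ### Slater determinants and form factors. -/

/-- The Slater determinant of wavelets in the space of distinguishable particles. -/
def slaterVec {L : ℝ} (hL : 0 < L) {n N : ℕ} (hn : 0 < n) (α : Fin N → WaveletLabel n) :
    ConfigSpace L N :=
  ∑ κ : Equiv.Perm (Fin N), ((Equiv.Perm.sign κ : ℤ) : ℂ) •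
    tensor L N fun i => waveletBasis hL hn (α (κ i))

theorem coeFn_slaterVec {L : ℝ} (hL : 0 < L) {n N : ℕ} (hn : 0 < n) (α : Fin N → WaveletLabel n) :
    slaterVec hL hn α =ᵐ[ringMeasure L N] slaterWavelet L α := by
  have h1 : ∀ᵐ x ∂(ringMeasure L N), ∀ κ : Equiv.Perm (Fin N),
      (((Equiv.Perm.sign κ : ℤ) : ℂ) •
        tensor L N fun i => waveletBasis hL hn (α (κ i)) : ConfigSpace L N) x =
        ((Equiv.Perm.sign κ : ℤ) : ℂ) * ∏ i, waveletFun L (α (κ i)) (x i) := by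
    refine ae_all_iff.mpr fun κ => ?_
    simp only [waveletBasis_apply]
    rw [tensor_apply, tensorFun_toLp fun i => memLp_waveletFun L (α (κ i))]
    filter_upwards [Lp.coeFn_smul ((Equiv.Perm.sign κ : ℤ) : ℂ)
      ((memLp_prod L fun i => memLp_waveletFun L (α (κ i))).toLp _ : ConfigSpace L N),
      (memLp_prod L fun i => memLp_waveletFun L (α (κ i))).coeFn_toLp] with x h1 h2
    rw [h1, Pi.smul_apply, h2, smul_eq_mul]
  filter_upwards [h1, Lp.coeFn_finsetSum Finset.univ fun κ : Equiv.Perm (Fin N) =>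
    ((Equiv.Perm.sign κ : ℤ) : ℂ) • tensor L N fun i => waveletBasis hL hn (α (κ i))] with x h1 h2
  rw [slaterVec, h2, Finset.sum_apply, Finset.sum_congr rfl fun κ _ => h1 κ]
  rfl

theorem signOp_waveletState {L : ℝ} (hL : 0 < L) {n N : ℕ} (hn : 0 < n)
    {α : Fin N → WaveletLabel n} (hα : Antitone fun i => (α i).2) :
    signOp L N (waveletState L α : ConfigSpace L N) =
      (((Real.sqrt (N.factorial : ℝ))⁻¹ : ℝ) : ℂ) • slaterVec hL hn α := by
  refine Lp.ext ?_
  filter_upwards [coeFn_signOp (waveletState L α : ConfigSpace L N),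
    (memLp_bosonize (memLp_waveletAmplitude L α)).coeFn_toLp, ae_injective L N,
    Lp.coeFn_smul (((Real.sqrt (N.factorial : ℝ))⁻¹ : ℝ) : ℂ) (slaterVec hL hn α),
    coeFn_slaterVec hL hn α] with x h1 h2 hx h3 h4
  rw [h1, h3, Pi.smul_apply, h4]
  change (signProd x : ℂ) * (memLp_bosonize (memLp_waveletAmplitude L α)).toLp _ x = _
  rw [h2, bosonize_waveletAmplitude hL hα, ← mul_assoc, ← Complex.ofReal_mul,
    signProd_mul_self hx, Complex.ofReal_one, one_mul, smul_eq_mul]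

/-- For fixed `κ`, replacing `τ` by `τ κ` turns the inner sum into the Leibniz formula, so each `κ`
contributes one determinant. -/
theorem sum_sum_sign_prod {N : ℕ} (A : Fin N → Fin N → ℂ) :
    ∑ κ : Equiv.Perm (Fin N), ∑ τ : Equiv.Perm (Fin N),
      ((Equiv.Perm.sign κ : ℤ) : ℂ) * (((Equiv.Perm.sign τ : ℤ) : ℂ) * ∏ i, A (κ i) (τ i)) =
      (N.factorial : ℂ) * Matrix.det (Matrix.of A) := by
  have h : ∀ κ : Equiv.Perm (Fin N), ∑ τ : Equiv.Perm (Fin N),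
      ((Equiv.Perm.sign κ : ℤ) : ℂ) * (((Equiv.Perm.sign τ : ℤ) : ℂ) * ∏ i, A (κ i) (τ i)) =
      Matrix.det (Matrix.of A) := by
    intro κ
    rw [Matrix.det_apply', ← Equiv.sum_comp (Equiv.mulRight κ)]
    refine Eq.trans ?_ (sum_sign_prod_inv A)
    refine Finset.sum_congr rfl fun τ _ => ?_
    rw [Equiv.coe_mulRight, Equiv.Perm.sign_mul,
      ← Equiv.prod_comp κ fun i => A i (τ i)]
    push_cast
    rw [← mul_assoc, mul_comm (((Equiv.Perm.sign τ : ℤ) : ℂ)), ← mul_assoc, sign_mul_sign, one_mul]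
    rfl
  rw [Finset.sum_congr rfl fun κ _ => h κ, Finset.sum_const, Finset.card_univ, Fintype.card_perm,
    Fintype.card_fin, nsmul_eq_mul]

/-- The form factors of the evolution operator are determinants. -/
theorem inner_waveletState_bosonEvolution {L : ℝ} (hL : 0 < L) {n N : ℕ} (hn : 0 < n)
    {v : Fin n → ℝ → ℝ} (hv : ∀ b, Continuous (v b)) (t : ℝ) {α β : Fin N → WaveletLabel n}
    (hα : Antitone fun i => (α i).2) (hβ : Antitone fun i => (β i).2) :
    inner ℂ (waveletState L α) (bosonEvolution hL hv N t (waveletState L β)) =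
      Matrix.det (Matrix.of fun i j => inner ℂ (waveletBasis hL hn (α i))
        (ringEvolution hL hv t (waveletBasis hL hn (β j)))) := by
  have h0 : inner ℂ (waveletState L α) (bosonEvolution hL hv N t (waveletState L β)) =
      inner ℂ (waveletState L α : ConfigSpace L N)
        (bosonEvolution hL hv N t (waveletState L β) : ConfigSpace L N) := rfl
  have hN : (0 : ℝ) < N.factorial := by exact_mod_cast N.factorial_pos
  have hN' : (N.factorial : ℂ) ≠ 0 := by exact_mod_cast N.factorial_ne_zero
  -- The sign factors on both sides are absorbed into the states, which become Slater vectors. Their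
  -- two factors `1 / √N!` combine to `1 / N!` and cancel the `N!` of the double sum over
  -- permutations.
  rw [h0, coe_bosonEvolution, ← inner_signOp_left, signOp_waveletState hL hn hα,
    signOp_waveletState hL hn hβ, map_smul, inner_smul_left, inner_smul_right, Complex.conj_ofReal,
    ← mul_assoc, inv_sqrt_mul_self hN, inv_mul_eq_iff_eq_mul₀ (by exact_mod_cast hN'),
    Complex.ofReal_natCast, ← sum_sum_sign_prod, slaterVec, slaterVec, map_sum, sum_inner]
  refine Finset.sum_congr rfl fun κ _ => ?_
  rw [inner_sum]
  refine Finset.sum_congr rfl fun τ _ => ?_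
  rw [map_smul, inner_smul_left, inner_smul_right, configEvolution_tensor, inner_tensor]
  simp

end HardcoreBosons

end

theorem theorem1 (L : ℝ) (hL : 0 < L) (n : ℕ) (hn : 0 < n)
    (v : Fin n → ℝ → ℝ) (hv : ∀ b, Continuous (v b)) :
    -- the series for `G_t` and `U_t` converge absolutely
    (∀ (t : ℝ) (a c : HardcoreBosons.WaveletLabel n),
      Summable (HardcoreBosons.greenTerm L t a c)) ∧
    (∀ (t : ℝ) (a c : HardcoreBosons.WaveletLabel n),
      Summable fun g : HardcoreBosons.WaveletLabel n =>
        HardcoreBosons.green L (-t) a g * (v g.2 t : ℂ) * HardcoreBosons.green L t g c) ∧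
    -- the differential equation has exactly one solution, and its series converge absolutely
    ∃ ψt : ℝ → HardcoreBosons.WaveletLabel n → HardcoreBosons.WaveletLabel n → ℂ,
      HardcoreBosons.IsInteractionSolution L v ψt ∧
      (∀ ψt', HardcoreBosons.IsInteractionSolution L v ψt' → ψt' = ψt) ∧
      (∀ (t : ℝ) (a c : HardcoreBosons.WaveletLabel n),
        Summable fun ν => HardcoreBosons.generator L v t a ν * ψt t ν c) ∧
      (∀ (t : ℝ) (a c : HardcoreBosons.WaveletLabel n),
        Summable fun g => HardcoreBosons.green L t a g * ψt t g c) ∧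
      -- for every even number of particles the evolution operator exists, is unique, and has the
      -- determinantal form factors
      ∀ N : ℕ, Even N →
        ∃ U : ℝ → HardcoreBosons.BosonSpace L N →L[ℂ] HardcoreBosons.BosonSpace L N,
          HardcoreBosons.IsEvolutionOperator L v N U ∧
          (∀ U', HardcoreBosons.IsEvolutionOperator L v N U' → U' = U) ∧
          ∀ (t : ℝ) (α β : Fin N → HardcoreBosons.WaveletLabel n),
            Function.Injective α → Antitone (fun i => (α i).2) →
            Function.Injective β → Antitone (fun i => (β i).2) →
            inner ℂ (HardcoreBosons.waveletState L α) (U t (HardcoreBosons.waveletState L β)) =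
              Matrix.det (Matrix.of fun i j => HardcoreBosons.psi L ψt t (α i) (β j)) := by
  refine ⟨fun t a c => (HardcoreBosons.hasSum_greenTerm hL hn t a c).summable,
    fun t a c => (HardcoreBosons.hasSum_generator hL hn v t a c).summable,
    HardcoreBosons.interactionMatrix hL hn hv,
    HardcoreBosons.isInteractionSolution_interactionMatrix hL hn hv,
    fun ψ hψ => HardcoreBosons.eq_interactionMatrix hL hn hv hψ,
    HardcoreBosons.summable_generator_mul hL hn hv,
    fun t a c => (HardcoreBosons.hasSum_psi hL hn hv t a c).summable, fun N hN =>
    ⟨HardcoreBosons.bosonEvolution hL hv N,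
      HardcoreBosons.isEvolutionOperator_bosonEvolution hL hv hN,
      fun U hU => HardcoreBosons.eq_bosonEvolution hL hv hN hU, fun t α β _ hα _ hβ => ?_⟩⟩
  simp only [HardcoreBosons.psi_interactionMatrix]
  exact HardcoreBosons.inner_waveletState_bosonEvolution hL hn hv t hα hβ
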